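/- **Setting.** Fix a many-sorted first-order signature with an interpretation (for example the sort $\mathbb N$ with $0,1,+,\times$). Parameter expressions $p$ over a parameter context $\Theta$ (a finite list of sorted parameters) are its terms; constraints are $C ::= \mathbb T \mid R(\vec p) \mid p=q \mid C\wedge C \mid C\Rightarrow C \mid \exists\Psi.C \mid \forall\Psi.C$. Types of polarity $+$ (data) and $-$ (computations) are built from type variables $X(\vec p)$, type constructors $T(\vec A,\vec p)$ (type arguments may abstract over parameters), closures $\Downarrow\! A^-$, thunks $\Uparrow\! A^+$, $!A^-$ and $\mathbf{Fix}\,A^-$. Every positive (negative) type constructor $T(\vec X,\vec n)$ is defined by finitely many value (stack) constructors $K$, each with fresh parameters $\Theta_K$, a guard $C_K(\Theta_K,\vec n)$, positive argument types $\vec A_K(\vec X,\Theta_K,\vec n)$ and, in the negative case, a continuation type $B_K(\vec X,\Theta_K,\vec n)$ of polarity $-$; definitions may be recursive. The types $!A$ and $\mathbf{Fix}\,A$ are called shareable. The terms of the $\mathbf{ILL}$-machine are (all binders up to renaming) - commands $c ::= \langle V^{\pm}|S^{\pm}\rangle \mid \langle V^+|\mu\mathbf{del}.c\rangle \mid \langle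 V^+|\mu\mathbf{dup}(x,y).c\rangle$; - $V^+ ::= x^+ \mid K(\vec V^+) \mid {\Downarrow}(V^-) \mid \mu({!}\cdot\alpha^-).c \mid \mu(\mathbf{fix}\cdot\alpha^-).\langle\mathbf{self}|S^+\rangle$; - $S^+ ::= \alpha^+ \mid \mu x^+.c \mid \mu(\overrightarrow{K(\vec x^+).c}) \mid \mu{\Downarrow}(x^-).c \mid {!}\cdot S^- \mid \mathbf{fix}\cdot S^-$; - $V^- ::= x^- \mid \mu\alpha^-.c \mid \mu(\overrightarrow{(K(\vec x^+)\cdot\alpha^-).c}) \mid \mu({\Uparrow}\cdot\alpha^+).c$; - $S^- ::= \alpha^- \mid K(\vec V^+)\cdot S^- \mid {\Uparrow}\cdot S^+$, and the one-step reduction is $\langle\mu\alpha.c|S\rangle\to c[S/\alpha]$; $\langle V|\mu x.c\rangle\to c[V/x]$; $\langle V|\mu\mathbf{del}.c\rangle\to c$; $\langle V|\mu\mathbf{dup}(x,y).c\rangle\to c[V/x,V/y]$; $\langle{\Downarrow}(V)|\mu{\Downarrow}(x).c\rangle\to c[V/x]$; $\langle\mu({\Uparrow}\cdot\alpha).c|{\Uparrow}\cdot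 S\rangle\to c[S/\alpha]$; $\langle K_j(\vec V)|\mu(\overrightarrow{K_i(\vec x_i).c_i})\rangle\to c_j[\vec V/\vec x_j]$; $\langle\mu(\overrightarrow{(K_i(\vec x_i)\cdot\alpha_i).c_i})|K_j(\vec V)\cdot S\rangle\to c_j[\vec V/\vec x_j,S/\alpha_j]$; $\langle\mu({!}\cdot\alpha).c|{!}\cdot S\rangle\to c[S/\alpha]$; $\langle W|\mathbf{fix}\cdot S'\rangle\to\langle W|S[S'/\alpha]\rangle$ for $W=\mu(\mathbf{fix}\cdot\alpha).\langle\mathbf{self}|S\rangle$. **Typing.** Judgements are $\Theta;C;\Gamma\vdash V:A$, $\;\Theta;C;\Gamma\mid S:A\vdash\Delta$ and $c:(\Theta;C;\Gamma\vdash\Delta)$, where $\Gamma$ types value variables and $\Delta=(\alpha:A)$ is a single stack variable. In the rules, $\Gamma,\Gamma'$ is a union that is disjoint except for variables of shareable type, and each judgement may use parameters that it does not need. - Axioms $\Theta;\mathbb T;x:A\vdash x:A$ and $\Theta;\mathbb T;\cdot\mid\alpha:A\vdash\alpha:A$. Cut: from $\Theta;C;\Gamma\vdash V:A$ and $\Theta;C';\Gamma'\mid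 S:A\vdash\Delta$ infer $\langle V|S\rangle:(\Theta;C\wedge C';\Gamma,\Gamma'\vdash\Delta)$. - $\mu\alpha.c:A^-$ if $c:(\Theta;C;\Gamma\vdash\alpha:A^-)$; $\mu x.c:A^+$ if $c:(\Theta;C;\Gamma,x:A^+\vdash\Delta)$, with the same constraint. Likewise, keeping the constraint, ${\Downarrow}(V)$, $\mu{\Downarrow}(x).c$ have type ${\Downarrow}A$ if $V:A$, respectively $x:A$ in $c$; $\mu({\Uparrow}\cdot\alpha).c$, ${\Uparrow}\cdot S$ have type ${\Uparrow}A$ if $\alpha:A$, respectively $S:A$; $\mu(!\cdot\alpha).c$, $!\cdot S$ have type $!A$ if $\alpha:A$, respectively $S:A$; $\mathbf{fix}\cdot S$ has type $\mathbf{Fix}\,A$ if $S:A$, and $\mu(\mathbf{fix}\cdot\alpha).\langle\mathbf{self}|S\rangle$ has type $\mathbf{Fix}\,A$ if $\Theta;C;\Gamma\mid S:\mathbf{Fix}\,A\vdash\alpha:A$. In the rules for $\mu(!\cdot\alpha).c$ and $\mu(\mathbf{fix}\cdot\alpha).\langle\mathbf{self}|S\rangle$ all types in $\Gamma$ must be shareable.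 - If $\Theta;C;\Gamma\vdash V:A$ with $A$ shareable, then $\langle V|\mu\mathbf{del}.c\rangle$ and $\langle V|\mu\mathbf{dup}(x,y).c\rangle$ have type $(\Theta;C\wedge C';\Gamma,\Gamma'\vdash\Delta)$ if $c:(\Theta;C';\Gamma'\vdash\Delta)$, respectively $c:(\Theta;C';\Gamma',x:A,y:A\vdash\Delta)$. - Constructors, with $\Theta_K$ fresh: if $\Theta_K,\Theta;C_i;\Gamma_i\vdash V_i:A_{K,i}$ for all $i$, then $\Theta;\exists\Theta_K.(C_K\wedge\bigwedge_iC_i);\vec\Gamma\vdash K(\vec V):T(\vec A,\vec p)$; a stack $K(\vec V)\cdot S$ is typed in the same way, with the further premise $\Theta_K,\Theta;C';\Gamma'\mid S:B_K\vdash\Delta$ and the further conjunct $C'$. - Pattern matching, with $\Theta_K$ fresh: if $c_K:(\Theta_K,\Theta;C'_K;\Gamma,\vec x:\vec A_K\vdash\Delta)$ for all $K$, then $\Theta;\bigwedge_K\forall\Theta_K.(C_K\Rightarrow C'_K);\Gamma\mid\mu(\overrightarrow{K(\vec x).c_K}):T(\vec A,\vec p)\vdash\Delta$; a value $\mu(\overrightarrow{(K(\vec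 x)\cdot\alpha).c_K})$ is typed in the same way, with $\alpha:B_K$ in place of $\Delta$. - Conversion: if $A$ and $B$ differ only in their parameter expressions, and corresponding expressions are equal for all instantiations satisfying $E$, then a value or stack of type $A$ with constraint $C$ also has type $B$ with constraint $C\wedge E$. - Hiding: if $c:(\Psi,\Theta;C;\Gamma\vdash\Delta)$ and the parameters $\Psi$ do not occur in $\Gamma,\Delta$, then $c:(\Theta;\exists\Psi.C;\Gamma\vdash\Delta)$. **Theorem (Soundness).** If $c:(\Theta;C;\Gamma\vdash\Delta)$ and $c\to c'$, then $c'$ has a typing $c':(\Theta';C';\Gamma'\vdash\Delta')$ such that $\Theta'\subseteq\Theta$, $\Gamma'\subseteq\Gamma$, $\Delta=\Delta'$, and, for every instantiation of the parameters $\Theta$, $C$ implies $C'$. -/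

import Mathlib

namespace ILL

/-! ## Polarities, variables, parameter theories -/

/-- The two base sorts of types: data (`+`) and computations (`-`). -/
inductive Pol
  | pos
  | neg
  deriving DecidableEq

/-- `Var l a`: a position of the list `l` that holds `a` (an intrinsically sorted de Bruijn
index). -/
inductive Var {α : Type} : List α → α → Type
  | here {a : α} {l : List α} : Var (a :: l) a
  | there {a b : α} {l : List α} : Var l a → Var (b :: l) a

namespace Var

variable {α : Type}

def inl {l' : List α} : {l : List α} → {a : α} → Var l a → Var (l ++ l') a
  | _, _, .here => .here
  | _, _, .there x => .there (inl x)

def inr {l' : List α} : (l : List α) → {a : α} → Var l' a → Var (l ++ l') a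
  | [], _, x => x
  | _ :: l, _, x => .there (inr l x)

/-- Case analysis on a variable of a concatenated list. -/
def append {l' : List α} {X : α → Type} : (l : List α) →
    (∀ a, Var l a → X a) → (∀ a, Var l' a → X a) → ∀ a, Var (l ++ l') a → X a
  | [], _, g, a, x => g a x
  | _ :: _, f, _, _, .here => f _ .here
  | _ :: l, f, g, a, .there x => append l (fun a y => f a (.there y)) g a x

end Var

/-- The language of parameters: an arbitrary many-sorted first-order signature together with its
intended interpretation, e.g. the sort `ℕ` with `0, 1, +, ×`. -/
structure ParamTheory where
  Srt : Type
  Fn : List Srt → Srt → Type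
  Rel : List Srt → Type
  carrier : Srt → Type
  fn : ∀ {dom s}, Fn dom s → (∀ t, Var dom t → carrier t) → carrier s
  rel : ∀ {dom}, Rel dom → (∀ t, Var dom t → carrier t) → Prop

/-- A parameter context `Θ`, a list of sorted parameters. -/
abbrev PCtx (P : ParamTheory) := List P.Srt

/-- Instantiations of the parameters `Θ`. -/
abbrev Valuation (P : ParamTheory) (Θ : PCtx P) := ∀ s, Var Θ s → P.carrier s

/-- Parameter expressions `p`. -/
inductive Ix (P : ParamTheory) (Θ : PCtx P) : P.Srt → Type
  | var {s} (x : Var Θ s) : Ix P Θ s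
  | app {dom s} (f : P.Fn dom s) (args : ∀ t, Var dom t → Ix P Θ t) : Ix P Θ s

/-- Simultaneous substitutions of parameter expressions over `Θ'` for the parameters `Θ`; also the
tuples of expressions over `Θ'` whose sorts are listed by `Θ`. -/
abbrev Sub (P : ParamTheory) (Θ Θ' : PCtx P) := ∀ s, Var Θ s → Ix P Θ' s

variable {P : ParamTheory}

namespace Ix

def eval {Θ : PCtx P} (v : Valuation P Θ) : {s : P.Srt} → Ix P Θ s → P.carrier s
  | _, .var x => v _ x
  | _, .app f args => P.fn f (fun t x => (args t x).eval v)

def subst {Θ Θ' : PCtx P} (σ : Sub P Θ Θ') : {s : P.Srt} → Ix P Θ s → Ix P Θ' s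
  | _, .var x => σ _ x
  | _, .app f args => .app f (fun t x => (args t x).subst σ)

end Ix

namespace Sub

def ids (Θ : PCtx P) : Sub P Θ Θ := fun _ x => .var x

def comp {Θ₁ Θ₂ Θ₃ : PCtx P} (σ : Sub P Θ₁ Θ₂) (τ : Sub P Θ₂ Θ₃) : Sub P Θ₁ Θ₃ :=
  fun s x => (σ s x).subst τ

/-- Weakening by the fresh parameters `Ψ`. -/
def wk (Ψ Θ : PCtx P) : Sub P Θ (Ψ ++ Θ) := fun _ x => .var (Var.inr Ψ x)

/-- Going under a binder for the parameters `Ψ`. -/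
def lift (Ψ : PCtx P) {Θ Θ' : PCtx P} (σ : Sub P Θ Θ') : Sub P (Ψ ++ Θ) (Ψ ++ Θ') :=
  Var.append Ψ (fun _ x => .var (Var.inl x)) (σ.comp (wk Ψ Θ'))

end Sub

/-- First-order constraints over the parameters `Θ`. -/
inductive Constraint (P : ParamTheory) : PCtx P → Type
  | top {Θ} : Constraint P Θ
  | rel {Θ dom} (R : P.Rel dom) (args : Sub P dom Θ) : Constraint P Θ
  | eq {Θ s} (p q : Ix P Θ s) : Constraint P Θ
  | and {Θ} (C D : Constraint P Θ) : Constraint P Θ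
  | imp {Θ} (C D : Constraint P Θ) : Constraint P Θ
  | ex {Θ} (Ψ : PCtx P) (C : Constraint P (Ψ ++ Θ)) : Constraint P Θ
  | all {Θ} (Ψ : PCtx P) (C : Constraint P (Ψ ++ Θ)) : Constraint P Θ

namespace Constraint

/-- Truth of a constraint under an instantiation of its parameters. -/
def Holds : {Θ : PCtx P} → Constraint P Θ → Valuation P Θ → Prop
  | _, .top, _ => True
  | _, .rel R args, v => P.rel R (fun t x => (args t x).eval v)
  | _, .eq p q, v => p.eval v = q.eval v
  | _, .and C D, v => C.Holds v ∧ D.Holds v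
  | _, .imp C D, v => C.Holds v → D.Holds v
  | _, .ex Ψ C, v => ∃ w : Valuation P Ψ, C.Holds (Var.append Ψ w v)
  | _, .all Ψ C, v => ∀ w : Valuation P Ψ, C.Holds (Var.append Ψ w v)

def subst : {Θ Θ' : PCtx P} → Constraint P Θ → Sub P Θ Θ' → Constraint P Θ'
  | _, _, .top, _ => .top
  | _, _, .rel R args, σ => .rel R (Sub.comp args σ)
  | _, _, .eq p q, σ => .eq (p.subst σ) (q.subst σ)
  | _, _, .and C D, σ => .and (C.subst σ) (D.subst σ)
  | _, _, .imp C D, σ => .imp (C.subst σ) (D.subst σ)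
  | _, _, .ex Ψ C, σ => .ex Ψ (C.subst (σ.lift Ψ))
  | _, _, .all Ψ C, σ => .all Ψ (C.subst (σ.lift Ψ))

/-- Finite conjunctions. -/
def conj {Θ : PCtx P} : {n : ℕ} → (Fin n → Constraint P Θ) → Constraint P Θ
  | 0, _ => .top
  | _ + 1, C => .and (C 0) (conj (fun i => C i.succ))

end Constraint

/-! ## Types -/

/-- The sorts `𝒫 → ⋯ → 𝒫 → ±` of types that depend on parameters. -/
structure Kind (P : ParamTheory) where
  params : PCtx P
  pol : Pol

/-- Type constructors with their sorts: `T : kinds → indices → ε`. -/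
structure TypeSig (P : ParamTheory) where
  TCon : Pol → Type
  kinds : ∀ {ε}, TCon ε → List (Kind P)
  indices : ∀ {ε}, TCon ε → PCtx P

/-- Types of polarity `ε` with type variables `Ξ` and parameters `Θ`. A type argument of sort
`𝒫⃗ → ±` is a type in which the parameters `𝒫⃗` are bound. -/
inductive Ty (Sg : TypeSig P) (Ξ : List (Kind P)) : PCtx P → Pol → Type
  | tvar {Θ Ψ ε} (X : Var Ξ ⟨Ψ, ε⟩) (args : Sub P Ψ Θ) : Ty Sg Ξ Θ ε
  | con {Θ ε} (T : Sg.TCon ε)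
      (targs : ∀ κ, Var (Sg.kinds T) κ → Ty Sg Ξ (κ.params ++ Θ) κ.pol)
      (idx : Sub P (Sg.indices T) Θ) : Ty Sg Ξ Θ ε
  /-- closures over a computation -/
  | clos {Θ} (A : Ty Sg Ξ Θ .neg) : Ty Sg Ξ Θ .pos
  /-- thunks returning data -/
  | thunk {Θ} (A : Ty Sg Ξ Θ .pos) : Ty Sg Ξ Θ .neg
  /-- `!A` -/
  | bang {Θ} (A : Ty Sg Ξ Θ .neg) : Ty Sg Ξ Θ .pos
  /-- `Fix A` -/
  | fix {Θ} (A : Ty Sg Ξ Θ .neg) : Ty Sg Ξ Θ .pos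

/-- Type arguments for the sorts `Ξ'`. -/
abbrev TArgs (Sg : TypeSig P) (Ξ Ξ' : List (Kind P)) (Θ : PCtx P) :=
  ∀ κ : Kind P, Var Ξ' κ → Ty Sg Ξ (κ.params ++ Θ) κ.pol

namespace Ty

variable {Sg : TypeSig P} {Ξ Ξ' : List (Kind P)}

/-- Substitution of parameter expressions in types. -/
def subst : {Θ Θ' : PCtx P} → {ε : Pol} → Ty Sg Ξ Θ ε → Sub P Θ Θ' → Ty Sg Ξ Θ' ε
  | _, _, _, .tvar X args, σ => .tvar X (Sub.comp args σ)
  | _, _, _, .con T a i, σ => .con T (fun κ X => (a κ X).subst (σ.lift κ.params)) (Sub.comp i σ)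
  | _, _, _, .clos A, σ => .clos (A.subst σ)
  | _, _, _, .thunk A, σ => .thunk (A.subst σ)
  | _, _, _, .bang A, σ => .bang (A.subst σ)
  | _, _, _, .fix A, σ => .fix (A.subst σ)

/-- Simultaneous substitution of parameter expressions for parameters and of types for type
variables. -/
def inst : {Θ Θ' : PCtx P} → {ε : Pol} →
    Ty Sg Ξ' Θ ε → Sub P Θ Θ' → TArgs Sg Ξ Ξ' Θ' → Ty Sg Ξ Θ' ε
  | _, Θ', _, .tvar (Ψ := Ψ) X args, σ, τ =>
      (τ _ X).subst (Var.append Ψ (Sub.comp args σ) (Sub.ids Θ'))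
  | _, Θ', _, .con T a i, σ, τ =>
      .con T (fun κ X => (a κ X).inst (σ.lift κ.params)
        (fun κ' Y => (τ κ' Y).subst (Sub.lift κ'.params (Sub.wk κ.params Θ')))) (Sub.comp i σ)
  | _, _, _, .clos A, σ, τ => .clos (A.inst σ τ)
  | _, _, _, .thunk A, σ, τ => .thunk (A.inst σ τ)
  | _, _, _, .bang A, σ, τ => .bang (A.inst σ τ)
  | _, _, _, .fix A, σ, τ => .fix (A.inst σ τ)

/-- `A.Conv H B`: the types `A` and `B` differ only in their parameter expressions, and
corresponding expressions have the same value under all instantiations that satisfy `H`. -/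
inductive Conv : {Θ : PCtx P} → {ε : Pol} → Ty Sg Ξ Θ ε → (Valuation P Θ → Prop) →
    Ty Sg Ξ Θ ε → Prop
  | tvar {Θ : PCtx P} {Ψ : PCtx P} {ε : Pol} {H : Valuation P Θ → Prop} (X : Var Ξ ⟨Ψ, ε⟩)
      {i j : Sub P Ψ Θ}
      (hi : ∀ v, H v → ∀ s x, (i s x).eval v = (j s x).eval v) :
      Conv (.tvar X i) H (.tvar X j)
  | con {Θ : PCtx P} {ε : Pol} {H : Valuation P Θ → Prop} (T : Sg.TCon ε)
      {a b : TArgs Sg Ξ (Sg.kinds T) Θ} {i j : Sub P (Sg.indices T) Θ}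
      (ha : ∀ κ X, Conv (a κ X) (fun w => H (fun s x => w s (Var.inr κ.params x))) (b κ X))
      (hi : ∀ v, H v → ∀ s x, (i s x).eval v = (j s x).eval v) :
      Conv (.con T a i) H (.con T b j)
  | clos {Θ : PCtx P} {H : Valuation P Θ → Prop} {A B : Ty Sg Ξ Θ .neg} (h : Conv A H B) :
      Conv (.clos A) H (.clos B)
  | thunk {Θ : PCtx P} {H : Valuation P Θ → Prop} {A B : Ty Sg Ξ Θ .pos} (h : Conv A H B) :
      Conv (.thunk A) H (.thunk B)
  | bang {Θ : PCtx P} {H : Valuation P Θ → Prop} {A B : Ty Sg Ξ Θ .neg} (h : Conv A H B) :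
      Conv (.bang A) H (.bang B)
  | fix {Θ : PCtx P} {H : Valuation P Θ → Prop} {A B : Ty Sg Ξ Θ .neg} (h : Conv A H B) :
      Conv (.fix A) H (.fix B)

/-- The types that are subject to weakening and contraction: `!A` and `Fix A`. -/
inductive Shareable : {Θ : PCtx P} → {ε : Pol} → Ty Sg Ξ Θ ε → Prop
  | bang {Θ : PCtx P} (A : Ty Sg Ξ Θ .neg) : Shareable (.bang A)
  | fix {Θ : PCtx P} (A : Ty Sg Ξ Θ .neg) : Shareable (.fix A)

end Ty

/-! ## Definitions of datatypes and computation types -/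

/-- A value constructor `K of arg 0 ⊗ ⋯ where params with guard` of a datatype whose type and index
parameters are `Ξ` and `I`. -/
structure DataCtor (Sg : TypeSig P) (Ξ : List (Kind P)) (I : PCtx P) where
  params : PCtx P
  guard : Constraint P (params ++ I)
  arity : ℕ
  arg : Fin arity → Ty Sg Ξ (params ++ I) .pos

/-- A stack constructor `K(arg 0, …) · cont where params with guard` of a computation type. -/
structure CompCtor (Sg : TypeSig P) (Ξ : List (Kind P)) (I : PCtx P) extends
    DataCtor Sg Ξ I where
  cont : Ty Sg Ξ (params ++ I) .neg

/-- Definitions of all the type constructors by their (finitely many) constructors. The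
definitions may be mutually recursive. -/
structure Decls (Sg : TypeSig P) where
  numData : Sg.TCon .pos → ℕ
  data : ∀ T, Fin (numData T) → DataCtor Sg (Sg.kinds T) (Sg.indices T)
  numComp : Sg.TCon .neg → ℕ
  comp : ∀ T, Fin (numComp T) → CompCtor Sg (Sg.kinds T) (Sg.indices T)

namespace DataCtor

variable {Sg : TypeSig P} {Ξ Ξ' : List (Kind P)} {I Θ : PCtx P}

/-- The guard of a constructor at the indices `i`, with the parameters of the constructor fresh. -/
def guardAt (K : DataCtor Sg Ξ' I) (i : Sub P I Θ) : Constraint P (K.params ++ Θ) :=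
  K.guard.subst (i.lift K.params)

/-- Type arguments, weakened by the parameters of a constructor. -/
def wkArgs (Ψ : PCtx P) (a : TArgs Sg Ξ Ξ' Θ) : TArgs Sg Ξ Ξ' (Ψ ++ Θ) :=
  fun κ X => (a κ X).subst (Sub.lift κ.params (Sub.wk Ψ Θ))

/-- The types of the arguments of a constructor of the type with type arguments `a` and
indices `i`. -/
def argAt (K : DataCtor Sg Ξ' I) (a : TArgs Sg Ξ Ξ' Θ) (i : Sub P I Θ) (k : Fin K.arity) :
    Ty Sg Ξ (K.params ++ Θ) .pos :=
  (K.arg k).inst (i.lift K.params) (wkArgs K.params a)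

end DataCtor

/-- The type of the continuation of a stack constructor. -/
def CompCtor.contAt {Sg : TypeSig P} {Ξ Ξ' : List (Kind P)} {I Θ : PCtx P}
    (K : CompCtor Sg Ξ' I) (a : TArgs Sg Ξ Ξ' Θ) (i : Sub P I Θ) :
    Ty Sg Ξ (K.params ++ Θ) .neg :=
  K.cont.inst (i.lift K.params) (DataCtor.wkArgs K.params a)

/-! ## Terms -/

inductive Side
  | val
  | stk
  deriving DecidableEq

/-- Syntactic categories: commands, and values and stacks of either polarity. -/
inductive Cat
  | cmd
  | term (k : Side) (ε : Pol)

variable {Sg : TypeSig P}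

/-- Raw terms. There are four kinds of variables, `x⁺`, `x⁻`, `α⁺`, `α⁻`, each with its own
namespace of de Bruijn indices; an index beyond the enclosing binders of its kind is the name of a
free variable. -/
inductive Expr (D : Decls Sg) : Cat → Type
  /-- `x^ε` or `α^ε` -/
  | var (k : Side) (ε : Pol) (i : ℕ) : Expr D (.term k ε)
  /-- `⟨V | S⟩` -/
  | cut (ε : Pol) (V : Expr D (.term .val ε)) (S : Expr D (.term .stk ε)) : Expr D .cmd
  /-- `⟨V | μ del.c⟩` -/
  | del (V : Expr D (.term .val .pos)) (c : Expr D .cmd) : Expr D .cmd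
  /-- `⟨V | μ dup(x,y).c⟩`; `c` binds `x⁺ = 0` and `y⁺ = 1` -/
  | dup (V : Expr D (.term .val .pos)) (c : Expr D .cmd) : Expr D .cmd
  /-- the stack `μ x⁺.c` -/
  | letVal (c : Expr D .cmd) : Expr D (.term .stk .pos)
  /-- the value `μ α⁻.c` -/
  | letStk (c : Expr D .cmd) : Expr D (.term .val .neg)
  /-- the value `K(V⃗)` -/
  | data (T : Sg.TCon .pos) (K : Fin (D.numData T))
      (V : Fin (D.data T K).arity → Expr D (.term .val .pos)) : Expr D (.term .val .pos)
  /-- the stack `μ(K(x⃗).c | ⋯)`; the branch of `K` binds `x⁺ᵢ = i` for `i < arity` -/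
  | dataCase (T : Sg.TCon .pos) (c : Fin (D.numData T) → Expr D .cmd) :
      Expr D (.term .stk .pos)
  /-- the stack `K(V⃗) · S` -/
  | comp (T : Sg.TCon .neg) (K : Fin (D.numComp T))
      (V : Fin (D.comp T K).arity → Expr D (.term .val .pos))
      (S : Expr D (.term .stk .neg)) : Expr D (.term .stk .neg)
  /-- the value `μ((K(x⃗) · α).c | ⋯)`; the branch of `K` binds `x⁺ᵢ = i` and `α⁻ = 0` -/
  | compCase (T : Sg.TCon .neg) (c : Fin (D.numComp T) → Expr D .cmd) :
      Expr D (.term .val .neg)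
  /-- the value `closure(V)` -/
  | clos (V : Expr D (.term .val .neg)) : Expr D (.term .val .pos)
  /-- the stack `μ closure(x⁻).c` -/
  | closCase (c : Expr D .cmd) : Expr D (.term .stk .pos)
  /-- the value `μ(thunk · α⁺).c` -/
  | thunkCase (c : Expr D .cmd) : Expr D (.term .val .neg)
  /-- the stack `thunk · S` -/
  | thunk (S : Expr D (.term .stk .pos)) : Expr D (.term .stk .neg)
  /-- the value `μ(! · α⁻).c` -/
  | bangCase (c : Expr D .cmd) : Expr D (.term .val .pos)
  /-- the stack `! · S` -/
  | bang (S : Expr D (.term .stk .neg)) : Expr D (.term .stk .pos)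
  /-- the value `μ(fix · α⁻).⟨self | S⟩` -/
  | fixCase (S : Expr D (.term .stk .pos)) : Expr D (.term .val .pos)
  /-- the stack `fix · S` -/
  | fix (S : Expr D (.term .stk .neg)) : Expr D (.term .stk .pos)

abbrev Command (D : Decls Sg) := Expr D .cmd
abbrev Value (D : Decls Sg) (ε : Pol) := Expr D (.term .val ε)
abbrev Stack (D : Decls Sg) (ε : Pol) := Expr D (.term .stk ε)

/-- Renamings of the four kinds of variables. -/
abbrev Ren := Side → Pol → ℕ → ℕ

namespace Ren

/-- Make room for `n` new variables of kind `(k, ε)`. -/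
def shift (k : Side) (ε : Pol) (n : ℕ) : Ren :=
  fun k' ε' i => if k' = k ∧ ε' = ε then i + n else i

/-- Go under a binder of `n` variables of kind `(k, ε)`. -/
def lift (k : Side) (ε : Pol) (n : ℕ) (ρ : Ren) : Ren :=
  fun k' ε' i => if k' = k ∧ ε' = ε then (if i < n then i else ρ k' ε' (i - n) + n) else ρ k' ε' i

end Ren

variable {D : Decls Sg}

namespace Expr

def rename : {t : Cat} → Expr D t → Ren → Expr D t
  | _, .var k ε i, ρ => .var k ε (ρ k ε i)
  | _, .cut ε V S, ρ => .cut ε (V.rename ρ) (S.rename ρ)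
  | _, .del V c, ρ => .del (V.rename ρ) (c.rename ρ)
  | _, .dup V c, ρ => .dup (V.rename ρ) (c.rename (ρ.lift .val .pos 2))
  | _, .letVal c, ρ => .letVal (c.rename (ρ.lift .val .pos 1))
  | _, .letStk c, ρ => .letStk (c.rename (ρ.lift .stk .neg 1))
  | _, .data T K V, ρ => .data T K (fun i => (V i).rename ρ)
  | _, .dataCase T c, ρ =>
      .dataCase T (fun K => (c K).rename (ρ.lift .val .pos (D.data T K).arity))
  | _, .comp T K V S, ρ => .comp T K (fun i => (V i).rename ρ) (S.rename ρ)
  | _, .compCase T c, ρ =>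
      .compCase T (fun K =>
        (c K).rename ((ρ.lift .val .pos (D.comp T K).arity).lift .stk .neg 1))
  | _, .clos V, ρ => .clos (V.rename ρ)
  | _, .closCase c, ρ => .closCase (c.rename (ρ.lift .val .neg 1))
  | _, .thunkCase c, ρ => .thunkCase (c.rename (ρ.lift .stk .pos 1))
  | _, .thunk S, ρ => .thunk (S.rename ρ)
  | _, .bangCase c, ρ => .bangCase (c.rename (ρ.lift .stk .neg 1))
  | _, .bang S, ρ => .bang (S.rename ρ)
  | _, .fixCase S, ρ => .fixCase (S.rename (ρ.lift .stk .neg 1))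
  | _, .fix S, ρ => .fix (S.rename ρ)

end Expr

/-- Simultaneous substitutions of values and stacks for variables. -/
abbrev Subst (D : Decls Sg) := ∀ (k : Side) (ε : Pol), ℕ → Expr D (.term k ε)

namespace Subst

def ids : Subst D := fun k ε i => .var k ε i

/-- Substitute `t` for the first `n` variables of kind `(k, ε)`, and continue with `σ`. -/
def push (σ : Subst D) (k : Side) (ε : Pol) (n : ℕ) (t : Fin n → Expr D (.term k ε)) : Subst D :=
  Function.update σ k (Function.update (σ k) ε
    (fun i => if h : i < n then t ⟨i, h⟩ else σ k ε (i - n)))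

/-- Go under a binder of `n` variables of kind `(k, ε)`. -/
def lift (k : Side) (ε : Pol) (n : ℕ) (σ : Subst D) : Subst D :=
  push (fun k' ε' i => (σ k' ε' i).rename (Ren.shift k ε n)) k ε n (fun i => .var k ε i)

end Subst

namespace Expr

def subst : {t : Cat} → Expr D t → Subst D → Expr D t
  | _, .var k ε i, σ => σ k ε i
  | _, .cut ε V S, σ => .cut ε (V.subst σ) (S.subst σ)
  | _, .del V c, σ => .del (V.subst σ) (c.subst σ)
  | _, .dup V c, σ => .dup (V.subst σ) (c.subst (σ.lift .val .pos 2))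
  | _, .letVal c, σ => .letVal (c.subst (σ.lift .val .pos 1))
  | _, .letStk c, σ => .letStk (c.subst (σ.lift .stk .neg 1))
  | _, .data T K V, σ => .data T K (fun i => (V i).subst σ)
  | _, .dataCase T c, σ =>
      .dataCase T (fun K => (c K).subst (σ.lift .val .pos (D.data T K).arity))
  | _, .comp T K V S, σ => .comp T K (fun i => (V i).subst σ) (S.subst σ)
  | _, .compCase T c, σ =>
      .compCase T (fun K =>
        (c K).subst ((σ.lift .val .pos (D.comp T K).arity).lift .stk .neg 1))
  | _, .clos V, σ => .clos (V.subst σ)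
  | _, .closCase c, σ => .closCase (c.subst (σ.lift .val .neg 1))
  | _, .thunkCase c, σ => .thunkCase (c.subst (σ.lift .stk .pos 1))
  | _, .thunk S, σ => .thunk (S.subst σ)
  | _, .bangCase c, σ => .bangCase (c.subst (σ.lift .stk .neg 1))
  | _, .bang S, σ => .bang (S.subst σ)
  | _, .fixCase S, σ => .fixCase (S.subst (σ.lift .stk .neg 1))
  | _, .fix S, σ => .fix (S.subst σ)

/-- `e[t⃗/x⃗]` for the first `n` variables of kind `(k, ε)`. -/
def bind {t : Cat} (e : Expr D t) (k : Side) (ε : Pol) (n : ℕ)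
    (u : Fin n → Expr D (.term k ε)) : Expr D t :=
  e.subst (Subst.ids.push k ε n u)

/-- `e[t/x]` for the first variable of kind `(k, ε)`. -/
def bind₁ {t : Cat} {k : Side} {ε : Pol} (e : Expr D t) (u : Expr D (.term k ε)) : Expr D t :=
  e.bind k ε 1 (fun _ => u)

end Expr

/-- One step of reduction of the machine. -/
inductive Step : Command D → Command D → Prop
  | letStk (c : Command D) (S : Stack D .neg) :
      Step (.cut .neg (.letStk c) S) (c.bind₁ S)
  | letVal (V : Value D .pos) (c : Command D) :
      Step (.cut .pos V (.letVal c)) (c.bind₁ V)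
  | del (V : Value D .pos) (c : Command D) :
      Step (.del V c) c
  | dup (V : Value D .pos) (c : Command D) :
      Step (.dup V c) (c.bind .val .pos 2 (fun _ => V))
  | clos (V : Value D .neg) (c : Command D) :
      Step (.cut .pos (.clos V) (.closCase c)) (c.bind₁ V)
  | thunk (c : Command D) (S : Stack D .pos) :
      Step (.cut .neg (.thunkCase c) (.thunk S)) (c.bind₁ S)
  | data (T : Sg.TCon .pos) (K : Fin (D.numData T))
      (V : Fin (D.data T K).arity → Value D .pos) (c : Fin (D.numData T) → Command D) :
      Step (.cut .pos (.data T K V) (.dataCase T c)) ((c K).bind .val .pos _ V)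
  | comp (T : Sg.TCon .neg) (K : Fin (D.numComp T))
      (V : Fin (D.comp T K).arity → Value D .pos) (S : Stack D .neg)
      (c : Fin (D.numComp T) → Command D) :
      Step (.cut .neg (.compCase T c) (.comp T K V S))
        ((c K).subst ((Subst.ids.push .val .pos _ V).push .stk .neg 1 (fun _ => S)))
  | bang (c : Command D) (S : Stack D .neg) :
      Step (.cut .pos (.bangCase c) (.bang S)) (c.bind₁ S)
  /-- The whole fixpoint, in which the bound `α` is untouched, is put in place of `self`. -/
  | fix (S : Stack D .pos) (S' : Stack D .neg) :
      Step (.cut .pos (.fixCase S) (.fix S')) (.cut .pos (.fixCase S) (S.bind₁ S'))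

/-! ## Typing -/

/-- Contexts `Γ` of value variables. -/
abbrev Ctx (Sg : TypeSig P) (Ξ : List (Kind P)) (Θ : PCtx P) :=
  ∀ ε : Pol, ℕ → Option (Ty Sg Ξ Θ ε)

/-- Contexts `Δ = (α : A)`, with exactly one stack variable. -/
structure CoCtx (Sg : TypeSig P) (Ξ : List (Kind P)) (Θ : PCtx P) where
  pol : Pol
  name : ℕ
  ty : Ty Sg Ξ Θ pol

variable {Ξ : List (Kind P)} {Θ Θ' : PCtx P}

namespace Ctx

def empty : Ctx Sg Ξ Θ := fun _ _ => none

/-- The context `x : A`. -/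
def single (ε : Pol) (i : ℕ) (A : Ty Sg Ξ Θ ε) : Ctx Sg Ξ Θ :=
  Function.update empty ε (Function.update (fun _ => none) i (some A))

/-- `Γ, x⃗ : A⃗`, for the variables bound by a binder of `n` value variables. -/
def push (Γ : Ctx Sg Ξ Θ) (ε : Pol) (n : ℕ) (A : Fin n → Ty Sg Ξ Θ ε) : Ctx Sg Ξ Θ :=
  Function.update Γ ε (fun i => if h : i < n then some (A ⟨i, h⟩) else Γ ε (i - n))

def subst (Γ : Ctx Sg Ξ Θ) (σ : Sub P Θ Θ') : Ctx Sg Ξ Θ' :=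
  fun ε i => (Γ ε i).map (fun A => A.subst σ)

/-- Inclusion of contexts. -/
def Incl (Γ Γ' : Ctx Sg Ξ Θ) : Prop := ∀ ε i A, Γ ε i = some A → Γ' ε i = some A

/-- All variables have shareable types. -/
def AllShareable (Γ : Ctx Sg Ξ Θ) : Prop := ∀ ε i A, Γ ε i = some A → A.Shareable

/-- `Γ` is the union of the contexts `Γs`, which are disjoint except for variables of shareable
type. -/
structure Merge {ι : Type} (Γs : ι → Ctx Sg Ξ Θ) (Γ : Ctx Sg Ξ Θ) : Prop where
  incl : ∀ k, (Γs k).Incl Γ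
  cover : ∀ ε i A, Γ ε i = some A → ∃ k, Γs k ε i = some A
  linear : ∀ k l ε i A B, k ≠ l → Γs k ε i = some A → Γs l ε i = some B → A.Shareable

end Ctx

def CoCtx.subst (Δ : CoCtx Sg Ξ Θ) (σ : Sub P Θ Θ') : CoCtx Sg Ξ Θ' :=
  ⟨Δ.pol, Δ.name, Δ.ty.subst σ⟩

/-- The three forms of judgements: `Θ; C; Γ ⊢ V : A`, `Θ; C; Γ | S : A ⊢ Δ` and
`c : (Θ; C; Γ ⊢ Δ)`. -/
inductive Sequent (D : Decls Sg) (Ξ : List (Kind P)) : Type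
  | val {ε : Pol} (Θ : PCtx P) (C : Constraint P Θ) (Γ : Ctx Sg Ξ Θ) (V : Value D ε)
      (A : Ty Sg Ξ Θ ε)
  | stk {ε : Pol} (Θ : PCtx P) (C : Constraint P Θ) (Γ : Ctx Sg Ξ Θ) (S : Stack D ε)
      (A : Ty Sg Ξ Θ ε) (Δ : CoCtx Sg Ξ Θ)
  | cmd (c : Command D) (Θ : PCtx P) (C : Constraint P Θ) (Γ : Ctx Sg Ξ Θ) (Δ : CoCtx Sg Ξ Θ)

open Constraint in
/-- Derivability of judgements. The premises of a rule share one parameter context `Θ`, the union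
of those needed for each of them. -/
inductive Derivable : Sequent D Ξ → Prop
  | var {Θ ε i A} : Derivable (.val Θ top (Ctx.single ε i A) (.var .val ε i) A)
  | covar {Θ ε i A} : Derivable (.stk Θ top Ctx.empty (.var .stk ε i) A ⟨ε, i, A⟩)
  /-- Types that are equal under a constraint may be exchanged by adding the constraint. -/
  | convVal {Θ C E Γ ε} {V : Value D ε} {A B} (hV : Derivable (.val Θ C Γ V A))
      (hE : A.Conv E.Holds B) : Derivable (.val Θ (and C E) Γ V B)
  | convStk {Θ C E Γ ε Δ} {S : Stack D ε} {A B} (hS : Derivable (.stk Θ C Γ S A Δ))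
      (hE : A.Conv E.Holds B) : Derivable (.stk Θ (and C E) Γ S B Δ)
  /-- Parameters that do not occur in the interface are hidden existentially. -/
  | hide {Θ Ψ C Γ Δ c}
      (hc : Derivable (.cmd c (Ψ ++ Θ) C (Ctx.subst Γ (Sub.wk Ψ Θ)) (CoCtx.subst Δ (Sub.wk Ψ Θ)))) :
      Derivable (.cmd c Θ (ex Ψ C) Γ Δ)
  | cut {Θ C C' Γ₁ Γ₂ Γ Δ ε V S A} (hV : Derivable (.val Θ C Γ₁ V A))
      (hS : Derivable (.stk Θ C' Γ₂ S A Δ)) (hΓ : Ctx.Merge ![Γ₁, Γ₂] Γ) :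
      Derivable (.cmd (.cut ε V S) Θ (and C C') Γ Δ)
  | del {Θ C C' Γ₁ Γ₂ Γ Δ V c A} (hV : Derivable (.val Θ C Γ₁ V A)) (hA : A.Shareable)
      (hc : Derivable (.cmd c Θ C' Γ₂ Δ)) (hΓ : Ctx.Merge ![Γ₁, Γ₂] Γ) :
      Derivable (.cmd (.del V c) Θ (and C C') Γ Δ)
  | dup {Θ C C' Γ₁ Γ₂ Γ Δ V c A} (hV : Derivable (.val Θ C Γ₁ V A)) (hA : A.Shareable)
      (hc : Derivable (.cmd c Θ C' (Ctx.push Γ₂ .pos 2 (fun _ => A)) Δ))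
      (hΓ : Ctx.Merge ![Γ₁, Γ₂] Γ) :
      Derivable (.cmd (.dup V c) Θ (and C C') Γ Δ)
  | letStk {Θ C Γ c A} (hc : Derivable (.cmd c Θ C Γ ⟨.neg, 0, A⟩)) :
      Derivable (.val Θ C Γ (.letStk c) A)
  | letVal {Θ C Γ Δ c A} (hc : Derivable (.cmd c Θ C (Ctx.push Γ .pos 1 (fun _ => A)) Δ)) :
      Derivable (.stk Θ C Γ (.letVal c) A Δ)
  | data {Θ T K V} {a : TArgs Sg Ξ (Sg.kinds T) Θ} {i : Sub P (Sg.indices T) Θ}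
      {C : Fin (D.data T K).arity → Constraint P ((D.data T K).params ++ Θ)}
      {Γs : Fin (D.data T K).arity → Ctx Sg Ξ Θ} {Γ}
      (hV : ∀ k, Derivable (.val ((D.data T K).params ++ Θ) (C k)
        ((Γs k).subst (Sub.wk _ Θ)) (V k) ((D.data T K).argAt a i k)))
      (hΓ : Ctx.Merge Γs Γ) :
      Derivable (.val Θ (ex (D.data T K).params (and ((D.data T K).guardAt i) (conj C))) Γ
        (.data T K V) (.con T a i))
  | dataCase {Θ T c} {a : TArgs Sg Ξ (Sg.kinds T) Θ} {i : Sub P (Sg.indices T) Θ}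
      {C : ∀ K : Fin (D.numData T), Constraint P ((D.data T K).params ++ Θ)} {Γ Δ}
      (hc : ∀ K, Derivable (.cmd (c K) ((D.data T K).params ++ Θ) (C K)
        (Ctx.push (Ctx.subst Γ (Sub.wk _ Θ)) .pos _ ((D.data T K).argAt a i))
        (CoCtx.subst Δ (Sub.wk _ Θ)))) :
      Derivable (.stk Θ
        (conj (fun K => all (D.data T K).params (imp ((D.data T K).guardAt i) (C K)))) Γ
        (.dataCase T c) (.con T a i) Δ)
  | comp {Θ T K V S} {a : TArgs Sg Ξ (Sg.kinds T) Θ} {i : Sub P (Sg.indices T) Θ}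
      {C : Fin (D.comp T K).arity → Constraint P ((D.comp T K).params ++ Θ)}
      {C' : Constraint P ((D.comp T K).params ++ Θ)}
      {Γs : Fin (D.comp T K).arity → Ctx Sg Ξ Θ} {Γ' Γ Δ}
      (hV : ∀ k, Derivable (.val ((D.comp T K).params ++ Θ) (C k)
        ((Γs k).subst (Sub.wk _ Θ)) (V k) ((D.comp T K).argAt a i k)))
      (hS : Derivable (.stk ((D.comp T K).params ++ Θ) C'
        (Ctx.subst Γ' (Sub.wk _ Θ)) S ((D.comp T K).contAt a i) (CoCtx.subst Δ (Sub.wk _ Θ))))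
      (hΓ : Ctx.Merge (fun o : Option (Fin (D.comp T K).arity) => o.elim Γ' Γs) Γ) :
      Derivable (.stk Θ
        (ex (D.comp T K).params (and ((D.comp T K).guardAt i) (and (conj C) C'))) Γ
        (.comp T K V S) (.con T a i) Δ)
  | compCase {Θ T c} {a : TArgs Sg Ξ (Sg.kinds T) Θ} {i : Sub P (Sg.indices T) Θ}
      {C : ∀ K : Fin (D.numComp T), Constraint P ((D.comp T K).params ++ Θ)} {Γ}
      (hc : ∀ K, Derivable (.cmd (c K) ((D.comp T K).params ++ Θ) (C K)
        (Ctx.push (Ctx.subst Γ (Sub.wk _ Θ)) .pos _ ((D.comp T K).argAt a i))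
        ⟨.neg, 0, (D.comp T K).contAt a i⟩)) :
      Derivable (.val Θ
        (conj (fun K => all (D.comp T K).params (imp ((D.comp T K).guardAt i) (C K)))) Γ
        (.compCase T c) (.con T a i))
  | clos {Θ C Γ V A} (hV : Derivable (.val Θ C Γ V A)) :
      Derivable (.val Θ C Γ (.clos V) (.clos A))
  | closCase {Θ C Γ Δ c A} (hc : Derivable (.cmd c Θ C (Ctx.push Γ .neg 1 (fun _ => A)) Δ)) :
      Derivable (.stk Θ C Γ (.closCase c) (.clos A) Δ)
  | thunkCase {Θ C Γ c A} (hc : Derivable (.cmd c Θ C Γ ⟨.pos, 0, A⟩)) :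
      Derivable (.val Θ C Γ (.thunkCase c) (.thunk A))
  | thunk {Θ C Γ Δ S A} (hS : Derivable (.stk Θ C Γ S A Δ)) :
      Derivable (.stk Θ C Γ (.thunk S) (.thunk A) Δ)
  | bangCase {Θ C Γ c A} (hΓ : Ctx.AllShareable Γ)
      (hc : Derivable (.cmd c Θ C Γ ⟨.neg, 0, A⟩)) :
      Derivable (.val Θ C Γ (.bangCase c) (.bang A))
  | bang {Θ C Γ Δ S A} (hS : Derivable (.stk Θ C Γ S A Δ)) :
      Derivable (.stk Θ C Γ (.bang S) (.bang A) Δ)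
  | fixCase {Θ C Γ S A} (hΓ : Ctx.AllShareable Γ)
      (hS : Derivable (.stk Θ C Γ S (.fix A) ⟨.neg, 0, A⟩)) :
      Derivable (.val Θ C Γ (.fixCase S) (.fix A))
  | fix {Θ C Γ Δ S A} (hS : Derivable (.stk Θ C Γ S A Δ)) :
      Derivable (.stk Θ C Γ (.fix S) (.fix A) Δ)

/-- `c : (Θ; C; Γ ⊢ Δ)`. -/
def TypedCommand (c : Command D) (Θ : PCtx P) (C : Constraint P Θ) (Γ : Ctx Sg Ξ Θ)
    (Δ : CoCtx Sg Ξ Θ) : Prop :=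
  Derivable (.cmd c Θ C Γ Δ)

/-- An inclusion `Θ' ⊆ Θ` of parameter contexts. -/
structure ParamIncl (Θ' Θ : PCtx P) where
  map : ∀ s, Var Θ' s → Var Θ s
  injective : ∀ s, Function.Injective (map s)

namespace ParamIncl

/-- The inclusion as a substitution: everything over `Θ'` is also over `Θ`. -/
def sub (ι : ParamIncl Θ' Θ) : Sub P Θ' Θ := fun s x => .var (ι.map s x)

/-- The instantiation of `Θ'` given by an instantiation of `Θ`. -/
def restrict (ι : ParamIncl Θ' Θ) (v : Valuation P Θ) : Valuation P Θ' :=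
  fun s x => v s (ι.map s x)

end ParamIncl

end ILL

namespace ILL

/-! ## Parameter substitutions -/

namespace Var

variable {α : Type}

/-! The argument is subject reduction by inversion and substitution, with two complications: the
constraints that accumulate along a derivation, and linearity of contexts.

Only the truth of constraints matters, so `VTy`, `STy` and `CTy` express typability with some
constraint that follows from an arbitrary predicate `H` on instantiations. The typing rules become
closure properties of these three relations. In particular, hiding parameters only requires that
each instantiation satisfying `H` extends to the hidden parameters.

Derivations are stable under instantiation of parameters and injective renaming
(`Derivable.actStable`), which allows a term to be moved under binders. They are also stable under
simultaneous substitution (`Derivable.substStable`). There each substituted term carries its own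
context, and the resulting context is the union of those belonging to the variables that occur. A
variable occurring in two premises has shareable type. A value of shareable type uses only shareable
variables (`VTy.allShareable`), so the union remains legitimate when contexts are split.

By `Derivable.invertible`, every value or stack is typed by its introduction rule followed by a
conversion. The two sides of a cut are therefore introduced at convertible types, and conversion is
structural, so the component types are convertible too. When a constructor meets a pattern match,
one side provides values of the constructor's parameters that satisfy the guard, and the other side
provides an implication from the guard. Both are evaluated at the same values, the substitution is
carried out over the enlarged parameter context, and the parameters are hidden again.

`Derivable.reduces` combines these facts by induction on the typing of the command, where hiding is
the only rule not determined by syntax. Contexts shrink only through deletion, and all parameters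
can be kept. -/

theorem append_inl {l' : List α} {X : α → Type} :
    {l : List α} → (f : ∀ a, Var l a → X a) → (g : ∀ a, Var l' a → X a) → {a : α} →
    (x : Var l a) → append l f g a (inl x) = f a x
  | _, _, _, _, .here => rfl
  | _, f, g, _, .there x => append_inl (fun a y => f a (.there y)) g x

theorem append_inr {l' : List α} {X : α → Type} :
    {l : List α} → (f : ∀ a, Var l a → X a) → (g : ∀ a, Var l' a → X a) → {a : α} →
    (x : Var l' a) → append l f g a (inr l x) = g a x
  | [], _, _, _, _ => rfl
  | _ :: _, f, g, _, x => append_inr (fun a y => f a (.there y)) g x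

theorem inl_or_inr {l' : List α} : {l : List α} → {a : α} → (x : Var (l ++ l') a) →
    (∃ y, x = inl y) ∨ ∃ y, x = inr l y
  | [], _, x => .inr ⟨x, rfl⟩
  | _ :: _, _, .here => .inl ⟨.here, rfl⟩
  | _ :: _, _, .there x => by
      rcases inl_or_inr x with ⟨y, rfl⟩ | ⟨y, rfl⟩
      · exact .inl ⟨.there y, rfl⟩
      · exact .inr ⟨y, rfl⟩

theorem append_ext {l l' : List α} {X : α → Type} {F F' : ∀ a, Var (l ++ l') a → X a}
    (h : ∀ a (x : Var l a), F a (inl x) = F' a (inl x))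
    (h' : ∀ a (x : Var l' a), F a (inr l x) = F' a (inr l x)) : F = F' := by
  funext a x
  rcases inl_or_inr x with ⟨y, rfl⟩ | ⟨y, rfl⟩
  · exact h a y
  · exact h' a y

end Var

variable {P : ParamTheory} {Sg : TypeSig P} {D : Decls Sg} {Ξ Ξ' : List (Kind P)}
  {Θ Θ' Θ₁ Θ₂ Θ₃ : PCtx P}

/-- The instantiation of `Θ` obtained from one of `Θ'` along a substitution. -/
def Sub.eval (σ : Sub P Θ Θ') (v : Valuation P Θ') : Valuation P Θ :=
  fun s x => (σ s x).eval v

theorem Ix.eval_subst (σ : Sub P Θ Θ') (v : Valuation P Θ') {s : P.Srt} (p : Ix P Θ s) :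
    (p.subst σ).eval v = p.eval (σ.eval v) := by
  induction p with
  | var x => rfl
  | app f args ih => simp only [subst, eval, ih]

theorem Ix.subst_subst (σ : Sub P Θ₁ Θ₂) (τ : Sub P Θ₂ Θ₃) {s : P.Srt} (p : Ix P Θ₁ s) :
    (p.subst σ).subst τ = p.subst (σ.comp τ) := by
  induction p with
  | var x => rfl
  | app f args ih => simp only [subst, ih]

theorem Ix.subst_ids {s : P.Srt} (p : Ix P Θ s) : p.subst (Sub.ids Θ) = p := by
  induction p with
  | var x => rfl
  | app f args ih => simp only [subst, ih]

namespace Sub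

theorem comp_assoc {Θ₄ : PCtx P} (σ : Sub P Θ₁ Θ₂) (τ : Sub P Θ₂ Θ₃) (ρ : Sub P Θ₃ Θ₄) :
    (σ.comp τ).comp ρ = σ.comp (τ.comp ρ) := by
  funext s x; exact Ix.subst_subst _ _ _

theorem comp_ids (σ : Sub P Θ Θ') : σ.comp (ids Θ') = σ := by
  funext s x; exact Ix.subst_ids _

theorem ids_comp (σ : Sub P Θ Θ') : (ids Θ).comp σ = σ := rfl

theorem append_comp (Ψ : PCtx P) (f : Sub P Ψ Θ₂) (g : Sub P Θ₁ Θ₂) (ρ : Sub P Θ₂ Θ₃) :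
    comp (Var.append Ψ f g : Sub P (Ψ ++ Θ₁) Θ₂) ρ = Var.append Ψ (comp f ρ) (comp g ρ) := by
  apply Var.append_ext <;> intro a x <;> simp [comp, Var.append_inl, Var.append_inr]

/-- The β-law for parameter binders. It gives functoriality of `lift` and the type-variable case of
`Ty.subst_inst`. -/
theorem lift_comp_append (Ψ : PCtx P) (ρ : Sub P Θ₁ Θ₂) (f : Sub P Ψ Θ₃) (g : Sub P Θ₂ Θ₃) :
    (ρ.lift Ψ).comp (Var.append Ψ f g) = Var.append Ψ f (ρ.comp g) := by
  apply Var.append_ext <;> intro a x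
  · simp [comp, lift, Var.append_inl, Ix.subst]
  · simp only [comp, lift, Var.append_inr, Ix.subst_subst]
    congr 1
    funext s y
    simp [comp, wk, Ix.subst, Var.append_inr]

theorem wk_comp_lift (Ψ : PCtx P) (σ : Sub P Θ Θ') :
    (wk Ψ Θ).comp (σ.lift Ψ) = σ.comp (wk Ψ Θ') := by
  funext s x; simp [comp, lift, wk, Ix.subst, Var.append_inr]

theorem lift_comp (Ψ : PCtx P) (σ : Sub P Θ₁ Θ₂) (τ : Sub P Θ₂ Θ₃) :
    (σ.lift Ψ).comp (τ.lift Ψ) = (σ.comp τ).lift Ψ := by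
  refine (lift_comp_append Ψ σ _ _).trans ?_
  rw [← comp_assoc]
  rfl

theorem lift_ids (Ψ : PCtx P) : (ids Θ).lift Ψ = ids (Ψ ++ Θ) := by
  apply Var.append_ext <;> intro a x <;>
    simp [comp, lift, ids, wk, Ix.subst, Var.append_inl, Var.append_inr]

theorem eval_lift (Ψ : PCtx P) (σ : Sub P Θ Θ') (w : Valuation P Ψ) (v : Valuation P Θ') :
    (σ.lift Ψ).eval (Var.append Ψ w v) = Var.append Ψ w (σ.eval v) := by
  apply Var.append_ext <;> intro a x
  · simp [eval, lift, Var.append_inl, Ix.eval]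
  · simp only [eval, lift, comp, Var.append_inr, Ix.eval_subst]
    congr 1
    funext s y
    simp [eval, wk, Ix.eval, Var.append_inr]

theorem eval_wk_append (Ψ : PCtx P) (w : Valuation P Ψ) (v : Valuation P Θ) :
    (wk Ψ Θ).eval (Var.append Ψ w v) = v := by
  funext s x; simp [eval, wk, Ix.eval, Var.append_inr]

theorem eval_wk_lift (Ψ : PCtx P) (σ : Sub P Θ Θ') (w : Valuation P (Ψ ++ Θ')) :
    (wk Ψ Θ).eval ((σ.lift Ψ).eval w) = σ.eval ((wk Ψ Θ').eval w) := by
  funext s x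
  simp only [eval, wk, lift, Ix.eval, Var.append_inr, comp, Ix.eval_subst]

theorem eval_append (Ψ : PCtx P) (f : Sub P Ψ Θ') (g : Sub P Θ Θ') (v : Valuation P Θ') :
    eval (Var.append Ψ f g : Sub P (Ψ ++ Θ) Θ') v = Var.append Ψ (eval f v) (eval g v) := by
  apply Var.append_ext <;> intro a x <;> simp [eval, Var.append_inl, Var.append_inr]

theorem eval_comp (σ : Sub P Θ₁ Θ₂) (τ : Sub P Θ₂ Θ₃) (v : Valuation P Θ₃) :
    (σ.comp τ).eval v = σ.eval (τ.eval v) := by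
  funext s x; exact Ix.eval_subst _ _ _

/-- The step on parameter expressions in `Ty.Conv.subst`, shared by the arguments of type variables
and the indices of type constructors. -/
theorem eval_comp_congr {H : Valuation P Θ₂ → Prop} {i j : Sub P Θ₁ Θ₂} {σ τ : Sub P Θ₂ Θ₃}
    {H' : Valuation P Θ₃ → Prop} (hi : ∀ v, H v → ∀ s x, (i s x).eval v = (j s x).eval v)
    (hσ : ∀ v, H' v → σ.eval v = τ.eval v) (hH : ∀ v, H' v → H (σ.eval v)) (v : Valuation P Θ₃)
    (hv : H' v) (s : P.Srt) (x : Var Θ₁ s) : (i.comp σ s x).eval v = (j.comp τ s x).eval v := by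
  rw [comp, Ix.eval_subst, hi _ (hH v hv), hσ v hv, comp, Ix.eval_subst]

end Sub

/-- Splitting an instantiation into its bound and outer parts makes `Sub.eval_lift` applicable to
it. -/
theorem Valuation.append_surjective (Ψ : PCtx P) (v : Valuation P (Ψ ++ Θ)) :
    Var.append Ψ (fun _ x => v _ (Var.inl x)) ((Sub.wk Ψ Θ).eval v) = v := by
  apply Var.append_ext <;> intro a x <;>
    simp [Sub.eval, Sub.wk, Ix.eval, Var.append_inl, Var.append_inr]

/-- Under a quantifier, the lifted substitution leaves the values chosen for the bound parameters
alone (`Sub.eval_lift`). -/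
theorem Constraint.holds_subst (C : Constraint P Θ) (σ : Sub P Θ Θ') (v : Valuation P Θ') :
    (C.subst σ).Holds v ↔ C.Holds (σ.eval v) := by
  induction C generalizing Θ' with
  | top => rfl
  | rel R args => simp only [subst, Holds, Sub.comp, Ix.eval_subst]
  | eq p q => simp only [subst, Holds, Ix.eval_subst]
  | and C D ihC ihD => simp only [subst, Holds, ihC, ihD]
  | imp C D ihC ihD => simp only [subst, Holds, ihC, ihD]
  | ex Ψ C ih => simp only [subst, Holds, ih, Sub.eval_lift]
  | all Ψ C ih => simp only [subst, Holds, ih, Sub.eval_lift]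

theorem Constraint.holds_conj {n : ℕ} (C : Fin n → Constraint P Θ) (v : Valuation P Θ) :
    (conj C).Holds v ↔ ∀ k, (C k).Holds v := by
  induction n with
  | zero => simp [conj, Holds]
  | succ n ih => simp only [conj, Holds, ih, Fin.forall_fin_succ]

/-! ## Types -/

namespace Ty

theorem subst_subst {ε : Pol} (A : Ty Sg Ξ Θ₁ ε) (σ : Sub P Θ₁ Θ₂) (τ : Sub P Θ₂ Θ₃) :
    (A.subst σ).subst τ = A.subst (σ.comp τ) := by
  induction A generalizing Θ₂ Θ₃ with
  | tvar X args => simp only [subst, Sub.comp_assoc]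
  | con T a i ih => simp only [subst, Sub.comp_assoc, ih, Sub.lift_comp]
  | _ => simp only [subst, *]

theorem subst_ids {ε : Pol} (A : Ty Sg Ξ Θ ε) : A.subst (Sub.ids Θ) = A := by
  induction A with
  | tvar X args => simp only [subst, Sub.comp_ids]
  | con T a i ih => simp only [subst, Sub.comp_ids, Sub.lift_ids, ih]
  | _ => simp only [subst, *]

/-- The reason why the argument and continuation types of a constructor commute with instantiation
of the ambient parameters. Type arguments bind parameters of their own, so `ρ` reaches them lifted.
-/
theorem subst_inst {ε : Pol} (A : Ty Sg Ξ' Θ₁ ε) (σ : Sub P Θ₁ Θ₂) (τ : TArgs Sg Ξ Ξ' Θ₂)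
    (ρ : Sub P Θ₂ Θ₃) :
    (A.inst σ τ).subst ρ =
      A.inst (σ.comp ρ) (fun κ X => (τ κ X).subst (ρ.lift κ.params)) := by
  induction A generalizing Θ₂ Θ₃ with
  | tvar X args =>
    simp only [inst, subst_subst, Sub.lift_comp_append, Sub.append_comp, Sub.comp_assoc,
      Sub.ids_comp, Sub.comp_ids]
  | con T a i ih =>
    simp only [inst, subst, Sub.comp_assoc, ih, Sub.lift_comp, subst_subst, Sub.wk_comp_lift]
  | _ => simp only [inst, subst, *]

/-! ### Conversion of types: equivalence and congruence properties. -/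

namespace Conv

theorem refl {ε : Pol} (A : Ty Sg Ξ Θ ε) (H : Valuation P Θ → Prop) : A.Conv H A := by
  induction A with
  | tvar X args => exact .tvar X fun _ _ _ _ => rfl
  | con T a i ih => exact .con T (fun κ X => ih κ X _) fun _ _ _ _ => rfl
  | clos A ih => exact .clos (ih H)
  | thunk A ih => exact .thunk (ih H)
  | bang A ih => exact .bang (ih H)
  | fix A ih => exact .fix (ih H)

theorem symm {ε : Pol} {A B : Ty Sg Ξ Θ ε} {H : Valuation P Θ → Prop} (h : A.Conv H B) :
    B.Conv H A := by
  induction h with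
  | tvar X hi => exact .tvar X fun v hv s x => (hi v hv s x).symm
  | con T _ hi ih => exact .con T ih fun v hv s x => (hi v hv s x).symm
  | clos _ ih => exact .clos ih
  | thunk _ ih => exact .thunk ih
  | bang _ ih => exact .bang ih
  | fix _ ih => exact .fix ih

theorem mono {ε : Pol} {A B : Ty Sg Ξ Θ ε} {H H' : Valuation P Θ → Prop} (h : A.Conv H B)
    (hH : ∀ v, H' v → H v) : A.Conv H' B := by
  induction h with
  | tvar X hi => exact .tvar X fun v hv => hi v (hH v hv)
  | con T _ hi ih => exact .con T (fun κ X => ih κ X fun v hv => hH _ hv) fun v hv => hi v (hH v hv)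
  | clos _ ih => exact .clos (ih hH)
  | thunk _ ih => exact .thunk (ih hH)
  | bang _ ih => exact .bang (ih hH)
  | fix _ ih => exact .fix (ih hH)

theorem trans {ε : Pol} {A B B' : Ty Sg Ξ Θ ε} {H : Valuation P Θ → Prop} (h : A.Conv H B)
    (h' : B.Conv H B') : A.Conv H B' := by
  induction h with
  | tvar X hi =>
    cases h' with
    | tvar _ hi' => exact .tvar X fun v hv s x => (hi v hv s x).trans (hi' v hv s x)
  | con T _ hi ih =>
    cases h' with
    | con _ ha' hi' =>
      exact .con T (fun κ X => ih κ X (ha' κ X)) fun v hv s x =>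
        (hi v hv s x).trans (hi' v hv s x)
  | clos _ ih => cases h' with | clos h' => exact .clos (ih h')
  | thunk _ ih => cases h' with | thunk h' => exact .thunk (ih h')
  | bang _ ih => cases h' with | bang h' => exact .bang (ih h')
  | fix _ ih => cases h' with | fix h' => exact .fix (ih h')

/-- Two substitutions are allowed because instantiating a type variable on the two sides of a
conversion inserts expressions that agree only in value, and only where `H'` holds. -/
theorem subst {ε : Pol} {A B : Ty Sg Ξ Θ ε} {H : Valuation P Θ → Prop} (h : A.Conv H B)
    {σ τ : Sub P Θ Θ'} {H' : Valuation P Θ' → Prop} (hσ : ∀ v, H' v → σ.eval v = τ.eval v)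
    (hH : ∀ v, H' v → H (σ.eval v)) : (A.subst σ).Conv H' (B.subst τ) := by
  induction h generalizing Θ' with
  | tvar X hi => exact .tvar X (Sub.eval_comp_congr hi hσ hH)
  | con T _ hi ih =>
    refine .con T (fun κ X => ih κ X (fun w hw => ?_) (fun w hw => ?_)) (Sub.eval_comp_congr hi hσ hH)
    · rw [← Valuation.append_surjective _ w, Sub.eval_lift, Sub.eval_lift]
      exact congrArg _ (hσ _ hw)
    · have := hH _ hw
      rw [← Valuation.append_surjective _ w, Sub.eval_lift]
      simp only [Var.append_inr]
      exact this
  | clos _ ih => exact .clos (ih hσ hH)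
  | thunk _ ih => exact .thunk (ih hσ hH)
  | bang _ ih => exact .bang (ih hσ hH)
  | fix _ ih => exact .fix (ih hσ hH)

/-- Induction on the body `A` of a definition. Type constructors inside it are not unfolded, so
recursive definitions cause no difficulty. -/
theorem inst {ε : Pol} (A : Ty Sg Ξ' Θ ε) {σ σ' : Sub P Θ Θ'} {τ τ' : TArgs Sg Ξ Ξ' Θ'}
    {H : Valuation P Θ' → Prop} (hσ : ∀ v, H v → σ.eval v = σ'.eval v)
    (hτ : ∀ κ X, (τ κ X).Conv (fun w => H ((Sub.wk κ.params Θ').eval w)) (τ' κ X)) :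
    (A.inst σ τ).Conv H (A.inst σ' τ') := by
  induction A generalizing Θ' with
  | tvar X args =>
    refine (hτ _ X).subst (fun v hv => ?_) fun v hv => ?_
    · have : Sub.eval (Sub.comp args σ) v = Sub.eval (Sub.comp args σ') v := by
        funext s x
        simp only [Sub.eval, Sub.comp, Ix.eval_subst, hσ v hv]
      rw [Sub.eval_append, Sub.eval_append, this]
    · rwa [Sub.eval_append, Sub.eval_wk_append]
  | con T a i ih =>
    refine .con T (fun κ X => ih κ X (fun w hw => ?_) fun κ' Y => ?_) fun v hv s x => ?_
    · rw [← Valuation.append_surjective _ w, Sub.eval_lift, Sub.eval_lift]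
      exact congrArg _ (hσ _ hw)
    · refine (hτ κ' Y).subst (fun _ _ => rfl) fun w hw => ?_
      rw [Sub.eval_wk_lift]
      exact hw
    · simp only [Sub.comp, Ix.eval_subst, hσ v hv]
  | clos A ih => exact .clos (ih hσ hτ)
  | thunk A ih => exact .thunk (ih hσ hτ)
  | bang A ih => exact .bang (ih hσ hτ)
  | fix A ih => exact .fix (ih hσ hτ)

/-- Conversion never changes the outermost type former. -/
theorem shareable {ε : Pol} {A B : Ty Sg Ξ Θ ε} {H : Valuation P Θ → Prop} (h : A.Conv H B)
    (hB : B.Shareable) : A.Shareable := by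
  cases hB <;> cases h <;> constructor

end Conv

theorem Shareable.subst {ε : Pol} {A : Ty Sg Ξ Θ ε} (h : A.Shareable) (σ : Sub P Θ Θ') :
    (A.subst σ).Shareable := by
  cases h <;> constructor

end Ty

/-! ## Constructors -/

section Constructors

variable {I : PCtx P}

theorem wkArgs_subst (Ψ : PCtx P) (a : TArgs Sg Ξ Ξ' Θ) (σ : Sub P Θ Θ') :
    (fun κ X => (DataCtor.wkArgs Ψ a κ X).subst (Sub.lift κ.params (σ.lift Ψ))) =
      DataCtor.wkArgs Ψ (fun κ X => (a κ X).subst (σ.lift κ.params)) := by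
  funext κ X
  simp only [DataCtor.wkArgs, Ty.subst_subst, Sub.lift_comp, Sub.wk_comp_lift]

theorem DataCtor.argAt_subst (K : DataCtor Sg Ξ' I) (a : TArgs Sg Ξ Ξ' Θ) (i : Sub P I Θ)
    (σ : Sub P Θ Θ') (k : Fin K.arity) :
    (K.argAt a i k).subst (σ.lift K.params) =
      K.argAt (fun κ X => (a κ X).subst (σ.lift κ.params)) (i.comp σ) k := by
  rw [argAt, Ty.subst_inst, Sub.lift_comp, wkArgs_subst, argAt]

theorem CompCtor.contAt_subst (K : CompCtor Sg Ξ' I) (a : TArgs Sg Ξ Ξ' Θ) (i : Sub P I Θ)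
    (σ : Sub P Θ Θ') :
    (K.contAt a i).subst (σ.lift K.params) =
      K.contAt (fun κ X => (a κ X).subst (σ.lift κ.params)) (i.comp σ) := by
  rw [contAt, Ty.subst_inst, Sub.lift_comp, wkArgs_subst, contAt]

theorem DataCtor.guardAt_holds (K : DataCtor Sg Ξ' I) (i : Sub P I Θ)
    (v : Valuation P (K.params ++ Θ)) :
    (K.guardAt i).Holds v ↔ K.guard.Holds ((i.lift K.params).eval v) :=
  Constraint.holds_subst _ _ _

theorem DataCtor.guardAt_comp_holds (K : DataCtor Sg Ξ' I) (i : Sub P I Θ) (σ : Sub P Θ Θ')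
    (v : Valuation P (K.params ++ Θ')) :
    (K.guardAt (i.comp σ)).Holds v ↔ (K.guardAt i).Holds ((σ.lift K.params).eval v) := by
  rw [guardAt_holds, guardAt_holds, ← Sub.lift_comp, Sub.eval_comp]

/-- A guard depends on the indices only through their values. Hence the guard established where a
constructor is built is available to a pattern match at convertible indices. -/
theorem DataCtor.guardAt_congr (K : DataCtor Sg Ξ' I) {i j : Sub P I Θ}
    {w : Valuation P K.params} {v : Valuation P Θ} (h : i.eval v = j.eval v) :
    (K.guardAt i).Holds (Var.append _ w v) ↔ (K.guardAt j).Holds (Var.append _ w v) := by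
  rw [guardAt_holds, guardAt_holds, Sub.eval_lift, Sub.eval_lift, h]

theorem conv_wkArgs (Ψ : PCtx P) {a b : TArgs Sg Ξ Ξ' Θ} {H : Valuation P Θ → Prop}
    (ha : ∀ κ X, (a κ X).Conv (fun w => H ((Sub.wk κ.params Θ).eval w)) (b κ X))
    (κ : Kind P) (X : Var Ξ' κ) :
    (DataCtor.wkArgs Ψ a κ X).Conv
      (fun w => H ((Sub.wk Ψ Θ).eval ((Sub.wk κ.params (Ψ ++ Θ)).eval w)))
      (DataCtor.wkArgs Ψ b κ X) := by
  refine (ha κ X).subst (fun _ _ => rfl) fun w hw => ?_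
  rw [Sub.eval_wk_lift]
  exact hw

theorem eval_lift_congr (Ψ : PCtx P) {i j : Sub P I Θ} {H : Valuation P Θ → Prop}
    (hi : ∀ v, H v → i.eval v = j.eval v) (w : Valuation P (Ψ ++ Θ))
    (hw : H ((Sub.wk Ψ Θ).eval w)) : (i.lift Ψ).eval w = (j.lift Ψ).eval w := by
  rw [← Valuation.append_surjective _ w, Sub.eval_lift, Sub.eval_lift, hi _ hw]

/-- The hypothesis `H` concerns the ambient parameters only, so it is pulled back along the
weakening by the parameters of the constructor. -/
theorem DataCtor.conv_argAt (K : DataCtor Sg Ξ' I) {a b : TArgs Sg Ξ Ξ' Θ} {i j : Sub P I Θ}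
    {H : Valuation P Θ → Prop}
    (ha : ∀ κ X, (a κ X).Conv (fun w => H ((Sub.wk κ.params Θ).eval w)) (b κ X))
    (hi : ∀ v, H v → i.eval v = j.eval v) (k : Fin K.arity) :
    (K.argAt a i k).Conv (fun w => H ((Sub.wk K.params Θ).eval w)) (K.argAt b j k) :=
  .inst _ (fun w hw => eval_lift_congr _ hi w hw) (conv_wkArgs _ ha)

theorem CompCtor.conv_contAt (K : CompCtor Sg Ξ' I) {a b : TArgs Sg Ξ Ξ' Θ} {i j : Sub P I Θ}
    {H : Valuation P Θ → Prop}
    (ha : ∀ κ X, (a κ X).Conv (fun w => H ((Sub.wk κ.params Θ).eval w)) (b κ X))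
    (hi : ∀ v, H v → i.eval v = j.eval v) :
    (K.contAt a i).Conv (fun w => H ((Sub.wk K.params Θ).eval w)) (K.contAt b j) :=
  .inst _ (fun w hw => eval_lift_congr _ hi w hw) (conv_wkArgs _ ha)

end Constructors

/-! ## Contexts -/

namespace Ctx

theorem ext_some {Γ Γ' : Ctx Sg Ξ Θ} (h : ∀ ε i A, Γ ε i = some A ↔ Γ' ε i = some A) :
    Γ = Γ' := by
  funext ε i
  exact Option.ext (h ε i)

open Classical in
/-- The context with a given graph. -/
noncomputable def ofRel (R : ∀ ε, ℕ → Ty Sg Ξ Θ ε → Prop) : Ctx Sg Ξ Θ :=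
  fun ε i => if h : ∃ A, R ε i A then some h.choose else none

theorem ofRel_eq_some {R : ∀ ε, ℕ → Ty Sg Ξ Θ ε → Prop}
    (hR : ∀ ε i A B, R ε i A → R ε i B → A = B) {ε : Pol} {i : ℕ} {A : Ty Sg Ξ Θ ε} :
    ofRel R ε i = some A ↔ R ε i A := by
  unfold ofRel
  split_ifs with h
  · simp only [Option.some.injEq]
    exact ⟨fun e => e ▸ h.choose_spec, hR _ _ _ _ h.choose_spec⟩
  · simp only [false_iff]
    exact fun hA => h ⟨A, hA⟩

theorem subst_eq_some {Γ : Ctx Sg Ξ Θ} {σ : Sub P Θ Θ'} {ε : Pol} {i : ℕ} {B : Ty Sg Ξ Θ' ε} :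
    Γ.subst σ ε i = some B ↔ ∃ A, Γ ε i = some A ∧ A.subst σ = B := by
  simp [subst]

theorem single_self (ε : Pol) (i : ℕ) (A : Ty Sg Ξ Θ ε) : single ε i A ε i = some A := by
  simp [single]

theorem of_single_eq_some {ε ε' : Pol} {i j : ℕ} {A : Ty Sg Ξ Θ ε} {B : Ty Sg Ξ Θ ε'}
    (h : single ε i A ε' j = some B) : ε = ε' ∧ i = j ∧ HEq A B := by
  by_cases hε : ε' = ε
  · subst hε
    by_cases hi : j = i
    · subst hi
      rw [single_self] at h
      cases h
      exact ⟨rfl, rfl, .rfl⟩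
    · simp [single, hi] at h
  · simp [single, hε, empty] at h

theorem push_lt (Γ : Ctx Sg Ξ Θ) (ε : Pol) {n i : ℕ} (A : Fin n → Ty Sg Ξ Θ ε) (h : i < n) :
    Γ.push ε n A ε i = some (A ⟨i, h⟩) := by
  simp [push, h]

theorem push_add (Γ : Ctx Sg Ξ Θ) (ε : Pol) {n : ℕ} (i : ℕ) (A : Fin n → Ty Sg Ξ Θ ε) :
    Γ.push ε n A ε (i + n) = Γ ε i := by
  simp [push]

theorem push_ne (Γ : Ctx Sg Ξ Θ) {ε ε' : Pol} {n : ℕ} (i : ℕ) (A : Fin n → Ty Sg Ξ Θ ε)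
    (h : ε' ≠ ε) : Γ.push ε n A ε' i = Γ ε' i := by
  simp [push, h]

end Ctx

/-- A variable is either bound by a binder of `n` variables of polarity `ε`, or one of the other
variables of polarity `ε`, or of another polarity. -/
theorem binder_cases (ε : Pol) (n : ℕ) (ε' : Pol) (i : ℕ) :
    (ε' = ε ∧ i < n) ∨ (ε' = ε ∧ ∃ j, i = j + n) ∨ ε' ≠ ε := by
  by_cases h : ε' = ε
  · rcases lt_or_ge i n with h' | h'
    · exact .inl ⟨h, h'⟩
    · exact .inr (.inl ⟨h, i - n, by omega⟩)
  · exact .inr (.inr h)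

namespace Ctx

theorem subst_subst (Γ : Ctx Sg Ξ Θ₁) (σ : Sub P Θ₁ Θ₂) (τ : Sub P Θ₂ Θ₃) :
    (Γ.subst σ).subst τ = Γ.subst (σ.comp τ) := by
  funext ε i
  simp only [subst, Option.map_map]
  congr 1
  funext A
  exact Ty.subst_subst _ _ _

theorem subst_ids (Γ : Ctx Sg Ξ Θ) : Γ.subst (Sub.ids Θ) = Γ := by
  funext ε i
  simp [subst, Ty.subst_ids]

theorem subst_wk_lift (Γ : Ctx Sg Ξ Θ) (Ψ : PCtx P) (σ : Sub P Θ Θ') :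
    (Γ.subst (Sub.wk Ψ Θ)).subst (σ.lift Ψ) = (Γ.subst σ).subst (Sub.wk Ψ Θ') := by
  rw [subst_subst, subst_subst, Sub.wk_comp_lift]

theorem empty_subst (σ : Sub P Θ Θ') : (empty : Ctx Sg Ξ Θ).subst σ = empty := rfl

theorem single_subst (ε : Pol) (i : ℕ) (A : Ty Sg Ξ Θ ε) (σ : Sub P Θ Θ') :
    (single ε i A).subst σ = single ε i (A.subst σ) := by
  funext ε' j
  by_cases hε : ε' = ε
  · subst hε
    by_cases hi : j = i
    · subst hi; simp [single, subst]
    · simp [single, subst, hi]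
  · simp [single, subst, hε, empty]

theorem push_subst (Γ : Ctx Sg Ξ Θ) (ε : Pol) {n : ℕ} (A : Fin n → Ty Sg Ξ Θ ε)
    (σ : Sub P Θ Θ') :
    (Γ.push ε n A).subst σ = (Γ.subst σ).push ε n (fun k => (A k).subst σ) := by
  funext ε' i
  rcases binder_cases ε n ε' i with ⟨rfl, h⟩ | ⟨rfl, j, rfl⟩ | h
  · simp [subst, push_lt, h]
  · simp only [subst, push_add]
  · simp only [subst, push_ne _ _ _ h]

theorem AllShareable.subst {Γ : Ctx Sg Ξ Θ} (h : Γ.AllShareable) (σ : Sub P Θ Θ') :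
    (Γ.subst σ).AllShareable := by
  intro ε i B hB
  obtain ⟨A, hA, rfl⟩ := subst_eq_some.1 hB
  exact (h _ _ _ hA).subst σ

theorem Merge.subst {ι : Type} {Γs : ι → Ctx Sg Ξ Θ} {Γ : Ctx Sg Ξ Θ} (h : Merge Γs Γ)
    (σ : Sub P Θ Θ') : Merge (fun k => (Γs k).subst σ) (Γ.subst σ) where
  incl k ε i B hB := by
    obtain ⟨A, hA, rfl⟩ := subst_eq_some.1 hB
    exact subst_eq_some.2 ⟨A, h.incl k _ _ _ hA, rfl⟩
  cover ε i B hB := by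
    obtain ⟨A, hA, rfl⟩ := subst_eq_some.1 hB
    obtain ⟨k, hk⟩ := h.cover _ _ _ hA
    exact ⟨k, subst_eq_some.2 ⟨A, hk, rfl⟩⟩
  linear k l ε i A B hkl hA hB := by
    obtain ⟨A', hA', rfl⟩ := subst_eq_some.1 hA
    obtain ⟨B', hB', rfl⟩ := subst_eq_some.1 hB
    exact (h.linear _ _ _ _ _ _ hkl hA' hB').subst σ

theorem merge_pair {Γ₁ Γ₂ Γ : Ctx Sg Ξ Θ} :
    Merge ![Γ₁, Γ₂] Γ ↔ Γ₁.Incl Γ ∧ Γ₂.Incl Γ ∧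
      (∀ ε i A, Γ ε i = some A → Γ₁ ε i = some A ∨ Γ₂ ε i = some A) ∧
      ∀ ε i A, Γ₁ ε i = some A → Γ₂ ε i = some A → A.Shareable := by
  constructor
  · intro h
    refine ⟨h.incl 0, h.incl 1, fun ε i A hA => ?_, fun ε i A h₁ h₂ =>
      h.linear 0 1 ε i A A (by decide) h₁ h₂⟩
    obtain ⟨k, hk⟩ := h.cover ε i A hA
    fin_cases k
    · exact .inl hk
    · exact .inr hk
  · rintro ⟨h₁, h₂, hc, hl⟩
    refine ⟨fun k => ?_, fun ε i A hA => ?_, fun k l ε i A B hkl hA hB => ?_⟩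
    · fin_cases k
      · exact h₁
      · exact h₂
    · rcases hc ε i A hA with h | h
      · exact ⟨0, h⟩
      · exact ⟨1, h⟩
    · fin_cases k <;> fin_cases l
      · exact absurd rfl hkl
      · obtain rfl : A = B := Option.some.inj ((h₁ _ _ _ hA).symm.trans (h₂ _ _ _ hB))
        exact hl _ _ _ hA hB
      · obtain rfl : A = B := Option.some.inj ((h₂ _ _ _ hA).symm.trans (h₁ _ _ _ hB))
        exact hl _ _ _ hB hA
      · exact absurd rfl hkl

end Ctx

/-! ## Renaming in contexts -/

/-- Renamings that do not identify value variables. -/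
def Ren.Inj (ρ : Ren) : Prop := ∀ ε, Function.Injective (ρ .val ε)

/-- The identical renaming. -/
def Ren.ids : Ren := fun _ _ i => i

namespace Ren

theorem Inj.ids : Ren.ids.Inj := fun _ _ _ h => h

theorem Inj.shift (k : Side) (ε : Pol) (n : ℕ) : (Ren.shift k ε n).Inj := by
  intro ε' i j h
  simp only [Ren.shift] at h
  split_ifs at h <;> omega

theorem Inj.lift {ρ : Ren} (hρ : ρ.Inj) (k : Side) (ε : Pol) (n : ℕ) : (ρ.lift k ε n).Inj := by
  intro ε' i j h
  simp only [Ren.lift] at h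
  split_ifs at h
  · exact h
  · omega
  · omega
  · have := hρ ε' (Nat.add_right_cancel h); omega
  · exact hρ ε' h

theorem shift_self (k : Side) (ε : Pol) (n i : ℕ) : shift k ε n k ε i = i + n := by
  simp [shift]

theorem shift_ne {k : Side} {ε ε' : Pol} (n i : ℕ) (h : ε' ≠ ε) : shift k ε n k ε' i = i := by
  simp [shift, h]

theorem lift_lt (ρ : Ren) (k : Side) (ε : Pol) {n i : ℕ} (h : i < n) :
    ρ.lift k ε n k ε i = i := by
  simp [lift, h]

theorem lift_add (ρ : Ren) (k : Side) (ε : Pol) (n i : ℕ) :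
    ρ.lift k ε n k ε (i + n) = ρ k ε i + n := by
  simp [lift]

theorem lift_ne (ρ : Ren) (k : Side) {ε ε' : Pol} (n i : ℕ) (h : ε' ≠ ε) :
    ρ.lift k ε n k ε' i = ρ k ε' i := by
  simp [lift, h]

theorem lift_ids (k : Side) (ε : Pol) (n : ℕ) : Ren.ids.lift k ε n = Ren.ids := by
  funext k' ε' i
  simp only [lift, Ren.ids]
  split_ifs <;> omega

end Ren

theorem Expr.rename_ids {t : Cat} (e : Expr D t) : e.rename Ren.ids = e := by
  induction e <;> (simp only [rename, Ren.lift_ids, *]; try rfl)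

/-- Renaming of the variables of a context. -/
noncomputable def Ctx.rename (Γ : Ctx Sg Ξ Θ) (ρ : Ren) : Ctx Sg Ξ Θ :=
  .ofRel fun ε j A => ∃ i, ρ .val ε i = j ∧ Γ ε i = some A

namespace Ctx

variable {ρ : Ren}

theorem rename_eq_some (hρ : ρ.Inj) {Γ : Ctx Sg Ξ Θ} {ε : Pol} {j : ℕ} {A : Ty Sg Ξ Θ ε} :
    Γ.rename ρ ε j = some A ↔ ∃ i, ρ .val ε i = j ∧ Γ ε i = some A := by
  refine ofRel_eq_some ?_
  rintro ε _ A B ⟨i, rfl, hA⟩ ⟨j, hj, hB⟩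
  rw [hρ ε hj, hA] at hB
  exact Option.some.inj hB

theorem rename_apply (hρ : ρ.Inj) (Γ : Ctx Sg Ξ Θ) (ε : Pol) (i : ℕ) :
    Γ.rename ρ ε (ρ .val ε i) = Γ ε i := by
  refine Option.ext fun A => (rename_eq_some hρ).trans ⟨?_, fun h => ⟨i, rfl, h⟩⟩
  rintro ⟨j, hj, hA⟩
  rwa [← hρ ε hj]

/-- Renaming acts on contexts only through the value variables. -/
theorem rename_of_val (h : ∀ ε i, ρ .val ε i = i) (Γ : Ctx Sg Ξ Θ) : Γ.rename ρ = Γ := by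
  have hρ : ρ.Inj := fun ε i j e => by rwa [h, h] at e
  funext ε i
  conv_lhs => rw [← h ε i, rename_apply hρ]

theorem rename_ids (Γ : Ctx Sg Ξ Θ) : Γ.rename Ren.ids = Γ := rename_of_val (fun _ _ => rfl) Γ

theorem rename_shift_stk (Γ : Ctx Sg Ξ Θ) (ε : Pol) (n : ℕ) :
    Γ.rename (Ren.shift .stk ε n) = Γ := rename_of_val (fun _ _ => by simp [Ren.shift]) Γ

theorem rename_lift_stk (Γ : Ctx Sg Ξ Θ) (ρ : Ren) (ε : Pol) (n : ℕ) :
    Γ.rename (ρ.lift .stk ε n) = Γ.rename ρ := by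
  have : ∀ ε' i, ρ.lift .stk ε n .val ε' i = ρ .val ε' i := fun _ _ => by simp [Ren.lift]
  simp only [rename, this]

theorem subst_rename (hρ : ρ.Inj) (Γ : Ctx Sg Ξ Θ) (σ : Sub P Θ Θ') :
    (Γ.subst σ).rename ρ = (Γ.rename ρ).subst σ := by
  refine ext_some fun ε j B => ?_
  rw [rename_eq_some hρ, subst_eq_some]
  simp only [subst_eq_some, rename_eq_some hρ]
  constructor
  · rintro ⟨i, h, A, hA⟩; exact ⟨A, ⟨i, h, hA.1⟩, hA.2⟩
  · rintro ⟨A, ⟨i, h, hA⟩, hB⟩; exact ⟨i, h, A, hA, hB⟩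

theorem empty_rename (hρ : ρ.Inj) : (empty : Ctx Sg Ξ Θ).rename ρ = empty := by
  refine ext_some fun ε j B => ?_
  rw [rename_eq_some hρ]
  simp [empty]

theorem single_rename (hρ : ρ.Inj) (ε : Pol) (i : ℕ) (A : Ty Sg Ξ Θ ε) :
    (single ε i A).rename ρ = single ε (ρ .val ε i) A := by
  refine ext_some fun ε' j B => ?_
  rw [rename_eq_some hρ]
  constructor
  · rintro ⟨j, rfl, h⟩
    obtain ⟨rfl, rfl, hAB⟩ := of_single_eq_some h
    cases hAB
    exact single_self _ _ _
  · intro h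
    obtain ⟨rfl, rfl, hAB⟩ := of_single_eq_some h
    cases hAB
    exact ⟨i, rfl, single_self _ _ _⟩

theorem push_rename (hρ : ρ.Inj) (Γ : Ctx Sg Ξ Θ) (ε : Pol) {n : ℕ} (A : Fin n → Ty Sg Ξ Θ ε) :
    (Γ.push ε n A).rename (ρ.lift .val ε n) = (Γ.rename ρ).push ε n A := by
  have hρ' := hρ.lift .val ε n
  refine ext_some fun ε' j B => ?_
  rw [rename_eq_some hρ']
  constructor
  · rintro ⟨i, rfl, hB⟩
    rcases binder_cases ε n ε' i with ⟨rfl, h⟩ | ⟨rfl, j, rfl⟩ | h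
    · rwa [Ren.lift_lt _ _ _ h, push_lt _ _ _ h, ← push_lt _ _ _ h]
    · rw [push_add] at hB
      rwa [Ren.lift_add, push_add, rename_apply hρ]
    · rw [push_ne _ _ _ h] at hB
      rwa [Ren.lift_ne _ _ _ _ h, push_ne _ _ _ h, rename_apply hρ]
  · intro hB
    rcases binder_cases ε n ε' j with ⟨rfl, h⟩ | ⟨rfl, j, rfl⟩ | h
    · refine ⟨j, Ren.lift_lt _ _ _ h, ?_⟩
      rwa [push_lt _ _ _ h] at hB ⊢
    · rw [push_add, rename_eq_some hρ] at hB
      obtain ⟨i, rfl, hB⟩ := hB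
      exact ⟨i + n, Ren.lift_add _ _ _ _ _, by rwa [push_add]⟩
    · rw [push_ne _ _ _ h, rename_eq_some hρ] at hB
      obtain ⟨i, rfl, hB⟩ := hB
      exact ⟨i, Ren.lift_ne _ _ _ _ h, by rwa [push_ne _ _ _ h]⟩

theorem AllShareable.rename {Γ : Ctx Sg Ξ Θ} (h : Γ.AllShareable) (hρ : ρ.Inj) :
    (Γ.rename ρ).AllShareable := by
  intro ε j B hB
  obtain ⟨i, -, hA⟩ := (rename_eq_some hρ).1 hB
  exact h _ _ _ hA

theorem Merge.rename {ι : Type} {Γs : ι → Ctx Sg Ξ Θ} {Γ : Ctx Sg Ξ Θ} (h : Merge Γs Γ)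
    (hρ : ρ.Inj) : Merge (fun k => (Γs k).rename ρ) (Γ.rename ρ) where
  incl k ε j B hB := by
    obtain ⟨i, rfl, hA⟩ := (rename_eq_some hρ).1 hB
    exact (rename_eq_some hρ).2 ⟨i, rfl, h.incl k _ _ _ hA⟩
  cover ε j B hB := by
    obtain ⟨i, rfl, hA⟩ := (rename_eq_some hρ).1 hB
    obtain ⟨k, hk⟩ := h.cover _ _ _ hA
    exact ⟨k, (rename_eq_some hρ).2 ⟨i, rfl, hk⟩⟩
  linear k l ε j A B hkl hA hB := by
    obtain ⟨i, rfl, hA'⟩ := (rename_eq_some hρ).1 hA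
    rw [rename_apply hρ] at hB
    exact h.linear _ _ _ _ _ _ hkl hA' hB

/-- Instantiating the parameters and renaming the variables of a context. -/
noncomputable def act (Γ : Ctx Sg Ξ Θ) (σ : Sub P Θ Θ') (ρ : Ren) : Ctx Sg Ξ Θ' :=
  (Γ.subst σ).rename ρ

theorem Merge.act {ι : Type} {Γs : ι → Ctx Sg Ξ Θ} {Γ : Ctx Sg Ξ Θ} (h : Merge Γs Γ)
    (σ : Sub P Θ Θ') (hρ : ρ.Inj) : Merge (fun k => (Γs k).act σ ρ) (Γ.act σ ρ) :=
  (h.subst σ).rename hρ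

theorem act_wk_lift (hρ : ρ.Inj) (Γ : Ctx Sg Ξ Θ) (Ψ : PCtx P) (σ : Sub P Θ Θ') :
    (Γ.subst (Sub.wk Ψ Θ)).act (σ.lift Ψ) ρ = (Γ.act σ ρ).subst (Sub.wk Ψ Θ') := by
  rw [act, act, subst_wk_lift, subst_rename hρ]

theorem push_act (hρ : ρ.Inj) (Γ : Ctx Sg Ξ Θ) (ε : Pol) {n : ℕ} (A : Fin n → Ty Sg Ξ Θ ε)
    (σ : Sub P Θ Θ') :
    (Γ.push ε n A).act σ (ρ.lift .val ε n) = (Γ.act σ ρ).push ε n (fun k => (A k).subst σ) := by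
  rw [act, push_subst, push_rename hρ, act]

theorem act_lift_stk (Γ : Ctx Sg Ξ Θ) (σ : Sub P Θ Θ') (ρ : Ren) (ε : Pol) (n : ℕ) :
    Γ.act σ (ρ.lift .stk ε n) = Γ.act σ ρ := by
  rw [act, rename_lift_stk, act]

theorem pair_act {Γ₁ Γ₂ Γ : Ctx Sg Ξ Θ} (h : Merge ![Γ₁, Γ₂] Γ) (σ : Sub P Θ Θ') (hρ : ρ.Inj) :
    Merge ![Γ₁.act σ ρ, Γ₂.act σ ρ] (Γ.act σ ρ) := by
  have := h.act σ hρ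
  convert this using 1
  funext k
  fin_cases k <;> rfl

end Ctx

/-- Instantiating the parameters and renaming the variable of a context of stacks. -/
def CoCtx.act (Δ : CoCtx Sg Ξ Θ) (σ : Sub P Θ Θ') (ρ : Ren) : CoCtx Sg Ξ Θ' :=
  ⟨Δ.pol, ρ .stk Δ.pol Δ.name, Δ.ty.subst σ⟩

theorem CoCtx.act_wk_lift (Δ : CoCtx Sg Ξ Θ) (Ψ : PCtx P) (σ : Sub P Θ Θ') (ρ : Ren) :
    (Δ.subst (Sub.wk Ψ Θ)).act (σ.lift Ψ) ρ = (Δ.act σ ρ).subst (Sub.wk Ψ Θ') := by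
  simp only [act, subst, Ty.subst_subst, Sub.wk_comp_lift]

theorem CoCtx.act_lift_val (Δ : CoCtx Sg Ξ Θ) (σ : Sub P Θ Θ') (ρ : Ren) (ε : Pol) (n : ℕ) :
    Δ.act σ (ρ.lift .val ε n) = Δ.act σ ρ := by
  simp [act, Ren.lift]

/-! ## Typing under semantic constraints -/

/-- `V` has type `A` with some constraint that follows from `H`. -/
def VTy {ε : Pol} (H : Valuation P Θ → Prop) (Γ : Ctx Sg Ξ Θ) (V : Value D ε)
    (A : Ty Sg Ξ Θ ε) : Prop :=
  ∃ C : Constraint P Θ, (∀ v, H v → C.Holds v) ∧ Derivable (.val Θ C Γ V A)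

/-- `S` has type `A` with some constraint that follows from `H`. -/
def STy {ε : Pol} (H : Valuation P Θ → Prop) (Γ : Ctx Sg Ξ Θ) (S : Stack D ε)
    (A : Ty Sg Ξ Θ ε) (Δ : CoCtx Sg Ξ Θ) : Prop :=
  ∃ C : Constraint P Θ, (∀ v, H v → C.Holds v) ∧ Derivable (.stk Θ C Γ S A Δ)

/-- `c` is well typed with some constraint that follows from `H`. -/
def CTy (H : Valuation P Θ → Prop) (c : Command D) (Γ : Ctx Sg Ξ Θ) (Δ : CoCtx Sg Ξ Θ) : Prop :=
  ∃ C : Constraint P Θ, (∀ v, H v → C.Holds v) ∧ Derivable (.cmd c Θ C Γ Δ)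

variable {H H' : Valuation P Θ → Prop} {Γ Γ₁ Γ₂ : Ctx Sg Ξ Θ} {Δ : CoCtx Sg Ξ Θ} {ε : Pol}

theorem VTy.mono {V : Value D ε} {A : Ty Sg Ξ Θ ε} (h : VTy H Γ V A) (hH : ∀ v, H' v → H v) :
    VTy H' Γ V A :=
  let ⟨C, hC, h⟩ := h
  ⟨C, fun v hv => hC v (hH v hv), h⟩

theorem STy.mono {S : Stack D ε} {A : Ty Sg Ξ Θ ε} (h : STy H Γ S A Δ)
    (hH : ∀ v, H' v → H v) : STy H' Γ S A Δ :=
  let ⟨C, hC, h⟩ := h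
  ⟨C, fun v hv => hC v (hH v hv), h⟩

theorem CTy.mono {c : Command D} (h : CTy H c Γ Δ) (hH : ∀ v, H' v → H v) : CTy H' c Γ Δ :=
  let ⟨C, hC, h⟩ := h
  ⟨C, fun v hv => hC v (hH v hv), h⟩

theorem VTy.var (i : ℕ) (A : Ty Sg Ξ Θ ε) :
    VTy (D := D) H (.single ε i A) (.var .val ε i) A :=
  ⟨.top, fun _ _ => trivial, .var⟩

theorem STy.covar (i : ℕ) (A : Ty Sg Ξ Θ ε) :
    STy (D := D) H .empty (.var .stk ε i) A ⟨ε, i, A⟩ :=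
  ⟨.top, fun _ _ => trivial, .covar⟩

/-- The conversion rule records a syntactic constraint, whereas `H` may be any predicate. A
constraint `E` that lies between `H` and the conversion is therefore needed. -/
theorem VTy.conv {V : Value D ε} {A B : Ty Sg Ξ Θ ε} (h : VTy H Γ V A) {E : Constraint P Θ}
    (hE : A.Conv E.Holds B) (hH : ∀ v, H v → E.Holds v) : VTy H Γ V B :=
  let ⟨C, hC, h⟩ := h
  ⟨.and C E, fun v hv => ⟨hC v hv, hH v hv⟩, .convVal h hE⟩

theorem STy.conv {S : Stack D ε} {A B : Ty Sg Ξ Θ ε} (h : STy H Γ S A Δ) {E : Constraint P Θ}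
    (hE : A.Conv E.Holds B) (hH : ∀ v, H v → E.Holds v) : STy H Γ S B Δ :=
  let ⟨C, hC, h⟩ := h
  ⟨.and C E, fun v hv => ⟨hC v hv, hH v hv⟩, .convStk h hE⟩

/-- The existential constraint follows from `H` as soon as each instantiation satisfying `H` extends
to one satisfying `H'`. The choice of extension need not be definable by parameter expressions. -/
theorem CTy.hide {Ψ : PCtx P} {H' : Valuation P (Ψ ++ Θ) → Prop} {c : Command D}
    (h : CTy H' c (Γ.subst (Sub.wk Ψ Θ)) (Δ.subst (Sub.wk Ψ Θ)))
    (hH : ∀ v, H v → ∃ w, H' (Var.append Ψ w v)) : CTy H c Γ Δ :=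
  let ⟨C, hC, h⟩ := h
  ⟨.ex Ψ C, fun v hv => (hH v hv).imp fun _ hw => hC _ hw, .hide h⟩

theorem CTy.cut {V : Value D ε} {S : Stack D ε} {A : Ty Sg Ξ Θ ε} (hV : VTy H Γ₁ V A)
    (hS : STy H Γ₂ S A Δ) (hΓ : Ctx.Merge ![Γ₁, Γ₂] Γ) : CTy H (.cut ε V S) Γ Δ :=
  let ⟨C, hC, hV⟩ := hV
  let ⟨C', hC', hS⟩ := hS
  ⟨.and C C', fun v hv => ⟨hC v hv, hC' v hv⟩, .cut hV hS hΓ⟩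

theorem CTy.del {V : Value D .pos} {c : Command D} {A : Ty Sg Ξ Θ .pos} (hV : VTy H Γ₁ V A)
    (hA : A.Shareable) (hc : CTy H c Γ₂ Δ) (hΓ : Ctx.Merge ![Γ₁, Γ₂] Γ) :
    CTy H (.del V c) Γ Δ :=
  let ⟨C, hC, hV⟩ := hV
  let ⟨C', hC', hc⟩ := hc
  ⟨.and C C', fun v hv => ⟨hC v hv, hC' v hv⟩, .del hV hA hc hΓ⟩

theorem CTy.dup {V : Value D .pos} {c : Command D} {A : Ty Sg Ξ Θ .pos} (hV : VTy H Γ₁ V A)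
    (hA : A.Shareable) (hc : CTy H c (Γ₂.push .pos 2 (fun _ => A)) Δ)
    (hΓ : Ctx.Merge ![Γ₁, Γ₂] Γ) : CTy H (.dup V c) Γ Δ :=
  let ⟨C, hC, hV⟩ := hV
  let ⟨C', hC', hc⟩ := hc
  ⟨.and C C', fun v hv => ⟨hC v hv, hC' v hv⟩, .dup hV hA hc hΓ⟩

theorem VTy.letStk {c : Command D} {A : Ty Sg Ξ Θ .neg} (h : CTy H c Γ ⟨.neg, 0, A⟩) :
    VTy H Γ (.letStk c) A :=
  h.imp fun _ h => ⟨h.1, .letStk h.2⟩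

theorem STy.letVal {c : Command D} {A : Ty Sg Ξ Θ .pos}
    (h : CTy H c (Γ.push .pos 1 (fun _ => A)) Δ) : STy H Γ (.letVal c) A Δ :=
  h.imp fun _ h => ⟨h.1, .letVal h.2⟩

/-- One predicate `H'` serves all arguments, since a single choice of the constructor's parameters
must satisfy the guard and every argument's constraint. -/
theorem VTy.data {T : Sg.TCon .pos} {K : Fin (D.numData T)}
    {V : Fin (D.data T K).arity → Value D .pos} {a : TArgs Sg Ξ (Sg.kinds T) Θ}
    {i : Sub P (Sg.indices T) Θ} {H' : Valuation P ((D.data T K).params ++ Θ) → Prop}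
    {Γs : Fin (D.data T K).arity → Ctx Sg Ξ Θ}
    (hV : ∀ k, VTy H' ((Γs k).subst (Sub.wk _ Θ)) (V k) ((D.data T K).argAt a i k))
    (hΓ : Ctx.Merge Γs Γ)
    (hH : ∀ v, H v → ∃ w, ((D.data T K).guardAt i).Holds (Var.append _ w v) ∧
      H' (Var.append _ w v)) :
    VTy H Γ (.data T K V) (.con T a i) := by
  choose C hC hV using hV
  refine ⟨_, fun v hv => ?_, .data hV hΓ⟩
  obtain ⟨w, hw, hw'⟩ := hH v hv
  exact ⟨w, hw, (Constraint.holds_conj _ _).2 fun k => hC k _ hw'⟩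

theorem STy.dataCase {T : Sg.TCon .pos} {c : Fin (D.numData T) → Command D}
    {a : TArgs Sg Ξ (Sg.kinds T) Θ} {i : Sub P (Sg.indices T) Θ}
    {H' : ∀ K, Valuation P ((D.data T K).params ++ Θ) → Prop}
    (hc : ∀ K, CTy (H' K) (c K)
      (Ctx.push (Ctx.subst Γ (Sub.wk _ Θ)) .pos _ ((D.data T K).argAt a i))
      (CoCtx.subst Δ (Sub.wk _ Θ)))
    (hH : ∀ v, H v → ∀ K w, ((D.data T K).guardAt i).Holds (Var.append _ w v) →
      H' K (Var.append _ w v)) :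
    STy H Γ (.dataCase T c) (.con T a i) Δ := by
  choose C hC hc using hc
  refine ⟨_, fun v hv => ?_, .dataCase hc⟩
  exact (Constraint.holds_conj _ _).2 fun K w hw => hC K _ (hH v hv K w hw)

theorem STy.comp {T : Sg.TCon .neg} {K : Fin (D.numComp T)}
    {V : Fin (D.comp T K).arity → Value D .pos} {S : Stack D .neg}
    {a : TArgs Sg Ξ (Sg.kinds T) Θ} {i : Sub P (Sg.indices T) Θ}
    {H' : Valuation P ((D.comp T K).params ++ Θ) → Prop}
    {Γs : Fin (D.comp T K).arity → Ctx Sg Ξ Θ} {Γ' : Ctx Sg Ξ Θ}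
    (hV : ∀ k, VTy H' ((Γs k).subst (Sub.wk _ Θ)) (V k) ((D.comp T K).argAt a i k))
    (hS : STy H' (Γ'.subst (Sub.wk _ Θ)) S ((D.comp T K).contAt a i) (Δ.subst (Sub.wk _ Θ)))
    (hΓ : Ctx.Merge (fun o : Option (Fin (D.comp T K).arity) => o.elim Γ' Γs) Γ)
    (hH : ∀ v, H v → ∃ w, ((D.comp T K).guardAt i).Holds (Var.append _ w v) ∧
      H' (Var.append _ w v)) :
    STy H Γ (.comp T K V S) (.con T a i) Δ := by
  choose C hC hV using hV
  obtain ⟨C', hC', hS⟩ := hS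
  refine ⟨_, fun v hv => ?_, .comp hV hS hΓ⟩
  obtain ⟨w, hw, hw'⟩ := hH v hv
  exact ⟨w, hw, (Constraint.holds_conj _ _).2 fun k => hC k _ hw', hC' _ hw'⟩

theorem VTy.compCase {T : Sg.TCon .neg} {c : Fin (D.numComp T) → Command D}
    {a : TArgs Sg Ξ (Sg.kinds T) Θ} {i : Sub P (Sg.indices T) Θ}
    {H' : ∀ K, Valuation P ((D.comp T K).params ++ Θ) → Prop}
    (hc : ∀ K, CTy (H' K) (c K)
      (Ctx.push (Ctx.subst Γ (Sub.wk _ Θ)) .pos _ ((D.comp T K).argAt a i))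
      ⟨.neg, 0, (D.comp T K).contAt a i⟩)
    (hH : ∀ v, H v → ∀ K w, ((D.comp T K).guardAt i).Holds (Var.append _ w v) →
      H' K (Var.append _ w v)) :
    VTy H Γ (.compCase T c) (.con T a i) := by
  choose C hC hc using hc
  refine ⟨_, fun v hv => ?_, .compCase hc⟩
  exact (Constraint.holds_conj _ _).2 fun K w hw => hC K _ (hH v hv K w hw)

theorem VTy.clos {V : Value D .neg} {A : Ty Sg Ξ Θ .neg} (h : VTy H Γ V A) :
    VTy H Γ (.clos V) (.clos A) :=
  h.imp fun _ h => ⟨h.1, .clos h.2⟩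

theorem STy.closCase {c : Command D} {A : Ty Sg Ξ Θ .neg}
    (h : CTy H c (Γ.push .neg 1 (fun _ => A)) Δ) : STy H Γ (.closCase c) (.clos A) Δ :=
  h.imp fun _ h => ⟨h.1, .closCase h.2⟩

theorem VTy.thunkCase {c : Command D} {A : Ty Sg Ξ Θ .pos} (h : CTy H c Γ ⟨.pos, 0, A⟩) :
    VTy H Γ (.thunkCase c) (.thunk A) :=
  h.imp fun _ h => ⟨h.1, .thunkCase h.2⟩

theorem STy.thunk {S : Stack D .pos} {A : Ty Sg Ξ Θ .pos} (h : STy H Γ S A Δ) :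
    STy H Γ (.thunk S) (.thunk A) Δ :=
  h.imp fun _ h => ⟨h.1, .thunk h.2⟩

theorem VTy.bangCase {c : Command D} {A : Ty Sg Ξ Θ .neg} (hΓ : Γ.AllShareable)
    (h : CTy H c Γ ⟨.neg, 0, A⟩) : VTy H Γ (.bangCase c) (.bang A) :=
  h.imp fun _ h => ⟨h.1, .bangCase hΓ h.2⟩

theorem STy.bang {S : Stack D .neg} {A : Ty Sg Ξ Θ .neg} (h : STy H Γ S A Δ) :
    STy H Γ (.bang S) (.bang A) Δ :=
  h.imp fun _ h => ⟨h.1, .bang h.2⟩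

theorem VTy.fixCase {S : Stack D .pos} {A : Ty Sg Ξ Θ .neg} (hΓ : Γ.AllShareable)
    (h : STy H Γ S (.fix A) ⟨.neg, 0, A⟩) : VTy H Γ (.fixCase S) (.fix A) :=
  h.imp fun _ h => ⟨h.1, .fixCase hΓ h.2⟩

theorem STy.fix {S : Stack D .neg} {A : Ty Sg Ξ Θ .neg} (h : STy H Γ S A Δ) :
    STy H Γ (.fix S) (.fix A) Δ :=
  h.imp fun _ h => ⟨h.1, .fix h.2⟩

/-! ## Instantiation of parameters and renaming of variables in derivations -/

/-- The judgement stays derivable when its parameters are instantiated and its variables are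
renamed injectively. -/
def Sequent.ActStable : Sequent D Ξ → Prop
  | .val Θ C Γ V A => ∀ (Θ' : PCtx P) (σ : Sub P Θ Θ') (ρ : Ren), ρ.Inj →
      VTy (fun v => C.Holds (σ.eval v)) (Γ.act σ ρ) (V.rename ρ) (A.subst σ)
  | .stk Θ C Γ S A Δ => ∀ (Θ' : PCtx P) (σ : Sub P Θ Θ') (ρ : Ren), ρ.Inj →
      STy (fun v => C.Holds (σ.eval v)) (Γ.act σ ρ) (S.rename ρ) (A.subst σ) (Δ.act σ ρ)
  | .cmd c Θ C Γ Δ => ∀ (Θ' : PCtx P) (σ : Sub P Θ Θ') (ρ : Ren), ρ.Inj →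
      CTy (fun v => C.Holds (σ.eval v)) (c.rename ρ) (Γ.act σ ρ) (Δ.act σ ρ)

/-- Later uses need only weakening by parameters and shifting of variables, but neither class is
closed under going below a binder, hence the general form. Injectivity on value variables keeps the
parts of a split context apart; stack variables need no such condition because only one is in scope.
-/
theorem Derivable.actStable {s : Sequent D Ξ} (h : Derivable s) : s.ActStable := by
  induction h with
  | @var Θ ε i A =>
    intro Θ' σ ρ hρ
    rw [Ctx.act, Ctx.single_subst, Ctx.single_rename hρ]
    exact .var _ _
  | covar =>
    intro Θ' σ ρ hρ
    rw [Ctx.act, Ctx.empty_subst, Ctx.empty_rename hρ]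
    exact .covar _ _
  | @convVal Θ C E Γ ε V A B _ hE ih =>
    intro Θ' σ ρ hρ
    refine ((ih Θ' σ ρ hρ).mono fun v hv => hv.1).conv (E := E.subst σ) ?_ fun v hv =>
      (Constraint.holds_subst _ _ _).2 hv.2
    exact hE.subst (fun _ _ => rfl) fun v hv => (Constraint.holds_subst _ _ _).1 hv
  | @convStk Θ C E Γ ε Δ S A B _ hE ih =>
    intro Θ' σ ρ hρ
    refine ((ih Θ' σ ρ hρ).mono fun v hv => hv.1).conv (E := E.subst σ) ?_ fun v hv =>
      (Constraint.holds_subst _ _ _).2 hv.2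
    exact hE.subst (fun _ _ => rfl) fun v hv => (Constraint.holds_subst _ _ _).1 hv
  | @hide Θ Ψ C Γ Δ c _ ih =>
    intro Θ' σ ρ hρ
    have := ih (Ψ ++ Θ') (σ.lift Ψ) ρ hρ
    rw [Ctx.act_wk_lift hρ, CoCtx.act_wk_lift] at this
    refine this.hide fun v hv => ?_
    obtain ⟨w, hw⟩ := hv
    exact ⟨w, by rwa [Sub.eval_lift]⟩
  | cut _ _ hΓ ihV ihS =>
    intro Θ' σ ρ hρ
    exact .cut ((ihV Θ' σ ρ hρ).mono fun v hv => hv.1) ((ihS Θ' σ ρ hρ).mono fun v hv => hv.2)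
      (Ctx.pair_act hΓ σ hρ)
  | del _ hA _ hΓ ihV ihc =>
    intro Θ' σ ρ hρ
    exact .del ((ihV Θ' σ ρ hρ).mono fun v hv => hv.1) (hA.subst σ)
      ((ihc Θ' σ ρ hρ).mono fun v hv => hv.2) (Ctx.pair_act hΓ σ hρ)
  | dup _ hA _ hΓ ihV ihc =>
    intro Θ' σ ρ hρ
    have := ihc Θ' σ _ (hρ.lift .val .pos 2)
    rw [Ctx.push_act hρ, CoCtx.act_lift_val] at this
    exact .dup ((ihV Θ' σ ρ hρ).mono fun v hv => hv.1) (hA.subst σ)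
      (this.mono fun v hv => hv.2) (Ctx.pair_act hΓ σ hρ)
  | letStk _ ih =>
    intro Θ' σ ρ hρ
    have := ih Θ' σ _ (hρ.lift .stk .neg 1)
    rw [Ctx.act_lift_stk] at this
    exact .letStk this
  | letVal _ ih =>
    intro Θ' σ ρ hρ
    have := ih Θ' σ _ (hρ.lift .val .pos 1)
    rw [Ctx.push_act hρ, CoCtx.act_lift_val] at this
    exact .letVal this
  | @data Θ T K V a i C Γs Γ _ hΓ ih =>
    intro Θ' σ ρ hρ
    refine .data (Γs := fun k => (Γs k).act σ ρ)
      (H' := fun w => ∀ k, (C k).Holds ((σ.lift _).eval w)) (fun k => ?_) (hΓ.act σ hρ)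
      fun v hv => ?_
    · have := ih k _ (σ.lift _) ρ hρ
      rw [Ctx.act_wk_lift hρ, DataCtor.argAt_subst] at this
      exact this.mono fun v hv => hv k
    · obtain ⟨w, hw, hw'⟩ := hv
      refine ⟨w, ?_, fun k => ?_⟩
      · rwa [DataCtor.guardAt_comp_holds, Sub.eval_lift]
      · rw [Sub.eval_lift]
        exact (Constraint.holds_conj _ _).1 hw' k
  | @dataCase Θ T c a i C Γ Δ _ ih =>
    intro Θ' σ ρ hρ
    refine .dataCase (H' := fun K w => (C K).Holds ((σ.lift _).eval w)) (fun K => ?_)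
      fun v hv K w hw => ?_
    · have := ih K _ (σ.lift _) _ (hρ.lift .val .pos (D.data T K).arity)
      rw [Ctx.push_act hρ, CoCtx.act_lift_val, Ctx.act_wk_lift hρ, CoCtx.act_wk_lift] at this
      simp only [DataCtor.argAt_subst] at this
      exact this
    · rw [DataCtor.guardAt_comp_holds, Sub.eval_lift] at hw
      rw [Sub.eval_lift]
      exact (Constraint.holds_conj _ _).1 hv K w hw
  | @comp Θ T K V S a i C C' Γs Γ' Γ Δ _ _ hΓ ihV ihS =>
    intro Θ' σ ρ hρ
    refine .comp (Γs := fun k => (Γs k).act σ ρ) (Γ' := Γ'.act σ ρ)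
      (H' := fun w => (∀ k, (C k).Holds ((σ.lift _).eval w)) ∧ C'.Holds ((σ.lift _).eval w))
      (fun k => ?_) ?_ ?_ fun v hv => ?_
    · have := ihV k _ (σ.lift _) ρ hρ
      rw [Ctx.act_wk_lift hρ, DataCtor.argAt_subst] at this
      exact this.mono fun v hv => hv.1 k
    · have := ihS _ (σ.lift _) ρ hρ
      rw [Ctx.act_wk_lift hρ, CoCtx.act_wk_lift, CompCtor.contAt_subst] at this
      exact this.mono fun v hv => hv.2
    · convert hΓ.act σ hρ using 1
      funext o
      cases o <;> rfl
    · obtain ⟨w, hw, hw', hw''⟩ := hv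
      refine ⟨w, ?_, fun k => ?_, ?_⟩
      · rwa [DataCtor.guardAt_comp_holds, Sub.eval_lift]
      · rw [Sub.eval_lift]
        exact (Constraint.holds_conj _ _).1 hw' k
      · rwa [Sub.eval_lift]
  | @compCase Θ T c a i C Γ _ ih =>
    intro Θ' σ ρ hρ
    refine .compCase (H' := fun K w => (C K).Holds ((σ.lift _).eval w)) (fun K => ?_)
      fun v hv K w hw => ?_
    · have := ih K _ (σ.lift _) _ ((hρ.lift .val .pos (D.comp T K).arity).lift .stk .neg 1)
      rw [Ctx.act_lift_stk, Ctx.push_act hρ, Ctx.act_wk_lift hρ] at this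
      simp only [DataCtor.argAt_subst, CoCtx.act, CompCtor.contAt_subst] at this
      exact this
    · rw [DataCtor.guardAt_comp_holds, Sub.eval_lift] at hw
      rw [Sub.eval_lift]
      exact (Constraint.holds_conj _ _).1 hv K w hw
  | clos _ ih => exact fun Θ' σ ρ hρ => .clos (ih Θ' σ ρ hρ)
  | closCase _ ih =>
    intro Θ' σ ρ hρ
    have := ih Θ' σ _ (hρ.lift .val .neg 1)
    rw [Ctx.push_act hρ, CoCtx.act_lift_val] at this
    exact .closCase this
  | thunkCase _ ih =>
    intro Θ' σ ρ hρ
    have := ih Θ' σ _ (hρ.lift .stk .pos 1)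
    rw [Ctx.act_lift_stk] at this
    exact .thunkCase this
  | thunk _ ih => exact fun Θ' σ ρ hρ => .thunk (ih Θ' σ ρ hρ)
  | bangCase hΓ _ ih =>
    intro Θ' σ ρ hρ
    have := ih Θ' σ _ (hρ.lift .stk .neg 1)
    rw [Ctx.act_lift_stk] at this
    exact .bangCase ((hΓ.subst σ).rename hρ) this
  | bang _ ih => exact fun Θ' σ ρ hρ => .bang (ih Θ' σ ρ hρ)
  | fixCase hΓ _ ih =>
    intro Θ' σ ρ hρ
    have := ih Θ' σ _ (hρ.lift .stk .neg 1)
    rw [Ctx.act_lift_stk] at this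
    exact .fixCase ((hΓ.subst σ).rename hρ) this
  | fix _ ih => exact fun Θ' σ ρ hρ => .fix (ih Θ' σ ρ hρ)

theorem VTy.wk {V : Value D ε} {A : Ty Sg Ξ Θ ε} (h : VTy H Γ V A) (Ψ : PCtx P) :
    VTy (fun w => H ((Sub.wk Ψ Θ).eval w)) (Γ.subst (Sub.wk Ψ Θ)) V (A.subst (Sub.wk Ψ Θ)) := by
  obtain ⟨C, hC, h⟩ := h
  have := h.actStable _ (Sub.wk Ψ Θ) _ Ren.Inj.ids
  rw [Expr.rename_ids, Ctx.act, Ctx.rename_ids] at this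
  exact this.mono fun w hw => hC _ hw

theorem STy.wk {S : Stack D ε} {A : Ty Sg Ξ Θ ε} (h : STy H Γ S A Δ) (Ψ : PCtx P) :
    STy (fun w => H ((Sub.wk Ψ Θ).eval w)) (Γ.subst (Sub.wk Ψ Θ)) S (A.subst (Sub.wk Ψ Θ))
      (Δ.subst (Sub.wk Ψ Θ)) := by
  obtain ⟨C, hC, h⟩ := h
  have := h.actStable _ (Sub.wk Ψ Θ) _ Ren.Inj.ids
  rw [Expr.rename_ids, Ctx.act, Ctx.rename_ids] at this
  exact this.mono fun w hw => hC _ hw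

theorem VTy.rename {V : Value D ε} {A : Ty Sg Ξ Θ ε} (h : VTy H Γ V A) {ρ : Ren} (hρ : ρ.Inj) :
    VTy H (Γ.rename ρ) (V.rename ρ) A := by
  obtain ⟨C, hC, h⟩ := h
  have := h.actStable _ (Sub.ids Θ) _ hρ
  rw [Ctx.act, Ctx.subst_ids, Ty.subst_ids] at this
  exact this.mono fun w hw => hC _ hw

theorem STy.rename {S : Stack D ε} {A : Ty Sg Ξ Θ ε} (h : STy H Γ S A Δ) {ρ : Ren}
    (hρ : ρ.Inj) :
    STy H (Γ.rename ρ) (S.rename ρ) A ⟨Δ.pol, ρ .stk Δ.pol Δ.name, Δ.ty⟩ := by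
  obtain ⟨C, hC, h⟩ := h
  have := h.actStable _ (Sub.ids Θ) _ hρ
  rw [Ctx.act, Ctx.subst_ids, Ty.subst_ids, CoCtx.act, Ty.subst_ids] at this
  exact this.mono fun w hw => hC _ hw

/-- Values of shareable type use variables of shareable type only. -/
theorem VTy.allShareable {V : Value D ε} {A : Ty Sg Ξ Θ ε} (h : VTy H Γ V A)
    (hA : A.Shareable) : Γ.AllShareable := by
  -- The claim concerns values only, so the induction over all judgements has a trivial motive for
  -- stacks and commands.
  let M : Sequent D Ξ → Prop
    | .val _ _ Γ _ A => A.Shareable → Γ.AllShareable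
    | _ => True
  have key : ∀ s : Sequent D Ξ, Derivable s → M s := by
    intro s hs
    induction hs with
    | var =>
      intro hA ε' j B hB
      obtain ⟨rfl, rfl, hAB⟩ := Ctx.of_single_eq_some hB
      cases hAB
      exact hA
    | convVal _ hE ih => exact fun hB => ih (hE.shareable hB)
    | bangCase hΓ => exact fun _ => hΓ
    | fixCase hΓ => exact fun _ => hΓ
    | data => intro h; cases h
    | compCase => intro h; cases h
    | clos => intro h; cases h
    | thunkCase => intro h; cases h
    -- The value `μα.c` has negative type, while shareable types are positive.
    | @letStk _ _ _ _ A => intro h; cases A <;> cases h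
    | _ => trivial
  exact key _ h.choose_spec.2 hA

/-! ## Families of contexts -/

/-- Indices of the terms that are substituted into a judgement: `some (ε, i)` for the value
variable `i` of polarity `ε`, and `none` for the stack variable. -/
abbrev Slot := Option (Pol × ℕ)

/-- The contexts used by the terms of a substitution. -/
abbrev Fam (Sg : TypeSig P) (Ξ : List (Kind P)) (Θ : PCtx P) := Slot → Ctx Sg Ξ Θ

namespace Ctx

/-- The slots of the variables of a context. -/
def dom (Γ : Ctx Sg Ξ Θ) : Set Slot := {p | ∃ ε i A, p = some (ε, i) ∧ Γ ε i = some A}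

theorem mem_dom {Γ : Ctx Sg Ξ Θ} {ε : Pol} {i : ℕ} {A : Ty Sg Ξ Θ ε} (h : Γ ε i = some A) :
    some (ε, i) ∈ Γ.dom := ⟨ε, i, A, rfl, h⟩

theorem none_notMem_dom (Γ : Ctx Sg Ξ Θ) : none ∉ Γ.dom := by
  rintro ⟨ε, i, A, h, -⟩
  cases h

theorem dom_subst (Γ : Ctx Sg Ξ Θ) (σ : Sub P Θ Θ') : (Γ.subst σ).dom = Γ.dom := by
  ext p
  constructor
  · rintro ⟨ε, i, B, rfl, h⟩
    obtain ⟨A, hA, -⟩ := subst_eq_some.1 h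
    exact mem_dom hA
  · rintro ⟨ε, i, A, rfl, h⟩
    exact mem_dom (subst_eq_some.2 ⟨A, h, rfl⟩)

theorem Merge.mem_dom_iff {ι : Type} {Γs : ι → Ctx Sg Ξ Θ} {Γ : Ctx Sg Ξ Θ} (h : Merge Γs Γ)
    (p : Slot) : p ∈ Γ.dom ↔ ∃ k, p ∈ (Γs k).dom := by
  constructor
  · rintro ⟨ε, i, A, rfl, hA⟩
    obtain ⟨k, hk⟩ := h.cover _ _ _ hA
    exact ⟨k, mem_dom hk⟩
  · rintro ⟨k, ε, i, A, rfl, hA⟩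
    exact mem_dom (h.incl k _ _ _ hA)

end Ctx

namespace Fam

/-- The contexts of a family agree, and are disjoint except for variables of shareable type. -/
def Coh (G : Fam Sg Ξ Θ) : Prop :=
  ∀ p q ε i A B, G p ε i = some A → G q ε i = some B → A = B ∧ (p ≠ q → A.Shareable)

/-- The union of the contexts of the slots in `U`. -/
noncomputable def sel (G : Fam Sg Ξ Θ) (U : Set Slot) : Ctx Sg Ξ Θ :=
  .ofRel fun ε i A => ∃ p ∈ U, G p ε i = some A

variable {G : Fam Sg Ξ Θ}

theorem Coh.sel_eq_some (hG : G.Coh) {U : Set Slot} {ε : Pol} {i : ℕ} {A : Ty Sg Ξ Θ ε} :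
    G.sel U ε i = some A ↔ ∃ p ∈ U, G p ε i = some A := by
  refine Ctx.ofRel_eq_some ?_
  rintro ε i A B ⟨p, -, hA⟩ ⟨q, -, hB⟩
  exact (hG p q ε i A B hA hB).1

/-- A variable can reach two parts in two ways: through one slot selected by both, where `hU`
applies, or through two different slots, where coherence applies. -/
theorem Coh.merge_sel (hG : G.Coh) {ι : Type} {U : ι → Set Slot} {W : Set Slot}
    (hW : ∀ p, p ∈ W ↔ ∃ k, p ∈ U k)
    (hU : ∀ k l p, k ≠ l → p ∈ U k → p ∈ U l → (G p).AllShareable) :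
    Ctx.Merge (fun k => G.sel (U k)) (G.sel W) where
  incl k ε i A h := by
    obtain ⟨p, hp, h⟩ := hG.sel_eq_some.1 h
    exact hG.sel_eq_some.2 ⟨p, (hW p).2 ⟨k, hp⟩, h⟩
  cover ε i A h := by
    obtain ⟨p, hp, h⟩ := hG.sel_eq_some.1 h
    obtain ⟨k, hk⟩ := (hW p).1 hp
    exact ⟨k, hG.sel_eq_some.2 ⟨p, hk, h⟩⟩
  linear k l ε i A B hkl hA hB := by
    obtain ⟨p, hp, hA⟩ := hG.sel_eq_some.1 hA
    obtain ⟨q, hq, hB⟩ := hG.sel_eq_some.1 hB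
    by_cases hpq : p = q
    · subst hpq
      exact hU k l p hkl hp hq _ _ _ hA
    · exact (hG p q ε i A B hA hB).2 hpq

theorem Coh.merge_sel_pair (hG : G.Coh) {U U' W : Set Slot} (hW : W = U ∪ U')
    (hU : ∀ p ∈ U, p ∈ U' → (G p).AllShareable) :
    Ctx.Merge ![G.sel U, G.sel U'] (G.sel W) := by
  have := hG.merge_sel (U := ![U, U']) (W := W) (fun p => by simp [hW, Fin.exists_fin_two]) ?_
  · convert this using 1
    funext k
    fin_cases k <;> rfl
  · intro k l p hkl hk hl
    fin_cases k <;> fin_cases l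
    · exact absurd rfl hkl
    · exact hU p hk hl
    · exact hU p hl hk
    · exact absurd rfl hkl

/-! ### Weakening by parameters -/

/-- Weakening by the fresh parameters `Ψ`. -/
def wk (Ψ : PCtx P) (G : Fam Sg Ξ Θ) : Fam Sg Ξ (Ψ ++ Θ) := fun p => (G p).subst (Sub.wk Ψ Θ)

theorem Coh.wk (hG : G.Coh) (Ψ : PCtx P) : (G.wk Ψ).Coh := by
  intro p q ε i A B hA hB
  obtain ⟨A', hA', rfl⟩ := Ctx.subst_eq_some.1 hA
  obtain ⟨B', hB', rfl⟩ := Ctx.subst_eq_some.1 hB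
  obtain ⟨rfl, h⟩ := hG p q ε i A' B' hA' hB'
  exact ⟨rfl, fun hpq => (h hpq).subst _⟩

theorem Coh.sel_wk (hG : G.Coh) (Ψ : PCtx P) (U : Set Slot) :
    (G.wk Ψ).sel U = (G.sel U).subst (Sub.wk Ψ Θ) := by
  refine Ctx.ext_some fun ε i B => ?_
  rw [(hG.wk Ψ).sel_eq_some, Ctx.subst_eq_some]
  simp only [hG.sel_eq_some, Fam.wk, Ctx.subst_eq_some]
  constructor
  · rintro ⟨p, hp, A, hA, hB⟩; exact ⟨A, ⟨p, hp, hA⟩, hB⟩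
  · rintro ⟨A, ⟨p, hp, hA⟩, hB⟩; exact ⟨p, hp, A, hA, hB⟩

/-! ### Binders of value variables -/

/-- The slot of an old variable under a binder of `n` value variables of polarity `ε`. -/
def emb (ε : Pol) (n : ℕ) : Slot → Slot :=
  Option.map fun p => (p.1, Ren.shift .val ε n .val p.1 p.2)

theorem emb_injective (ε : Pol) (n : ℕ) : Function.Injective (emb ε n) := by
  refine Option.map_injective ?_
  rintro ⟨ε₁, i⟩ ⟨ε₂, j⟩ h
  simp only [Prod.mk.injEq] at h
  obtain ⟨rfl, h⟩ := h
  rw [Ren.Inj.shift .val ε n ε₁ h]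

/-- Going under a binder of `n` value variables of polarity `ε`. -/
noncomputable def lift (ε : Pol) (n : ℕ) (A : Fin n → Ty Sg Ξ Θ ε) (G : Fam Sg Ξ Θ) : Fam Sg Ξ Θ
  | none => (G none).rename (Ren.shift .val ε n)
  | some (ε', i) =>
    if ε' = ε then
      if h : i < n then .single ε i (A ⟨i, h⟩)
      else (G (some (ε', i - n))).rename (Ren.shift .val ε n)
    else (G (some (ε', i))).rename (Ren.shift .val ε n)

variable {ε : Pol} {n : ℕ} {A : Fin n → Ty Sg Ξ Θ ε}

theorem lift_bound (G : Fam Sg Ξ Θ) {i : ℕ} (h : i < n) :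
    G.lift ε n A (some (ε, i)) = .single ε i (A ⟨i, h⟩) := by
  simp [lift, h]

theorem lift_emb (G : Fam Sg Ξ Θ) (p : Slot) :
    G.lift ε n A (emb ε n p) = (G p).rename (Ren.shift .val ε n) := by
  rcases p with _ | ⟨ε', i⟩
  · rfl
  · by_cases h : ε' = ε
    · subst h; simp [emb, lift, Ren.shift]
    · simp [emb, lift, Ren.shift, h]

theorem bound_or_emb (ε : Pol) (n : ℕ) (p : Slot) :
    (∃ i < n, p = some (ε, i)) ∨ ∃ q, p = emb ε n q := by
  rcases p with _ | ⟨ε', i⟩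
  · exact .inr ⟨none, rfl⟩
  · rcases binder_cases ε n ε' i with ⟨rfl, h⟩ | ⟨rfl, j, rfl⟩ | h
    · exact .inl ⟨i, h, rfl⟩
    · exact .inr ⟨some (ε', j), by simp [emb, Ren.shift]⟩
    · exact .inr ⟨some (ε', i), by simp [emb, Ren.shift, h]⟩

/-- Shifting vacates the indices of the new binder, so the contexts of old terms cannot clash with
the bound variables. -/
theorem rename_shift_lt (Γ : Ctx Sg Ξ Θ) {i : ℕ} (h : i < n) :
    Γ.rename (Ren.shift .val ε n) ε i = none := by
  refine Option.eq_none_iff_forall_ne_some.2 fun A hA => ?_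
  obtain ⟨j, hj, -⟩ := (Ctx.rename_eq_some (Ren.Inj.shift _ _ _)).1 hA
  rw [Ren.shift_self] at hj
  omega

theorem Coh.lift (hG : G.Coh) (A : Fin n → Ty Sg Ξ Θ ε) : (G.lift ε n A).Coh := by
  intro p q ε' j B B' hB hB'
  rcases bound_or_emb ε n p with ⟨i, hi, rfl⟩ | ⟨p, rfl⟩ <;>
    rcases bound_or_emb ε n q with ⟨i', hi', rfl⟩ | ⟨q, rfl⟩
  · rw [lift_bound G hi] at hB
    rw [lift_bound G hi'] at hB'
    obtain ⟨rfl, rfl, -⟩ := Ctx.of_single_eq_some hB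
    obtain ⟨-, rfl, -⟩ := Ctx.of_single_eq_some hB'
    exact ⟨Option.some.inj (hB.symm.trans hB'), fun h => absurd rfl h⟩
  · rw [lift_bound G hi] at hB
    rw [lift_emb] at hB'
    obtain ⟨rfl, rfl, -⟩ := Ctx.of_single_eq_some hB
    rw [rename_shift_lt _ hi] at hB'
    cases hB'
  · rw [lift_bound G hi'] at hB'
    rw [lift_emb] at hB
    obtain ⟨rfl, rfl, -⟩ := Ctx.of_single_eq_some hB'
    rw [rename_shift_lt _ hi'] at hB
    cases hB
  · have hρ := Ren.Inj.shift .val ε n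
    rw [lift_emb] at hB hB'
    obtain ⟨i, rfl, h⟩ := (Ctx.rename_eq_some hρ).1 hB
    rw [Ctx.rename_apply hρ] at hB'
    obtain ⟨rfl, h⟩ := hG p q ε' i B B' h hB'
    exact ⟨rfl, fun hpq => h fun e => hpq (e ▸ rfl)⟩

/-- The sets of slots are left abstract to cover selections with and without the slot of the stack
variable. -/
theorem Coh.sel_lift (hG : G.Coh) (A : Fin n → Ty Sg Ξ Θ ε) {U U' : Set Slot}
    (hU : ∀ i < n, some (ε, i) ∈ U') (hU' : ∀ p, emb ε n p ∈ U' ↔ p ∈ U) :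
    (G.lift ε n A).sel U' = (G.sel U).push ε n A := by
  have hρ := Ren.Inj.shift .val ε n
  refine Ctx.ext_some fun ε' j B => ?_
  rw [(hG.lift A).sel_eq_some]
  constructor
  · rintro ⟨p, hp, hB⟩
    rcases bound_or_emb ε n p with ⟨i, hi, rfl⟩ | ⟨p, rfl⟩
    · rw [lift_bound G hi] at hB
      obtain ⟨rfl, rfl, -⟩ := Ctx.of_single_eq_some hB
      rw [Ctx.single_self] at hB
      rwa [Ctx.push_lt _ _ _ hi]
    · rw [lift_emb] at hB
      obtain ⟨i, rfl, h⟩ := (Ctx.rename_eq_some hρ).1 hB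
      by_cases hε : ε' = ε
      · subst hε
        rw [Ren.shift_self, Ctx.push_add]
        exact hG.sel_eq_some.2 ⟨p, (hU' p).1 hp, h⟩
      · rw [Ren.shift_ne _ _ hε, Ctx.push_ne _ _ _ hε]
        exact hG.sel_eq_some.2 ⟨p, (hU' p).1 hp, h⟩
  · intro hB
    rcases binder_cases ε n ε' j with ⟨rfl, h⟩ | ⟨rfl, j, rfl⟩ | h
    · refine ⟨_, hU j h, ?_⟩
      rwa [lift_bound G h, Ctx.single_self, ← Ctx.push_lt _ _ _ h]
    · rw [Ctx.push_add] at hB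
      obtain ⟨p, hp, hB⟩ := hG.sel_eq_some.1 hB
      refine ⟨_, (hU' p).2 hp, ?_⟩
      rwa [lift_emb, ← Ren.shift_self .val ε' n j, Ctx.rename_apply hρ]
    · rw [Ctx.push_ne _ _ _ h] at hB
      obtain ⟨p, hp, hB⟩ := hG.sel_eq_some.1 hB
      refine ⟨_, (hU' p).2 hp, ?_⟩
      rwa [lift_emb, ← Ren.shift_ne (k := .val) n j h, Ctx.rename_apply hρ]

theorem bound_mem_dom_push (Γ : Ctx Sg Ξ Θ) (A : Fin n → Ty Sg Ξ Θ ε) (i : ℕ) (h : i < n) :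
    some (ε, i) ∈ (Γ.push ε n A).dom :=
  Ctx.mem_dom (Ctx.push_lt Γ ε A h)

theorem emb_mem_dom_push (Γ : Ctx Sg Ξ Θ) (A : Fin n → Ty Sg Ξ Θ ε) (p : Slot) :
    emb ε n p ∈ (Γ.push ε n A).dom ↔ p ∈ Γ.dom := by
  have key : ∀ ε' i, Γ.push ε n A ε' (Ren.shift .val ε n .val ε' i) = Γ ε' i := by
    intro ε' i
    by_cases h : ε' = ε
    · subst h; rw [Ren.shift_self, Ctx.push_add]
    · rw [Ren.shift_ne _ _ h, Ctx.push_ne _ _ _ h]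
  rcases p with _ | ⟨ε', i⟩
  · exact iff_of_false (Ctx.none_notMem_dom _) (Ctx.none_notMem_dom _)
  · constructor
    · rintro ⟨ε₁, j, B, h, hB⟩
      simp only [emb, Option.map_some, Option.some.injEq, Prod.mk.injEq] at h
      obtain ⟨rfl, rfl⟩ := h
      rw [key] at hB
      exact Ctx.mem_dom hB
    · rintro ⟨ε₁, j, B, h, hB⟩
      cases h
      refine Ctx.mem_dom (A := B) ?_
      rwa [key]

theorem Coh.sel_lift_dom (hG : G.Coh) (Γ : Ctx Sg Ξ Θ) (A : Fin n → Ty Sg Ξ Θ ε) :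
    (G.lift ε n A).sel (Γ.push ε n A).dom = (G.sel Γ.dom).push ε n A :=
  hG.sel_lift A (bound_mem_dom_push Γ A) (emb_mem_dom_push Γ A)

theorem Coh.sel_lift_insert_dom (hG : G.Coh) (Γ : Ctx Sg Ξ Θ) (A : Fin n → Ty Sg Ξ Θ ε) :
    (G.lift ε n A).sel (insert none (Γ.push ε n A).dom) =
      (G.sel (insert none Γ.dom)).push ε n A := by
  refine hG.sel_lift A (fun i hi => .inr (bound_mem_dom_push Γ A i hi)) fun p => ?_
  rw [Set.mem_insert_iff, Set.mem_insert_iff, emb_mem_dom_push]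
  cases p <;> simp [emb]

/-! ### Binders of stack variables -/

/-- Going under a binder of a stack variable. -/
def covar (G : Fam Sg Ξ Θ) : Fam Sg Ξ Θ
  | none => .empty
  | some p => G (some p)

theorem Coh.covar (hG : G.Coh) : G.covar.Coh := by
  rintro (_ | p) (_ | q) ε i A B hA hB
  · cases hA
  · cases hA
  · cases hB
  · exact hG _ _ ε i A B hA hB

/-- Under a stack binder the bound variable is the only stack in scope. It is mapped to itself and
uses no value variables, so its slot contributes nothing. -/
theorem Coh.sel_covar (hG : G.Coh) (Γ : Ctx Sg Ξ Θ) :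
    G.covar.sel (insert none Γ.dom) = G.sel Γ.dom := by
  refine Ctx.ext_some fun ε i B => ?_
  rw [hG.covar.sel_eq_some, hG.sel_eq_some]
  constructor
  · rintro ⟨_ | p, hp, hB⟩
    · cases hB
    · exact ⟨some p, hp.resolve_left (by simp), hB⟩
  · rintro ⟨_ | p, hp, hB⟩
    · exact absurd hp (Ctx.none_notMem_dom _)
    · exact ⟨some p, .inr hp, hB⟩

end Fam

/-! ## The substitution lemma -/

namespace Subst

theorem push_lt (σ : Subst D) (k : Side) (ε : Pol) {n i : ℕ} (t : Fin n → Expr D (.term k ε))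
    (h : i < n) : σ.push k ε n t k ε i = t ⟨i, h⟩ := by
  simp [push, h]

theorem push_add (σ : Subst D) (k : Side) (ε : Pol) {n : ℕ} (i : ℕ)
    (t : Fin n → Expr D (.term k ε)) : σ.push k ε n t k ε (i + n) = σ k ε i := by
  simp [push]

theorem push_ne_pol (σ : Subst D) (k : Side) {ε ε' : Pol} {n : ℕ} (i : ℕ)
    (t : Fin n → Expr D (.term k ε)) (h : ε' ≠ ε) : σ.push k ε n t k ε' i = σ k ε' i := by
  simp [push, h]

theorem push_ne_side (σ : Subst D) {k k' : Side} {ε ε' : Pol} {n : ℕ} (i : ℕ)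
    (t : Fin n → Expr D (.term k ε)) (h : k' ≠ k) : σ.push k ε n t k' ε' i = σ k' ε' i := by
  simp [push, h]

end Subst

/-- The values of `σ` have the types that `Γ` assigns to the variables. -/
def VSub (σ : Subst D) (H : Valuation P Θ → Prop) (G : Fam Sg Ξ Θ) (Γ : Ctx Sg Ξ Θ) : Prop :=
  ∀ ε i A, Γ ε i = some A → VTy H (G (some (ε, i))) (σ .val ε i) A

/-- The stack of `σ` has the type that `Δ` assigns to the stack variable. -/
def SSub (σ : Subst D) (H : Valuation P Θ → Prop) (G : Fam Sg Ξ Θ) (Δ Δ' : CoCtx Sg Ξ Θ) : Prop :=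
  STy H (G none) (σ .stk Δ.pol Δ.name) Δ.ty Δ'

section

variable {σ : Subst D} {H : Valuation P Θ → Prop} {G : Fam Sg Ξ Θ} {Γ Γ₁ Γ₂ : Ctx Sg Ξ Θ}
  {Δ Δ' : CoCtx Sg Ξ Θ}

theorem VSub.incl (h : VSub σ H G Γ) (hΓ : Γ₁.Incl Γ) : VSub σ H G Γ₁ :=
  fun ε i A hA => h ε i A (hΓ ε i A hA)

theorem VSub.wk (h : VSub σ H G Γ) (Ψ : PCtx P) :
    VSub σ (fun w => H ((Sub.wk Ψ Θ).eval w)) (G.wk Ψ) (Γ.subst (Sub.wk Ψ Θ)) := by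
  intro ε i B hB
  obtain ⟨A, hA, rfl⟩ := Ctx.subst_eq_some.1 hB
  exact (h ε i A hA).wk Ψ

theorem SSub.wk (h : SSub σ H G Δ Δ') (Ψ : PCtx P) :
    SSub σ (fun w => H ((Sub.wk Ψ Θ).eval w)) (G.wk Ψ) (Δ.subst (Sub.wk Ψ Θ))
      (Δ'.subst (Sub.wk Ψ Θ)) :=
  STy.wk h Ψ

theorem VSub.lift (h : VSub σ H G Γ) (ε : Pol) {n : ℕ} (A : Fin n → Ty Sg Ξ Θ ε) :
    VSub (σ.lift .val ε n) H (G.lift ε n A) (Γ.push ε n A) := by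
  have hρ := Ren.Inj.shift .val ε n
  intro ε' i B hB
  rcases binder_cases ε n ε' i with ⟨rfl, hi⟩ | ⟨rfl, j, rfl⟩ | hε
  · rw [Ctx.push_lt _ _ _ hi] at hB
    cases hB
    rw [Fam.lift_bound G hi, Subst.lift, Subst.push_lt _ _ _ _ hi]
    exact .var _ _
  · rw [Ctx.push_add] at hB
    have := Fam.lift_emb (A := A) G (some (ε', j))
    rw [Fam.emb, Option.map_some, Ren.shift_self] at this
    rw [this, Subst.lift, Subst.push_add]
    exact (h _ _ _ hB).rename hρ
  · rw [Ctx.push_ne _ _ _ hε] at hB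
    have := Fam.lift_emb (A := A) G (some (ε', i))
    rw [Fam.emb, Option.map_some, Ren.shift_ne _ _ hε] at this
    rw [this, Subst.lift, Subst.push_ne_pol _ _ _ _ hε]
    exact (h _ _ _ hB).rename hρ

theorem SSub.lift (h : SSub σ H G Δ Δ') (ε : Pol) {n : ℕ} (A : Fin n → Ty Sg Ξ Θ ε) :
    SSub (σ.lift .val ε n) H (G.lift ε n A) Δ Δ' := by
  have := STy.rename h (Ren.Inj.shift .val ε n)
  rw [SSub, Subst.lift, Subst.push_ne_side _ _ _ (by decide)]
  have e : Ren.shift .val ε n .stk Δ'.pol Δ'.name = Δ'.name := by simp [Ren.shift]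
  rw [e] at this
  exact this

theorem VSub.covar (h : VSub σ H G Γ) (ε : Pol) :
    VSub (σ.lift .stk ε 1) H G.covar Γ := by
  intro ε' i A hA
  have := (h ε' i A hA).rename (Ren.Inj.shift .stk ε 1)
  rw [Ctx.rename_shift_stk] at this
  rw [Subst.lift, Subst.push_ne_side _ _ _ (by decide)]
  exact this

theorem SSub.covar (σ : Subst D) (H : Valuation P Θ → Prop) (G : Fam Sg Ξ Θ) {ε : Pol}
    (A : Ty Sg Ξ Θ ε) : SSub (σ.lift .stk ε 1) H G.covar ⟨ε, 0, A⟩ ⟨ε, 0, A⟩ := by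
  simp only [SSub]
  rw [Subst.lift, Subst.push_lt _ _ _ _ Nat.zero_lt_one]
  exact .covar _ _

/-- Terms substituted for a variable that occurs in two parts of a context can be shared. -/
theorem VSub.allShareable {ι : Type} {Γs : ι → Ctx Sg Ξ Θ} (h : VSub σ H G Γ)
    (hΓ : Ctx.Merge Γs Γ) {k l : ι} (hkl : k ≠ l) {p : Slot} (hk : p ∈ (Γs k).dom)
    (hl : p ∈ (Γs l).dom) : (G p).AllShareable := by
  obtain ⟨ε, i, A, rfl, hA⟩ := hk
  obtain ⟨ε', j, B, e, hB⟩ := hl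
  cases e
  exact (h ε i A (hΓ.incl k _ _ _ hA)).allShareable (hΓ.linear k l _ _ _ _ hkl hA hB)

/-- A splitting of the source context induces one of the target context: a slot used by two parts
holds a value of shareable type, whose context is entirely shareable. -/
theorem VSub.merge (h : VSub σ H G Γ) (hG : G.Coh) {ι : Type} {Γs : ι → Ctx Sg Ξ Θ}
    (hΓ : Ctx.Merge Γs Γ) : Ctx.Merge (fun k => G.sel (Γs k).dom) (G.sel Γ.dom) :=
  hG.merge_sel hΓ.mem_dom_iff fun _ _ _ hkl hk hl => h.allShareable hΓ hkl hk hl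

/-- The version for `K(V⃗) · S`. The slot of the stack variable goes to the continuation alone, so
it is never shared. -/
theorem VSub.merge_option (h : VSub σ H G Γ) (hG : G.Coh) {ι : Type} {Γs : ι → Ctx Sg Ξ Θ}
    {Γ' : Ctx Sg Ξ Θ} (hΓ : Ctx.Merge (fun o : Option ι => o.elim Γ' Γs) Γ) :
    Ctx.Merge (fun o : Option ι => o.elim (G.sel (insert none Γ'.dom)) fun k => G.sel (Γs k).dom)
      (G.sel (insert none Γ.dom)) := by
  have := hG.merge_sel (W := insert none Γ.dom)
    (U := fun o : Option ι => o.elim (insert none Γ'.dom) fun k => (Γs k).dom) ?_ ?_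
  · convert this using 1
    funext o
    cases o <;> rfl
  · intro p
    rw [Set.mem_insert_iff, hΓ.mem_dom_iff, Option.exists, Option.exists]
    exact (or_assoc (a := p = none) (b := p ∈ Γ'.dom)).symm
  · have key : ∀ (o : Option ι) p, p ∈ o.elim (insert none Γ'.dom) (fun k => (Γs k).dom) →
        p ≠ none → p ∈ (o.elim Γ' Γs).dom := by
      rintro (_ | k) p hp hp'
      · exact hp.resolve_left hp'
      · exact hp
    intro k l p hkl hk hl
    by_cases hp : p = none
    · subst hp
      rcases k with _ | k
      · rcases l with _ | l
        · exact absurd rfl hkl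
        · exact absurd hl (Ctx.none_notMem_dom _)
      · exact absurd hk (Ctx.none_notMem_dom _)
    · exact h.allShareable hΓ hkl (key k p hk hp) (key l p hl hp)

theorem VSub.merge_pair (h : VSub σ H G Γ) (hG : G.Coh) (hΓ : Ctx.Merge ![Γ₁, Γ₂] Γ) :
    Ctx.Merge ![G.sel Γ₁.dom, G.sel (insert none Γ₂.dom)] (G.sel (insert none Γ.dom)) := by
  refine hG.merge_sel_pair ?_ ?_
  · ext p
    rw [Set.mem_insert_iff, hΓ.mem_dom_iff, Fin.exists_fin_two]
    exact or_left_comm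
  · intro p hp hp'
    rcases hp' with rfl | hp'
    · exact absurd hp (Ctx.none_notMem_dom _)
    · exact h.allShareable (k := 0) (l := 1) hΓ (by decide) hp hp'

theorem VSub.sel_allShareable (h : VSub σ H G Γ) (hG : G.Coh) (hΓ : Γ.AllShareable) :
    (G.sel Γ.dom).AllShareable := by
  intro ε i A hA
  obtain ⟨p, ⟨ε', j, B, rfl, hB⟩, hA⟩ := hG.sel_eq_some.1 hA
  exact (h ε' j B hB).allShareable (hΓ _ _ _ hB) _ _ _ hA

end

/-- The judgement stays derivable under well-typed substitutions. -/
def Sequent.SubstStable : Sequent D Ξ → Prop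
  | .val _ C Γ V A => ∀ H σ G, Fam.Coh G → VSub σ H G Γ →
      VTy (fun v => C.Holds v ∧ H v) (G.sel Γ.dom) (V.subst σ) A
  | .stk _ C Γ S A Δ => ∀ H σ G Δ', Fam.Coh G → VSub σ H G Γ → SSub σ H G Δ Δ' →
      STy (fun v => C.Holds v ∧ H v) (G.sel (insert none Γ.dom)) (S.subst σ) A Δ'
  | .cmd c _ C Γ Δ => ∀ H σ G Δ', Fam.Coh G → VSub σ H G Γ → SSub σ H G Δ Δ' →
      CTy (fun v => C.Holds v ∧ H v) (c.subst σ) (G.sel (insert none Γ.dom)) Δ'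

/-- At a variable the selected union is exactly the context of the substituted term. Rules with
several premises use the splitting lemmas for `VSub`; rules with binders weaken or shift the
substituted terms and extend the family of contexts. -/
theorem Derivable.substStable {s : Sequent D Ξ} (h : Derivable s) : s.SubstStable := by
  induction h with
  | @var Θ ε i A =>
    intro H σ G hG hσ
    have : G.sel (Ctx.single ε i A).dom = G (some (ε, i)) := by
      refine Ctx.ext_some fun ε' j B => hG.sel_eq_some.trans ⟨?_, fun h => ⟨_, ?_, h⟩⟩
      · rintro ⟨p, ⟨ε₁, i₁, A₁, rfl, hA₁⟩, hB⟩
        obtain ⟨rfl, rfl, -⟩ := Ctx.of_single_eq_some hA₁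
        exact hB
      · exact Ctx.mem_dom (Ctx.single_self ε i A)
    rw [this]
    exact (hσ ε i A (Ctx.single_self ε i A)).mono fun v hv => hv.2
  | @covar Θ ε i A =>
    intro H σ G Δ' hG _ hS
    have : G.sel (insert none (Ctx.empty : Ctx Sg Ξ Θ).dom) = G none := by
      refine Ctx.ext_some fun ε' j B => hG.sel_eq_some.trans ⟨?_, fun h => ⟨_, .inl rfl, h⟩⟩
      rintro ⟨p, rfl | ⟨ε₁, i₁, A₁, rfl, hA₁⟩, hB⟩
      · exact hB
      · cases hA₁
    rw [this]
    exact STy.mono hS fun v hv => hv.2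
  | convVal _ hE ih =>
    intro H σ G hG hσ
    exact ((ih H σ G hG hσ).mono fun v hv => ⟨hv.1.1, hv.2⟩).conv hE fun v hv => hv.1.2
  | convStk _ hE ih =>
    intro H σ G Δ' hG hσ hS
    exact ((ih H σ G Δ' hG hσ hS).mono fun v hv => ⟨hv.1.1, hv.2⟩).conv hE fun v hv => hv.1.2
  | @hide Θ Ψ C Γ Δ c _ ih =>
    intro H σ G Δ' hG hσ hS
    -- The substituted terms do not mention the hidden parameters, so they enter this scope by
    -- weakening and leave the hypothesis `H` on `Θ` unchanged.
    have := ih _ σ _ _ (hG.wk Ψ) (hσ.wk Ψ) (hS.wk Ψ)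
    rw [hG.sel_wk, Ctx.dom_subst] at this
    refine this.hide fun v hv => ?_
    obtain ⟨⟨w, hw⟩, hv⟩ := hv
    exact ⟨w, hw, by rwa [Sub.eval_wk_append]⟩
  | cut _ _ hΓ ihV ihS =>
    intro H σ G Δ' hG hσ hS
    exact .cut ((ihV H σ G hG (hσ.incl (hΓ.incl 0))).mono fun v hv => ⟨hv.1.1, hv.2⟩)
      ((ihS H σ G Δ' hG (hσ.incl (hΓ.incl 1)) hS).mono fun v hv => ⟨hv.1.2, hv.2⟩)
      (hσ.merge_pair hG hΓ)
  | del _ hA _ hΓ ihV ihc =>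
    intro H σ G Δ' hG hσ hS
    exact .del ((ihV H σ G hG (hσ.incl (hΓ.incl 0))).mono fun v hv => ⟨hv.1.1, hv.2⟩) hA
      ((ihc H σ G Δ' hG (hσ.incl (hΓ.incl 1)) hS).mono fun v hv => ⟨hv.1.2, hv.2⟩)
      (hσ.merge_pair hG hΓ)
  | @dup Θ C C' Γ₁ Γ₂ Γ Δ V c A _ hA _ hΓ ihV ihc =>
    intro H σ G Δ' hG hσ hS
    have hσ₂ : VSub σ H G Γ₂ := hσ.incl (hΓ.incl 1)
    have := ihc H _ _ Δ' (hG.lift fun _ => A) (hσ₂.lift .pos fun _ => A) (hS.lift .pos fun _ => A)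
    rw [hG.sel_lift_insert_dom] at this
    exact .dup ((ihV H σ G hG (hσ.incl (hΓ.incl 0))).mono fun v hv => ⟨hv.1.1, hv.2⟩) hA
      (this.mono fun v hv => ⟨hv.1.2, hv.2⟩) (hσ.merge_pair hG hΓ)
  | letStk _ ih =>
    intro H σ G hG hσ
    have := ih H _ _ _ hG.covar (hσ.covar .neg) (SSub.covar σ H G _)
    rw [hG.sel_covar] at this
    exact .letStk this
  | @letVal Θ C Γ Δ c A _ ih =>
    intro H σ G Δ' hG hσ hS
    have := ih H _ _ Δ' (hG.lift fun _ => A) (hσ.lift .pos fun _ => A) (hS.lift .pos fun _ => A)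
    rw [hG.sel_lift_insert_dom] at this
    exact .letVal this
  | @data Θ T K V a i C Γs Γ _ hΓ ih =>
    intro H σ G hG hσ
    refine .data (Γs := fun k => G.sel (Γs k).dom)
      (H' := fun w => (∀ k, (C k).Holds w) ∧ H ((Sub.wk _ Θ).eval w)) (fun k => ?_)
      (hσ.merge hG hΓ) fun v hv => ?_
    · have := ih k _ σ _ (hG.wk _) ((hσ.incl (hΓ.incl k)).wk _)
      rw [hG.sel_wk, Ctx.dom_subst] at this
      exact this.mono fun v hv => ⟨hv.1 k, hv.2⟩
    · obtain ⟨⟨w, hw, hw'⟩, hv⟩ := hv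
      exact ⟨w, hw, (Constraint.holds_conj _ _).1 hw', by rwa [Sub.eval_wk_append]⟩
  | @dataCase Θ T c a i C Γ Δ _ ih =>
    intro H σ G Δ' hG hσ hS
    refine .dataCase (H' := fun K w => (C K).Holds w ∧ H ((Sub.wk _ Θ).eval w)) (fun K => ?_)
      fun v hv K w hw => ?_
    · have := ih K _ _ _ _ ((hG.wk _).lift _) ((hσ.wk _).lift _ _) ((hS.wk _).lift _ _)
      rw [(hG.wk _).sel_lift_insert_dom, hG.sel_wk, Ctx.dom_subst] at this
      exact this
    · exact ⟨(Constraint.holds_conj _ _).1 hv.1 K w hw, by rw [Sub.eval_wk_append]; exact hv.2⟩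
  | @comp Θ T K V S a i C C' Γs Γ' Γ Δ _ _ hΓ ihV ihS =>
    intro H σ G Δ' hG hσ hS
    refine .comp (Γs := fun k => G.sel (Γs k).dom) (Γ' := G.sel (insert none Γ'.dom))
      (H' := fun w => ((∀ k, (C k).Holds w) ∧ C'.Holds w) ∧ H ((Sub.wk _ Θ).eval w))
      (fun k => ?_) ?_ (hσ.merge_option hG hΓ) fun v hv => ?_
    · have := ihV k _ σ _ (hG.wk _) ((hσ.incl (hΓ.incl (some k))).wk _)
      rw [hG.sel_wk, Ctx.dom_subst] at this
      exact this.mono fun v hv => ⟨hv.1.1 k, hv.2⟩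
    · have := ihS _ σ _ _ (hG.wk _) ((hσ.incl (hΓ.incl none)).wk _) (hS.wk _)
      rw [hG.sel_wk, Ctx.dom_subst] at this
      exact this.mono fun v hv => ⟨hv.1.2, hv.2⟩
    · obtain ⟨⟨w, hw, hw', hw''⟩, hv⟩ := hv
      exact ⟨w, hw, ⟨(Constraint.holds_conj _ _).1 hw', hw''⟩, by rwa [Sub.eval_wk_append]⟩
  | @compCase Θ T c a i C Γ _ ih =>
    intro H σ G hG hσ
    refine .compCase (H' := fun K w => (C K).Holds w ∧ H ((Sub.wk _ Θ).eval w)) (fun K => ?_)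
      fun v hv K w hw => ?_
    -- The family is weakened by the constructor's parameters, lifted over its value variables, and
    -- then over the continuation variable, in the order in which the substitution is lifted.
    · have := ih K _ _ _ _ ((hG.wk _).lift _).covar (((hσ.wk _).lift _ _).covar .neg)
        (SSub.covar _ _ _ _)
      rw [((hG.wk _).lift _).sel_covar, (hG.wk _).sel_lift_dom, hG.sel_wk, Ctx.dom_subst] at this
      exact this
    · exact ⟨(Constraint.holds_conj _ _).1 hv.1 K w hw, by rw [Sub.eval_wk_append]; exact hv.2⟩
  | clos _ ih => exact fun H σ G hG hσ => .clos (ih H σ G hG hσ)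
  | @closCase Θ C Γ Δ c A _ ih =>
    intro H σ G Δ' hG hσ hS
    have := ih H _ _ Δ' (hG.lift fun _ => A) (hσ.lift .neg fun _ => A) (hS.lift .neg fun _ => A)
    rw [hG.sel_lift_insert_dom] at this
    exact .closCase this
  | thunkCase _ ih =>
    intro H σ G hG hσ
    have := ih H _ _ _ hG.covar (hσ.covar .pos) (SSub.covar σ H G _)
    rw [hG.sel_covar] at this
    exact .thunkCase this
  | thunk _ ih => exact fun H σ G Δ' hG hσ hS => .thunk (ih H σ G Δ' hG hσ hS)
  | bangCase hΓ _ ih =>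
    intro H σ G hG hσ
    have := ih H _ _ _ hG.covar (hσ.covar .neg) (SSub.covar σ H G _)
    rw [hG.sel_covar] at this
    exact .bangCase (hσ.sel_allShareable hG hΓ) this
  | bang _ ih => exact fun H σ G Δ' hG hσ hS => .bang (ih H σ G Δ' hG hσ hS)
  | fixCase hΓ _ ih =>
    intro H σ G hG hσ
    have := ih H _ _ _ hG.covar (hσ.covar .neg) (SSub.covar σ H G _)
    rw [hG.sel_covar] at this
    exact .fixCase (hσ.sel_allShareable hG hΓ) this
  | fix _ ih => exact fun H σ G Δ' hG hσ hS => .fix (ih H σ G Δ' hG hσ hS)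

/-! ## Substitution for the variables of a binder -/

namespace Ctx

variable {Γ Γ₁ Γ₂ : Ctx Sg Ξ Θ}

theorem Merge.swap (h : Merge ![Γ₁, Γ₂] Γ) : Merge ![Γ₂, Γ₁] Γ := by
  rw [merge_pair] at h ⊢
  exact ⟨h.2.1, h.1, fun ε i A hA => (h.2.2.1 ε i A hA).symm,
    fun ε i A h₁ h₂ => h.2.2.2 ε i A h₂ h₁⟩

/-- Associativity of splitting. An overlap between `Γ₁` and a part of `Γ₂` is already an overlap
between `Γ₁` and `Γ₂`. -/
theorem Merge.nest {ι : Type} {Γs : ι → Ctx Sg Ξ Θ} (h : Merge ![Γ₁, Γ₂] Γ) (h' : Merge Γs Γ₂) :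
    Merge (fun o : Option ι => o.elim Γ₁ Γs) Γ := by
  obtain ⟨h₁, h₂, hc, hl⟩ := merge_pair.1 h
  refine ⟨?_, fun ε i A hA => ?_, ?_⟩
  · rintro (_ | k) ε i A hA
    · exact h₁ _ _ _ hA
    · exact h₂ _ _ _ (h'.incl k _ _ _ hA)
  · rcases hc ε i A hA with hA | hA
    · exact ⟨none, hA⟩
    · obtain ⟨k, hk⟩ := h'.cover _ _ _ hA
      exact ⟨some k, hk⟩
  · rintro (_ | k) (_ | l) ε i A B hkl hA hB
    · exact absurd rfl hkl
    · replace hB := h'.incl l _ _ _ hB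
      obtain rfl : A = B := Option.some.inj ((h₁ _ _ _ hA).symm.trans (h₂ _ _ _ hB))
      exact hl _ _ _ hA hB
    · replace hA := h'.incl k _ _ _ hA
      obtain rfl : A = B := Option.some.inj ((h₂ _ _ _ hA).symm.trans (h₁ _ _ _ hB))
      exact hl _ _ _ hB hA
    · exact h'.linear k l ε i A B (fun e => hkl (e ▸ rfl)) hA hB

theorem merge_empty_left (Γ : Ctx Sg Ξ Θ) : Merge ![empty, Γ] Γ :=
  merge_pair.2 ⟨fun _ _ _ h => (nomatch h), fun _ _ _ h => h, fun _ _ _ h => .inr h,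
    fun _ _ _ h _ => (nomatch h)⟩

theorem merge_fin_zero (Γs : Fin 0 → Ctx Sg Ξ Θ) : Merge Γs empty :=
  ⟨fun k => k.elim0, fun _ _ _ h => (nomatch h), fun k => k.elim0⟩

theorem merge_fin_one (Γ : Ctx Sg Ξ Θ) : Merge (fun _ : Fin 1 => Γ) Γ :=
  ⟨fun _ _ _ _ h => h, fun _ _ _ h => ⟨0, h⟩,
    fun _ _ _ _ _ _ h => absurd (Subsingleton.elim _ _) h⟩

/-- Contraction for contexts: with `ι = Fin 2` it accounts for the two copies made by `dup`. -/
theorem AllShareable.merge {ι : Type} [Nonempty ι] (h : Γ.AllShareable) :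
    Merge (fun _ : ι => Γ) Γ :=
  ⟨fun _ _ _ _ h => h, fun _ _ _ h => ⟨Classical.arbitrary ι, h⟩,
    fun _ _ _ _ _ _ _ hA _ => h _ _ _ hA⟩

theorem Merge.subst_pair (h : Merge ![Γ₁, Γ₂] Γ) (σ : Sub P Θ Θ') :
    Merge ![Γ₁.subst σ, Γ₂.subst σ] (Γ.subst σ) := by
  convert h.subst σ using 1
  funext k
  fin_cases k <;> rfl

theorem Merge.subst_option {ι : Type} {Γs : ι → Ctx Sg Ξ Θ}
    (h : Merge (fun o : Option ι => o.elim Γ₁ Γs) Γ) (σ : Sub P Θ Θ') :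
    Merge (fun o : Option ι => o.elim (Γ₁.subst σ) fun k => (Γs k).subst σ) (Γ.subst σ) := by
  convert h.subst σ using 1
  funext o
  cases o <;> rfl

theorem push_zero (Γ : Ctx Sg Ξ Θ) (ε : Pol) (A : Fin 0 → Ty Sg Ξ Θ ε) : Γ.push ε 0 A = Γ := by
  funext ε' i
  by_cases h : ε' = ε
  · subst h; exact push_add Γ ε' i A
  · exact push_ne Γ i A h

end Ctx

section Instantiate

variable {n : ℕ}

/-- The slot to which the variable `(ε', j)` of a part of the resulting context belongs, when
terms are substituted for `n` value variables of polarity `ε` and for the stack variable; the parts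
are the context of the body, of the stack and of the values. -/
def slotOf (ε : Pol) (ε' : Pol) (j : ℕ) : Option (Option (Fin n)) → Slot
  | none => Fam.emb ε n (some (ε', j))
  | some none => none
  | some (some k) => some (ε, k)

variable {ε : Pol} {H : Valuation P Θ → Prop} {Γ Γ₁ Γ₂ Γ₃ : Ctx Sg Ξ Θ}
  {Γs : Fin n → Ctx Sg Ξ Θ} {A : Fin n → Ty Sg Ξ Θ ε} {V : Fin n → Value D ε} {σ : Subst D}
  {Δ Δ' : CoCtx Sg Ξ Θ}

theorem emb_ne_bound (ε' : Pol) (j : ℕ) (k : Fin n) :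
    Fam.emb ε n (some (ε', j)) ≠ some (ε, (k : ℕ)) := by
  intro h
  simp only [Fam.emb, Option.map_some, Option.some.injEq, Prod.mk.injEq] at h
  obtain ⟨rfl, h⟩ := h
  rw [Ren.shift_self] at h
  have := k.isLt
  omega

/-- The family of contexts for a substitution for the variables of a binder. -/
theorem exists_fam (hM : Ctx.Merge
      (fun o : Option (Option (Fin n)) => o.elim Γ₂ fun o => o.elim Γ₃ Γs) Γ)
    (hσ : ∀ ε' i, σ .val ε' i = (Subst.ids.push .val ε n V) .val ε' i)
    (hV : ∀ k, VTy H (Γs k) (V k) (A k))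
    (hS : STy H Γ₃ (σ .stk Δ.pol Δ.name) Δ.ty Δ') :
    ∃ G : Fam Sg Ξ Θ, G.Coh ∧ VSub σ H G (Γ₂.push ε n A) ∧ SSub σ H G Δ Δ' ∧
      G.sel (insert none (Γ₂.push ε n A).dom) = Γ := by
  let parts : Option (Option (Fin n)) → Ctx Sg Ξ Θ := fun o => o.elim Γ₂ fun o => o.elim Γ₃ Γs
  -- The target context is distributed over the slots: variables used by a value or by the stack go
  -- to the slot of that term, and each variable of the body gets the slot of its own shifted copy.
  let G : Fam Sg Ξ Θ := fun p => .ofRel fun ε' j B =>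
    ∃ o, p = slotOf ε ε' j o ∧ parts o ε' j = some B
  have hG : ∀ {p ε' j B}, G p ε' j = some B ↔
      ∃ o, p = slotOf ε ε' j o ∧ parts o ε' j = some B := by
    intro p ε' j B
    refine Ctx.ofRel_eq_some ?_
    rintro ε' j B B' ⟨o, -, h⟩ ⟨o', -, h'⟩
    exact Option.some.inj ((hM.incl o _ _ _ h).symm.trans (hM.incl o' _ _ _ h'))
  have hcoh : G.Coh := by
    intro p q ε' j B B' hB hB'
    obtain ⟨o, rfl, h⟩ := hG.1 hB
    obtain ⟨o', rfl, h'⟩ := hG.1 hB'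
    refine ⟨Option.some.inj ((hM.incl o _ _ _ h).symm.trans (hM.incl o' _ _ _ h')), fun hpq => ?_⟩
    -- For a fixed variable, different slots come from different parts, so linearity of the
    -- splitting gives shareability.
    exact hM.linear o o' _ _ _ _ (fun e => hpq (e ▸ rfl)) h h'
  have hnone : G none = Γ₃ := by
    refine Ctx.ext_some fun ε' j B => hG.trans ⟨?_, fun h => ⟨some none, rfl, h⟩⟩
    rintro ⟨_ | _ | k, hp, h⟩
    · cases hp
    · exact h
    · cases hp
  have hbound : ∀ k : Fin n, G (some (ε, k)) = Γs k := by
    intro k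
    refine Ctx.ext_some fun ε' j B => hG.trans ⟨?_, fun h => ⟨some (some k), rfl, h⟩⟩
    rintro ⟨_ | _ | k', hp, h⟩
    · exact absurd hp.symm (emb_ne_bound _ _ _)
    · cases hp
    · simp only [slotOf, Option.some.injEq, Prod.mk.injEq, true_and] at hp
      obtain rfl := Fin.ext hp
      exact h
  have hold : ∀ ε' j B, Γ₂ ε' j = some B →
      G (Fam.emb ε n (some (ε', j))) = .single ε' j B := by
    intro ε' j B hB
    refine Ctx.ext_some fun ε₁ j₁ B₁ => hG.trans ⟨?_, fun h => ?_⟩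
    · rintro ⟨_ | _ | k, hp, h⟩
      · obtain h' := Fam.emb_injective ε n hp
        cases h'
        obtain rfl : B = B₁ := Option.some.inj (hB.symm.trans h)
        exact Ctx.single_self _ _ _
      · cases hp
      · exact absurd hp (emb_ne_bound _ _ _)
    · obtain ⟨rfl, rfl, hBB⟩ := Ctx.of_single_eq_some h
      cases hBB
      exact ⟨none, rfl, hB⟩
  refine ⟨G, hcoh, fun ε' i B hB => ?_, ?_, Ctx.ext_some fun ε' j B => ?_⟩
  · rw [hσ]
    rcases binder_cases ε n ε' i with ⟨rfl, h⟩ | ⟨rfl, j, rfl⟩ | h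
    · rw [Ctx.push_lt _ _ _ h] at hB
      cases hB
      rw [Subst.push_lt _ _ _ _ h, hbound ⟨i, h⟩]
      exact hV _
    · rw [Ctx.push_add] at hB
      have := hold _ _ _ hB
      rw [Fam.emb, Option.map_some, Ren.shift_self] at this
      rw [Subst.push_add, this]
      exact .var _ _
    · rw [Ctx.push_ne _ _ _ h] at hB
      have := hold _ _ _ hB
      rw [Fam.emb, Option.map_some, Ren.shift_ne _ _ h] at this
      rw [Subst.push_ne_pol _ _ _ _ h, this]
      exact .var _ _
  · rw [SSub, hnone]
    exact hS
  · rw [hcoh.sel_eq_some]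
    constructor
    · rintro ⟨p, -, h⟩
      obtain ⟨o, -, h⟩ := hG.1 h
      exact hM.incl o _ _ _ h
    · intro h
      obtain ⟨o, h⟩ := hM.cover _ _ _ h
      refine ⟨_, ?_, hG.2 ⟨o, rfl, h⟩⟩
      rcases o with _ | _ | k
      · exact .inr ((Fam.emb_mem_dom_push Γ₂ A _).2 (Ctx.mem_dom h))
      · exact .inl rfl
      · exact .inr (Fam.bound_mem_dom_push Γ₂ A k k.isLt)

/-- The stack variable is replaced by itself, with an empty value context. -/
theorem CTy.bindVal {c : Command D} (hc : CTy H c (Γ₂.push ε n A) Δ)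
    (hV : ∀ k, VTy H (Γs k) (V k) (A k)) (hΓ : Ctx.Merge ![Γ₁, Γ₂] Γ) (hΓs : Ctx.Merge Γs Γ₁) :
    CTy H (c.bind .val ε n V) Γ Δ := by
  obtain ⟨C, hC, hc⟩ := hc
  obtain ⟨G, hG, hσ, hS, e⟩ := exists_fam (H := H) (σ := Subst.ids.push .val ε n V) (Δ := Δ)
    (Δ' := Δ) (hΓ.swap.nest ((Ctx.merge_empty_left Γ₁).nest hΓs)) (fun _ _ => rfl) hV (by
      rw [Subst.push_ne_side _ _ _ (by decide)]
      exact .covar _ _)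
  have := hc.substStable H _ G Δ hG hσ hS
  rw [e] at this
  exact this.mono fun v hv => ⟨hC v hv, hv⟩

theorem CTy.bindComp {c : Command D} {B : Ty Sg Ξ Θ .neg} {S : Stack D .neg}
    (hc : CTy H c (Γ₁.push ε n A) ⟨.neg, 0, B⟩) (hV : ∀ k, VTy H (Γs k) (V k) (A k))
    (hS : STy H Γ₃ S B Δ) (hΓ : Ctx.Merge ![Γ₁, Γ₂] Γ)
    (hΓs : Ctx.Merge (fun o : Option (Fin n) => o.elim Γ₃ Γs) Γ₂) :
    CTy H (c.subst ((Subst.ids.push .val ε n V).push .stk .neg 1 (fun _ => S))) Γ Δ := by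
  obtain ⟨C, hC, hc⟩ := hc
  obtain ⟨G, hG, hσ, hS, e⟩ := exists_fam (H := H)
    (σ := (Subst.ids.push .val ε n V).push .stk .neg 1 (fun _ => S)) (Δ := ⟨.neg, 0, B⟩)
    (Δ' := Δ) (hΓ.nest hΓs) (fun _ _ => Subst.push_ne_side _ _ _ (by decide)) hV (by
      rw [Subst.push_lt _ _ _ _ Nat.zero_lt_one]
      exact hS)
  have := hc.substStable H _ G Δ hG hσ hS
  rw [e] at this
  exact this.mono fun v hv => ⟨hC v hv, hv⟩

/-- The case of a binder of no value variables, whose polarity `.pos` is an arbitrary choice. -/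
theorem exists_fam_stk {B : Ty Sg Ξ Θ ε} {S : Stack D ε} (hS : STy H Γ₂ S B Δ)
    (hΓ : Ctx.Merge ![Γ₁, Γ₂] Γ) :
    ∃ G : Fam Sg Ξ Θ, G.Coh ∧ VSub (Subst.ids.push .stk ε 1 fun _ => S) H G Γ₁ ∧
      SSub (Subst.ids.push .stk ε 1 fun _ => S) H G ⟨ε, 0, B⟩ Δ ∧
      G.sel (insert none Γ₁.dom) = Γ := by
  have := exists_fam (H := H) (ε := .pos) (n := 0) (V := fun k => k.elim0) (A := fun k => k.elim0)
    (σ := Subst.ids.push .stk ε 1 fun _ => S) (Δ := ⟨ε, 0, B⟩) (Δ' := Δ)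
    (hΓ.nest ((Ctx.merge_empty_left Γ₂).swap.nest (Ctx.merge_fin_zero fun _ => .empty)))
    (fun ε' i => ?_) (fun k => k.elim0) (by
      rw [Subst.push_lt _ _ _ _ Nat.zero_lt_one]
      exact hS)
  · rwa [Ctx.push_zero] at this
  · rw [Subst.push_ne_side _ _ _ (by decide)]
    cases ε' <;> rfl

theorem CTy.bindStk {c : Command D} {B : Ty Sg Ξ Θ ε} {S : Stack D ε}
    (hc : CTy H c Γ₁ ⟨ε, 0, B⟩) (hS : STy H Γ₂ S B Δ) (hΓ : Ctx.Merge ![Γ₁, Γ₂] Γ) :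
    CTy H (c.bind₁ S) Γ Δ := by
  obtain ⟨C, hC, hc⟩ := hc
  obtain ⟨G, hG, hσ, hS, e⟩ := exists_fam_stk hS hΓ
  have := hc.substStable H _ G Δ hG hσ hS
  rw [e] at this
  exact this.mono fun v hv => ⟨hC v hv, hv⟩

theorem STy.bindStk {ε' : Pol} {S' : Stack D ε'} {A : Ty Sg Ξ Θ ε'} {B : Ty Sg Ξ Θ ε}
    {S : Stack D ε} (hS' : STy H Γ₁ S' A ⟨ε, 0, B⟩) (hS : STy H Γ₂ S B Δ)
    (hΓ : Ctx.Merge ![Γ₁, Γ₂] Γ) : STy H Γ (S'.bind₁ S) A Δ := by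
  obtain ⟨C, hC, hS'⟩ := hS'
  obtain ⟨G, hG, hσ, hS, e⟩ := exists_fam_stk hS hΓ
  have := hS'.substStable H _ G Δ hG hσ hS
  rw [e] at this
  exact this.mono fun v hv => ⟨hC v hv, hv⟩

end Instantiate

/-! ## Inversion -/

/-- The premises of the rule that introduces a value. -/
def VHead (H : Valuation P Θ → Prop) (Γ : Ctx Sg Ξ Θ) :
    {ε : Pol} → Value D ε → Ty Sg Ξ Θ ε → Prop
  | _, .var _ _ _, _ => True
  | _, .letStk c, A => CTy H c Γ ⟨.neg, 0, A⟩
  | _, .data T K V, A => ∃ (a : TArgs Sg Ξ (Sg.kinds T) Θ) (i : Sub P (Sg.indices T) Θ)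
      (Γs : Fin (D.data T K).arity → Ctx Sg Ξ Θ)
      (H' : Valuation P ((D.data T K).params ++ Θ) → Prop), A = .con T a i ∧
      (∀ k, VTy H' ((Γs k).subst (Sub.wk _ Θ)) (V k) ((D.data T K).argAt a i k)) ∧
      Ctx.Merge Γs Γ ∧
      ∀ v, H v → ∃ w, ((D.data T K).guardAt i).Holds (Var.append _ w v) ∧ H' (Var.append _ w v)
  | _, .compCase T c, A => ∃ (a : TArgs Sg Ξ (Sg.kinds T) Θ) (i : Sub P (Sg.indices T) Θ)
      (H' : ∀ K, Valuation P ((D.comp T K).params ++ Θ) → Prop), A = .con T a i ∧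
      (∀ K, CTy (H' K) (c K)
        (Ctx.push (Ctx.subst Γ (Sub.wk _ Θ)) .pos _ ((D.comp T K).argAt a i))
        ⟨.neg, 0, (D.comp T K).contAt a i⟩) ∧
      ∀ v, H v → ∀ K w, ((D.comp T K).guardAt i).Holds (Var.append _ w v) →
        H' K (Var.append _ w v)
  | _, .clos V, A => ∃ B, A = .clos B ∧ VTy H Γ V B
  | _, .thunkCase c, A => ∃ B, A = .thunk B ∧ CTy H c Γ ⟨.pos, 0, B⟩
  | _, .bangCase c, A => ∃ B, A = .bang B ∧ CTy H c Γ ⟨.neg, 0, B⟩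
  | _, .fixCase S, A => ∃ B, A = .fix B ∧ Γ.AllShareable ∧ STy H Γ S (.fix B) ⟨.neg, 0, B⟩

/-- The premises of the rule that introduces a stack. -/
def SHead (H : Valuation P Θ → Prop) (Γ : Ctx Sg Ξ Θ) (Δ : CoCtx Sg Ξ Θ) :
    {ε : Pol} → Stack D ε → Ty Sg Ξ Θ ε → Prop
  | _, .var _ _ _, _ => True
  | _, .letVal c, A => CTy H c (Γ.push .pos 1 fun _ => A) Δ
  | _, .dataCase T c, A => ∃ (a : TArgs Sg Ξ (Sg.kinds T) Θ) (i : Sub P (Sg.indices T) Θ)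
      (H' : ∀ K, Valuation P ((D.data T K).params ++ Θ) → Prop), A = .con T a i ∧
      (∀ K, CTy (H' K) (c K)
        (Ctx.push (Ctx.subst Γ (Sub.wk _ Θ)) .pos _ ((D.data T K).argAt a i))
        (Δ.subst (Sub.wk _ Θ))) ∧
      ∀ v, H v → ∀ K w, ((D.data T K).guardAt i).Holds (Var.append _ w v) →
        H' K (Var.append _ w v)
  | _, .comp T K V S, A => ∃ (a : TArgs Sg Ξ (Sg.kinds T) Θ) (i : Sub P (Sg.indices T) Θ)
      (Γs : Fin (D.comp T K).arity → Ctx Sg Ξ Θ) (Γ' : Ctx Sg Ξ Θ)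
      (H' : Valuation P ((D.comp T K).params ++ Θ) → Prop), A = .con T a i ∧
      (∀ k, VTy H' ((Γs k).subst (Sub.wk _ Θ)) (V k) ((D.comp T K).argAt a i k)) ∧
      STy H' (Γ'.subst (Sub.wk _ Θ)) S ((D.comp T K).contAt a i) (Δ.subst (Sub.wk _ Θ)) ∧
      Ctx.Merge (fun o : Option (Fin (D.comp T K).arity) => o.elim Γ' Γs) Γ ∧
      ∀ v, H v → ∃ w, ((D.comp T K).guardAt i).Holds (Var.append _ w v) ∧ H' (Var.append _ w v)
  | _, .closCase c, A => ∃ B, A = .clos B ∧ CTy H c (Γ.push .neg 1 fun _ => B) Δ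
  | _, .thunk S, A => ∃ B, A = .thunk B ∧ STy H Γ S B Δ
  | _, .bang S, A => ∃ B, A = .bang B ∧ STy H Γ S B Δ
  | _, .fix S, A => ∃ B, A = .fix B ∧ STy H Γ S B Δ

/-- Up to conversion, the judgement is the conclusion of an introduction rule. -/
def Sequent.Invertible : Sequent D Ξ → Prop
  | .val _ C Γ V B => ∀ H, (∀ v, H v → C.Holds v) → ∃ (A : _) (E : Constraint P _),
      A.Conv E.Holds B ∧ (∀ v, H v → E.Holds v) ∧ VHead H Γ V A
  | .stk _ C Γ S B Δ => ∀ H, (∀ v, H v → C.Holds v) → ∃ (A : _) (E : Constraint P _),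
      A.Conv E.Holds B ∧ (∀ v, H v → E.Holds v) ∧ SHead H Γ Δ S A
  | .cmd _ _ _ _ _ => True

/-- Conversion is the only rule for values and stacks that does not follow the term. Successive
conversions compose to one under the conjunction of their constraints. -/
theorem Derivable.invertible {s : Sequent D Ξ} (h : Derivable s) : s.Invertible := by
  have conv_trans : ∀ {Θ : PCtx P} {ε : Pol} {A B B' : Ty Sg Ξ Θ ε} {E E' : Constraint P Θ},
      A.Conv E.Holds B → B.Conv E'.Holds B' → A.Conv (E.and E').Holds B' :=
    fun h h' => (h.mono fun _ hv => hv.1).trans (h'.mono fun _ hv => hv.2)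
  induction h with
  | convVal _ hE ih =>
    intro H hH
    obtain ⟨A, E', hA, hE', h⟩ := ih H fun v hv => (hH v hv).1
    exact ⟨A, _, conv_trans hA hE, fun v hv => ⟨hE' v hv, (hH v hv).2⟩, h⟩
  | convStk _ hE ih =>
    intro H hH
    obtain ⟨A, E', hA, hE', h⟩ := ih H fun v hv => (hH v hv).1
    exact ⟨A, _, conv_trans hA hE, fun v hv => ⟨hE' v hv, (hH v hv).2⟩, h⟩
  | hide => trivial
  | cut => trivial
  | del => trivial
  | dup => trivial
  | var => exact fun H hH => ⟨_, .top, .refl _ _, fun _ _ => trivial, trivial⟩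
  | covar => exact fun H hH => ⟨_, .top, .refl _ _, fun _ _ => trivial, trivial⟩
  | letStk hc => exact fun H hH => ⟨_, .top, .refl _ _, fun _ _ => trivial, ⟨_, hH, hc⟩⟩
  | letVal hc => exact fun H hH => ⟨_, .top, .refl _ _, fun _ _ => trivial, ⟨_, hH, hc⟩⟩
  | @data Θ T K V a i C Γs Γ hV hΓ =>
    refine fun H hH => ⟨_, .top, .refl _ _, fun _ _ => trivial, a, i, Γs,
      fun w => ∀ k, (C k).Holds w, rfl, fun k => ⟨_, fun v hv => hv k, hV k⟩, hΓ, fun v hv => ?_⟩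
    obtain ⟨w, hw, hw'⟩ := hH v hv
    exact ⟨w, hw, (Constraint.holds_conj _ _).1 hw'⟩
  | @dataCase Θ T c a i C Γ Δ hc =>
    exact fun H hH => ⟨_, .top, .refl _ _, fun _ _ => trivial, a, i,
      fun K => (C K).Holds, rfl, fun K => ⟨_, fun v hv => hv, hc K⟩,
      fun v hv => (Constraint.holds_conj _ _).1 (hH v hv)⟩
  | @comp Θ T K V S a i C C' Γs Γ' Γ Δ hV hS hΓ =>
    refine fun H hH => ⟨_, .top, .refl _ _, fun _ _ => trivial, a, i, Γs, Γ',
      fun w => (∀ k, (C k).Holds w) ∧ C'.Holds w, rfl, fun k => ⟨_, fun v hv => hv.1 k, hV k⟩,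
      ⟨_, fun v hv => hv.2, hS⟩, hΓ, fun v hv => ?_⟩
    obtain ⟨w, hw, hw', hw''⟩ := hH v hv
    exact ⟨w, hw, (Constraint.holds_conj _ _).1 hw', hw''⟩
  | @compCase Θ T c a i C Γ hc =>
    exact fun H hH => ⟨_, .top, .refl _ _, fun _ _ => trivial, a, i,
      fun K => (C K).Holds, rfl, fun K => ⟨_, fun v hv => hv, hc K⟩,
      fun v hv => (Constraint.holds_conj _ _).1 (hH v hv)⟩
  -- Shareability of the context is retained here because the fixpoint survives its own reduction.
  -- For `!` it is dropped, as that value is consumed by one step.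
  | fixCase hΓ hS =>
    exact fun H hH => ⟨_, .top, .refl _ _, fun _ _ => trivial, _, rfl, hΓ, ⟨_, hH, hS⟩⟩
  | bangCase _ hc =>
    exact fun H hH => ⟨_, .top, .refl _ _, fun _ _ => trivial, _, rfl, ⟨_, hH, hc⟩⟩
  | clos h | closCase h | thunkCase h | thunk h | bang h | fix h =>
    exact fun H hH => ⟨_, .top, .refl _ _, fun _ _ => trivial, _, rfl, ⟨_, hH, h⟩⟩

/-! ## Soundness of reduction -/

section Reduction

variable {H : Valuation P Θ → Prop} {Γ Γ₁ Γ₂ : Ctx Sg Ξ Θ} {Δ : CoCtx Sg Ξ Θ} {ε : Pol}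

/-- Inversion of a cut: both sides are introduced at convertible types. -/
theorem cut_inversion {V : Value D ε} {S : Stack D ε} {A : Ty Sg Ξ Θ ε} (hV : VTy H Γ₁ V A)
    (hS : STy H Γ₂ S A Δ) :
    ∃ (B B' : Ty Sg Ξ Θ ε) (E : Constraint P Θ), B.Conv E.Holds B' ∧ (∀ v, H v → E.Holds v) ∧
      VHead H Γ₁ V B ∧ SHead H Γ₂ Δ S B' := by
  obtain ⟨C, hC, hV⟩ := hV
  obtain ⟨C', hC', hS⟩ := hS
  obtain ⟨B, E, hB, hE, hV⟩ := hV.invertible H hC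
  obtain ⟨B', E', hB', hE', hS⟩ := hS.invertible H hC'
  exact ⟨B, B', .and E E', (hB.mono fun _ hv => hv.1).trans (hB'.mono fun _ hv => hv.2).symm,
    fun v hv => ⟨hE v hv, hE' v hv⟩, hV, hS⟩

/-- Turns a weakened hypothesis back into a syntactic constraint, as the conversion rule demands. -/
theorem conv_wk_constraint {Ψ : PCtx P} {A B : Ty Sg Ξ (Ψ ++ Θ) ε} {E : Constraint P Θ}
    (h : A.Conv (fun w => E.Holds ((Sub.wk Ψ Θ).eval w)) B) :
    A.Conv (E.subst (Sub.wk Ψ Θ)).Holds B :=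
  h.mono fun _ hw => (Constraint.holds_subst _ _ _).1 hw

/-- The constructor supplies the witnesses for its parameters and the pattern match supplies a
branch valid for all of them. The arguments are converted to the types expected by the branch before
substitution. -/
theorem CTy.step_data {T : Sg.TCon .pos} {K : Fin (D.numData T)}
    {V : Fin (D.data T K).arity → Value D .pos} {c : Fin (D.numData T) → Command D}
    {A : Ty Sg Ξ Θ .pos} (hV : VTy H Γ₁ (.data T K V) A) (hS : STy H Γ₂ (.dataCase T c) A Δ)
    (hΓ : Ctx.Merge ![Γ₁, Γ₂] Γ) : CTy H ((c K).bind .val .pos _ V) Γ Δ := by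
  obtain ⟨B, B', E, hB, hE, hV, hS⟩ := cut_inversion hV hS
  obtain ⟨a, i, Γs, HV, rfl, hV, hΓs, hHV⟩ := hV
  obtain ⟨b, j, HS, rfl, hc, hHS⟩ := hS
  cases hB with
  | con _ ha hi =>
  have hij : ∀ v, E.Holds v → i.eval v = j.eval v := fun v hv => by
    funext s x; exact hi v hv s x
  refine CTy.hide (Ψ := (D.data T K).params)
    (H' := fun w => HV w ∧ HS K w ∧ E.Holds ((Sub.wk _ Θ).eval w)) ?_ fun v hv => ?_
  · refine CTy.bindVal ((hc K).mono fun w hw => hw.2.1) (fun k => ?_) (hΓ.subst_pair _)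
      (hΓs.subst _)
    exact ((hV k).mono fun w hw => hw.1).conv
      (conv_wk_constraint ((D.data T K).conv_argAt ha hij k)) fun w hw =>
        (Constraint.holds_subst _ _ _).2 hw.2.2
  -- The hidden parameters receive the values `w` chosen by the constructor. Its guard, transported
  -- along the equality of indices, discharges the hypothesis of the branch.
  · obtain ⟨w, hw, hw'⟩ := hHV v hv
    refine ⟨w, hw', hHS v hv K w ?_, ?_⟩
    · exact ((D.data T K).guardAt_congr (hij v (hE v hv))).1 hw
    · rw [Sub.eval_wk_append]
      exact hE v hv

/-- Dual to `CTy.step_data`: the stack supplies the parameters and the value supplies the branches,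
so the conversion is used in the opposite direction and also applied to the continuation. -/
theorem CTy.step_comp {T : Sg.TCon .neg} {K : Fin (D.numComp T)}
    {V : Fin (D.comp T K).arity → Value D .pos} {S : Stack D .neg}
    {c : Fin (D.numComp T) → Command D} {A : Ty Sg Ξ Θ .neg} (hV : VTy H Γ₁ (.compCase T c) A)
    (hS : STy H Γ₂ (.comp T K V S) A Δ) (hΓ : Ctx.Merge ![Γ₁, Γ₂] Γ) :
    CTy H ((c K).subst ((Subst.ids.push .val .pos _ V).push .stk .neg 1 (fun _ => S))) Γ Δ := by
  obtain ⟨B, B', E, hB, hE, hV, hS⟩ := cut_inversion hV hS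
  obtain ⟨a, i, HV, rfl, hc, hHV⟩ := hV
  obtain ⟨b, j, Γs, Γ', HS, rfl, hV, hS, hΓs, hHS⟩ := hS
  cases hB.symm with
  | con _ ha hi =>
  have hij : ∀ v, E.Holds v → j.eval v = i.eval v := fun v hv => by
    funext s x; exact hi v hv s x
  refine CTy.hide (Ψ := (D.comp T K).params)
    (H' := fun w => HV K w ∧ HS w ∧ E.Holds ((Sub.wk _ Θ).eval w)) ?_ fun v hv => ?_
  · refine CTy.bindComp (Γs := fun k => (Γs k).subst (Sub.wk _ Θ)) (Γ₃ := Γ'.subst (Sub.wk _ Θ))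
      ((hc K).mono fun w hw => hw.1) (fun k => ?_) ?_ (hΓ.subst_pair _) (hΓs.subst_option _)
    · exact ((hV k).mono fun w hw => hw.2.1).conv
        (conv_wk_constraint ((D.comp T K).conv_argAt ha hij k)) fun w hw =>
          (Constraint.holds_subst _ _ _).2 hw.2.2
    · exact (hS.mono fun w hw => hw.2.1).conv
        (conv_wk_constraint ((D.comp T K).conv_contAt ha hij)) fun w hw =>
          (Constraint.holds_subst _ _ _).2 hw.2.2
  · obtain ⟨w, hw, hw'⟩ := hHS v hv
    refine ⟨w, hHV v hv K w ?_, hw', ?_⟩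
    · exact ((D.comp T K).guardAt_congr (hij v (hE v hv))).1 hw
    · rw [Sub.eval_wk_append]
      exact hE v hv

theorem CTy.step_cut {V : Value D ε} {S : Stack D ε} {A : Ty Sg Ξ Θ ε} {c' : Command D}
    (hV : VTy H Γ₁ V A) (hS : STy H Γ₂ S A Δ) (hΓ : Ctx.Merge ![Γ₁, Γ₂] Γ)
    (h : Step (.cut ε V S) c') : CTy H c' Γ Δ := by
  have inv := cut_inversion hV hS
  cases h with
  | letStk c S =>
    obtain ⟨C, hC, hV⟩ := hV
    -- Only the binding side is inverted; the stack may have any form and is converted to the type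
    -- of the bound variable.
    obtain ⟨B, E, hB, hE, hc⟩ := hV.invertible H hC
    exact CTy.bindStk hc (hS.conv hB.symm hE) hΓ
  | letVal V c =>
    obtain ⟨C, hC, hS⟩ := hS
    obtain ⟨B, E, hB, hE, hc⟩ := hS.invertible H hC
    exact CTy.bindVal hc (fun _ => hV.conv hB.symm hE) hΓ (Ctx.merge_fin_one Γ₁)
  | clos V c =>
    obtain ⟨_, _, E, hB, hE, ⟨B, rfl, hV⟩, B', rfl, hc⟩ := inv
    cases hB with
    | clos hB =>
    exact CTy.bindVal hc (fun _ => hV.conv hB hE) hΓ (Ctx.merge_fin_one Γ₁)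
  | thunk c S =>
    obtain ⟨_, _, E, hB, hE, ⟨B, rfl, hc⟩, B', rfl, hS⟩ := inv
    cases hB with
    | thunk hB =>
    exact CTy.bindStk hc (hS.conv hB.symm hE) hΓ
  | data T K V c => exact CTy.step_data hV hS hΓ
  | comp T K V S c => exact CTy.step_comp hV hS hΓ
  | bang c S =>
    obtain ⟨_, _, E, hB, hE, ⟨B, rfl, hc⟩, B', rfl, hS⟩ := inv
    cases hB with
    | bang hB =>
    exact CTy.bindStk hc (hS.conv hB.symm hE) hΓ
  | fix S S' =>
    obtain ⟨_, _, E, hB, hE, ⟨B, rfl, hΓ₁, hS⟩, B', rfl, hS'⟩ := inv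
    cases hB with
    | fix hB =>
    obtain ⟨h₁, -, -, -⟩ := Ctx.merge_pair.1 hΓ
    -- The body of the fixpoint now occurs twice: the new stack uses all of `Γ`, and the retained
    -- value uses `Γ₁` again. This is a legitimate splitting of `Γ` because `Γ₁` is shareable.
    refine CTy.cut (VTy.fixCase hΓ₁ hS) (STy.bindStk hS (hS'.conv hB.symm hE) hΓ) ?_
    exact Ctx.merge_pair.2 ⟨h₁, fun _ _ _ h => h, fun _ _ _ h => .inr h,
      fun _ _ _ h _ => hΓ₁ _ _ _ h⟩

end Reduction

/-- A context that is included in a weakened one is itself weakened. -/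
theorem Ctx.Incl.exists_subst {Γ : Ctx Sg Ξ Θ} {σ : Sub P Θ Θ'} {Γ' : Ctx Sg Ξ Θ'}
    (h : Γ'.Incl (Γ.subst σ)) : ∃ Γ₀ : Ctx Sg Ξ Θ, Γ₀.Incl Γ ∧ Γ₀.subst σ = Γ' := by
  refine ⟨fun ε i => if (Γ' ε i).isSome then Γ ε i else none, fun ε i A hA => ?_, ?_⟩
  · exact (Option.ite_none_right_eq_some.1 hA).2
  · funext ε i
    cases e : Γ' ε i with
    | none => simp [Ctx.subst, e]
    | some B => simpa [Ctx.subst, e] using h ε i B e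

/-- Subject reduction, for judgements about commands. -/
def Sequent.Reduces : Sequent D Ξ → Prop
  | .cmd c _ C Γ Δ => ∀ c', Step c c' → ∃ Γ', Γ'.Incl Γ ∧ CTy C.Holds c' Γ' Δ
  | _ => True

/-- Hiding is handled by the induction hypothesis. A context included in the weakened `Γ` cannot
mention the hidden parameters, so they can be hidden again after the step. -/
theorem Derivable.reduces {s : Sequent D Ξ} (h : Derivable s) : s.Reduces := by
  induction h with
  | hide _ ih =>
    intro c' hstep
    obtain ⟨Γ', hΓ', hc'⟩ := ih c' hstep
    obtain ⟨Γ₀, hΓ₀, rfl⟩ := hΓ'.exists_subst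
    exact ⟨Γ₀, hΓ₀, hc'.hide fun v hv => hv⟩
  | cut hV hS hΓ =>
    exact fun c' hstep => ⟨_, fun _ _ _ h => h, CTy.step_cut ⟨_, fun v hv => hv.1, hV⟩
      ⟨_, fun v hv => hv.2, hS⟩ hΓ hstep⟩
  | del _ _ hc hΓ =>
    intro c' hstep
    cases hstep
    -- The variables used only by the deleted value disappear. Apart from inclusions inherited
    -- through hiding, this is the one place where the context shrinks.
    exact ⟨_, hΓ.incl 1, _, fun v hv => hv.2, hc⟩
  | dup hV hA hc hΓ =>
    intro c' hstep
    cases hstep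
    have hV' : VTy _ _ _ _ := ⟨_, fun v hv => hv, hV⟩
    exact ⟨_, fun _ _ _ h => h, CTy.bindVal ⟨_, fun v hv => hv.2, hc⟩
      -- Both copies of the value are typed in the same context, which is shareable and hence the
      -- union of two copies of itself.
      (fun _ => hV'.mono fun v hv => hv.1) hΓ (hV'.allShareable hA).merge⟩
  | _ => trivial

end ILL

theorem theorem1 {P : ILL.ParamTheory} {Sg : ILL.TypeSig P} {D : ILL.Decls Sg}
    {Ξ : List (ILL.Kind P)} {Θ : ILL.PCtx P} {C : ILL.Constraint P Θ}
    {Γ : ILL.Ctx Sg Ξ Θ} {Δ : ILL.CoCtx Sg Ξ Θ} {c c' : ILL.Command D}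
    (hc : ILL.TypedCommand c Θ C Γ Δ) (hred : ILL.Step c c') :
    ∃ (Θ' : ILL.PCtx P) (ι : ILL.ParamIncl Θ' Θ) (C' : ILL.Constraint P Θ')
      (Γ' : ILL.Ctx Sg Ξ Θ') (Δ' : ILL.CoCtx Sg Ξ Θ'),
      ILL.TypedCommand c' Θ' C' Γ' Δ' ∧
      (Γ'.subst ι.sub).Incl Γ ∧
      Δ = Δ'.subst ι.sub ∧
      ∀ v : ILL.Valuation P Θ, C.Holds v → C'.Holds (ι.restrict v) := by
  obtain ⟨Γ', hΓ', C', hC', hc'⟩ := ILL.Derivable.reduces hc c' hred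
  have e : ILL.ParamIncl.sub ⟨fun _ x => x, fun _ _ _ h => h⟩ = ILL.Sub.ids Θ := rfl
  -- The constructor parameters introduced by a step have been hidden again, so the identity
  -- inclusion of `Θ` suffices.
  refine ⟨Θ, ⟨fun _ x => x, fun _ _ _ h => h⟩, C', Γ', Δ, hc', ?_, ?_, hC'⟩
  · rwa [e, ILL.Ctx.subst_ids]
  · rw [e, ILL.CoCtx.subst, ILL.Ty.subst_ids]
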